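/- **Setting.** Let $\Gamma\subset\mathbb R^d$ be a finite connected network: $\mathbf V=\{\mathrm v_1,\dots,\mathrm v_N\}\subset\mathbb R^d$ is a finite set of distinct vertices; $\mathbf E$ is a finite set of edges, each of which is an open straight segment $E=(\mathrm v_i,\mathrm v_j)$ with $i<j$ and $\bar E\cap\mathbf V=\{\mathrm v_i,\mathrm v_j\}$; distinct edges are disjoint; every vertex belongs to some $\bar E$; and $\Gamma=\bigcup_{E\in\mathbf E}\bar E$ is connected. Put $\ell_E=|\mathrm v_i-\mathrm v_j|$ and $\gamma_E(t)=\mathrm v_i+t(\mathrm v_j-\mathrm v_i)/\ell_E$ for $t\in[0,\ell_E]$. Let $\mathrm{Inc}(\mathrm v)=\{E\in\mathbf E:\mathrm v\in\bar E\}$ and $N_{\mathrm v}=\#\mathrm{Inc}(\mathrm v)$; the interior vertices $\mathbf V_{\mathbf i}$ are those with $N_{\mathrm v}>1$, the boundary vertices $\mathbf V_{\mathbf b}$ those with $N_{\mathrm v}=1$. $C^2(\Gamma)$ is the set of continuous $\varphi:\Gamma\to\mathbb R$ such that $\varphi\circ\gamma_E\in C^2([0,\ell_E])$ for all $E\in\mathbf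 E$. For $x=\gamma_E(t)\in\bar E$ write $\varphi_{x_E}(x)=(\varphi\circ\gamma_E)'(t)$ and $\varphi_{x_Ex_E}(x)=(\varphi\circ\gamma_E)''(t)$ (one-sided at the end points). For $E\in \mathrm{Inc}(\mathrm v)$ let $\partial_E\varphi(\mathrm v)=\lim_{x\to\mathrm v,\,x\in E}(\varphi(x)-\varphi(\mathrm v))/|x-\mathrm v|$ be the inward derivative, and $\boldsymbol{\partial\varphi}(\mathrm v)=(\partial_E\varphi(\mathrm v))_{E\in\mathrm{Inc}(\mathrm v)}$. **Problem.** Given $\lambda>0$, $a_E:\bar E\to[0,\infty)$, $H_E:\bar E\times\mathbb R\to\mathbb R$ for $E\in\mathbf E$, continuous $F^{\mathrm v}:\mathbb R\times\mathbb R^{N_{\mathrm v}}\to\mathbb R$ for $\mathrm v\in\mathbf V_{\mathbf i}$, and $h_{\mathrm v}\in\mathbb R$ for $\mathrm v\in\mathbf V_{\mathbf b}$, consider $$\lambda u-a_E(x)u_{xx}+H_E(x,u_x)=0 \text{ on } E\in\mathbf E,\qquad F^{\mathrm v}(u(\mathrm v),\boldsymbol{\partial u}(\mathrm v))=0,\ \mathrm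 v\in\mathbf V_{\mathbf i},\qquad u(\mathrm v)=h_{\mathrm v},\ \mathrm v\in\mathbf V_{\mathbf b}.\tag{P}$$ Let $G_E(r,p,X,x)=\lambda r-a_E(x)X+H_E(x,p)$. An upper semicontinuous $u:\Gamma\to\mathbb R$ is a viscosity subsolution of (P) if, whenever $\varphi\in C^2(\Gamma)$ and $u-\varphi$ has a local maximum on $\Gamma$ at $x$, - $G_E(u(x),\varphi_{x_E}(x),\varphi_{x_Ex_E}(x),x)\le0$ if $x\in E$; - $\min\{\min_{E\in\mathrm{Inc}(x)}G_E(u(x),\varphi_{x_E}(x),\varphi_{x_Ex_E}(x),x),\ F^{x}(u(x),\boldsymbol{\partial\varphi}(x))\}\le0$ if $x\in\mathbf V_{\mathbf i}$; - $\min\{G_E(u(x),\varphi_{x_E}(x),\varphi_{x_Ex_E}(x),x),\ u(x)-h_x\}\le0$ if $x\in\mathbf V_{\mathbf b}$ and $\mathrm{Inc}(x)=\{E\}$. A lower semicontinuous $v:\Gamma\to\mathbb R$ is a viscosity supersolution of (P) if the same holds with $v$, local minima, $\max$ and $\ge0$ in place of $u$, local maxima, $\min$ and $\le0$. **Theorem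 5.4.** Assume that 1. for each $E\in\mathbf E$ there is $C$ such that $|H_E(x,p)-H_E(y,p)|\le C(1+|p|)|x-y|$ and $|H_E(x,p)-H_E(x,q)|\le C|p-q|$ for all $x,y\in\bar E$, $p,q\in\mathbb R$; 2. for each $E\in\mathbf E$, $a_E=\sigma_E^2$ on $\bar E$ for some Lipschitz function $\sigma_E:\bar E\to\mathbb R$; 3. for each $\mathrm v\in\mathbf V_{\mathbf i}$: if $r\ge s$ and $p_E\le q_E$ for all $E \in \mathrm{Inc}(\mathrm v)$, then $F^{\mathrm v}(r,p)\ge F^{\mathrm v}(s,q)$, with strict inequality if moreover $p_E<q_E$ for some $E$; and $F^{\mathrm v}(r,p)\to+\infty$ when one component $p_E\to-\infty$, $r$ and the other components being fixed; 4. for each $\mathrm v\in\mathbf V$ and each $E\in\mathrm{Inc}(\mathrm v)$, either there are $C>0$ and a neighborhood of $\mathrm v$ in $\bar E$ on which $H_E(x,p)\ge C^{-1}|p|-C$ for all $p\in\mathbb R$, or $a_E(\mathrm v)>0$. Let $u$ be a bounded viscosity subsolution and $v$ a bounded viscosity supersolution of (P). Then $u\le v$ on $\Gamma\setminus\mathbf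 V_{\mathbf b}$. Moreover, if $\tilde u$ is defined by $\tilde u=u$ on $\Gamma\setminus\mathbf V_{\mathbf b}$ and $\tilde u(\mathrm v)=\limsup_{x\to\mathrm v,\,x\in E}u(x)$ for $\mathrm v\in\mathbf V_{\mathbf b}$, $\mathrm{Inc}(\mathrm v)=\{E\}$, then $\tilde u\le v$ on $\Gamma$. -/

import Mathlib

open Set Filter Topology

noncomputable section

/-- A finite connected network embedded in `ℝ^d`: finitely many labelled vertices, and edges which
are open straight segments joining two vertices.  An edge is recorded by the pair `(i, j)` of the
labels of its end points, `i < j`, which also fixes its orientation. -/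
structure EmbeddedNetwork (d : ℕ) where
  /-- number of vertices -/
  numVert : ℕ
  /-- position of the vertices -/
  vert : Fin numVert → EuclideanSpace ℝ (Fin d)
  vert_injective : Function.Injective vert
  edges : Finset (Fin numVert × Fin numVert)
  edges_lt : ∀ e ∈ edges, e.1 < e.2
  /-- the only vertices on a closed edge are its two end points -/
  segment_inter_vert : ∀ e ∈ edges,
    segment ℝ (vert e.1) (vert e.2) ∩ range vert = {vert e.1, vert e.2}
  /-- distinct open edges do not meet -/
  disjoint_edges : ∀ e ∈ edges, ∀ f ∈ edges, e ≠ f →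
    Disjoint (openSegment ℝ (vert e.1) (vert e.2)) (openSegment ℝ (vert f.1) (vert f.2))
  /-- every vertex is an end point of some edge -/
  exists_incident : ∀ i, ∃ e ∈ edges, vert i ∈ segment ℝ (vert e.1) (vert e.2)
  connected : IsConnected (⋃ e ∈ edges, segment ℝ (vert e.1) (vert e.2))

namespace EmbeddedNetwork

variable {d : ℕ} (Γ : EmbeddedNetwork d)

/-- The type of labels of the vertices. -/
abbrev Vertex : Type := Fin Γ.numVert

/-- The type of edges. -/
abbrev Edge : Type := {e : Fin Γ.numVert × Fin Γ.numVert // e ∈ Γ.edges}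

variable {Γ} in
/-- The initial point `v_i` of the edge `(i, j)`. -/
def source (e : Γ.Edge) : EuclideanSpace ℝ (Fin d) := Γ.vert e.1.1

variable {Γ} in
/-- The final point `v_j` of the edge `(i, j)`. -/
def target (e : Γ.Edge) : EuclideanSpace ℝ (Fin d) := Γ.vert e.1.2

variable {Γ} in
/-- The open edge `E`. -/
def openEdge (e : Γ.Edge) : Set (EuclideanSpace ℝ (Fin d)) := openSegment ℝ (source e) (target e)

variable {Γ} in
/-- The closed edge, i.e. the closure of `E`. -/
def closedEdge (e : Γ.Edge) : Set (EuclideanSpace ℝ (Fin d)) := segment ℝ (source e) (target e)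

/-- The network as a subset of `ℝ^d`: the union of the closed edges. -/
def carrier : Set (EuclideanSpace ℝ (Fin d)) := ⋃ e : Γ.Edge, closedEdge e

variable {Γ} in
/-- The length `ℓ_E`. -/
def length (e : Γ.Edge) : ℝ := dist (source e) (target e)

variable {Γ} in
/-- The parametrization by arc length `γ_E(t) = v_i + t (v_j - v_i) / ℓ_E`, for `t ∈ [0, ℓ_E]`. -/
def param (e : Γ.Edge) (t : ℝ) : EuclideanSpace ℝ (Fin d) :=
  source e + (t / length e) • (target e - source e)

variable {Γ} in
/-- The coordinate `x_E ∈ [0, ℓ_E]` of a point `x` of the closed edge, i.e. `γ_E(x_E) = x`. -/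
def coord (e : Γ.Edge) (x : EuclideanSpace ℝ (Fin d)) : ℝ := dist (source e) x

/-- The edges incident to a vertex. -/
abbrev Inc (i : Γ.Vertex) : Type := {e : Γ.Edge // Γ.vert i ∈ closedEdge e}

/-- Interior vertices: those with more than one incident edge. -/
def IsInteriorVertex (i : Γ.Vertex) : Prop := 1 < Nat.card (Γ.Inc i)

/-- Boundary vertices: those with exactly one incident edge. -/
def IsBoundaryVertex (i : Γ.Vertex) : Prop := Nat.card (Γ.Inc i) = 1

/-- The set `V_b` of the boundary vertices, as points of the network. -/
def boundaryVertices : Set (EuclideanSpace ℝ (Fin d)) := Γ.vert '' {i | Γ.IsBoundaryVertex i}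

/-! Functions on the network are represented by functions on `ℝ^d`; all the notions below depend
only on their values on the network. -/

variable {Γ} in
/-- The function `φ_E = φ ∘ γ_E` of the arc length (to be considered on `[0, ℓ_E]`). -/
def onEdge (e : Γ.Edge) (φ : EuclideanSpace ℝ (Fin d) → ℝ) (t : ℝ) : ℝ := φ (param e t)

/-- The space `C²(Γ)`: continuous functions on the network whose restriction to each closed edge
is `C²` up to the end points. -/
def IsC2 (φ : EuclideanSpace ℝ (Fin d) → ℝ) : Prop :=
  ContinuousOn φ Γ.carrier ∧ ∀ e : Γ.Edge, ContDiffOn ℝ 2 (onEdge e φ) (Icc 0 (length e))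

variable {Γ} in
/-- The derivative `φ_{x_E}(x)` with respect to the arc length coordinate at a point `x` of the
closed edge (one-sided at the end points). -/
def dEdge (e : Γ.Edge) (φ : EuclideanSpace ℝ (Fin d) → ℝ) (x : EuclideanSpace ℝ (Fin d)) : ℝ :=
  derivWithin (onEdge e φ) (Icc 0 (length e)) (coord e x)

variable {Γ} in
/-- The second derivative `φ_{x_E x_E}(x)`. -/
def ddEdge (e : Γ.Edge) (φ : EuclideanSpace ℝ (Fin d) → ℝ) (x : EuclideanSpace ℝ (Fin d)) : ℝ :=
  derivWithin (derivWithin (onEdge e φ) (Icc 0 (length e))) (Icc 0 (length e)) (coord e x)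

/-- The inward derivative `∂_E φ(v) = lim_{x → v, x ∈ E} (φ(x) - φ(v)) / ρ(x, v)` at an end point
`v` of `E`: it is `φ_{x_E}(v)` at the initial point and `-φ_{x_E}(v)` at the final point. -/
def inwardDeriv (i : Γ.Vertex) (φ : EuclideanSpace ℝ (Fin d) → ℝ) (e : Γ.Inc i) : ℝ :=
  if e.1.1.1 = i then dEdge e.1 φ (Γ.vert i) else -dEdge e.1 φ (Γ.vert i)

open Classical in
/-- `ũ`: the function equal to `u` off the boundary vertices, and to
`limsup_{x → v, x ∈ E} u(x)` at a boundary vertex `v`, where `E` is the edge incident to `v`. -/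
def uscExtension (u : EuclideanSpace ℝ (Fin d) → ℝ) (x : EuclideanSpace ℝ (Fin d)) : ℝ :=
  if x ∈ Γ.boundaryVertices then
    limsup u (𝓝[⋃ e : {e : Γ.Edge // x ∈ closedEdge e}, openEdge e.1] x)
  else u x

/-! ### Assumptions on the data -/

variable {Γ} in
/-- Lipschitz regularity of the Hamiltonian on a closed edge. -/
def HamiltonianRegular (e : Γ.Edge) (H : EuclideanSpace ℝ (Fin d) → ℝ → ℝ) : Prop :=
  ∃ C : ℝ, (∀ x ∈ closedEdge e, ∀ y ∈ closedEdge e, ∀ p : ℝ,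
      |H x p - H y p| ≤ C * (1 + |p|) * ‖x - y‖) ∧
    (∀ x ∈ closedEdge e, ∀ p q : ℝ, |H x p - H x q| ≤ C * |p - q|)

variable {Γ} in
/-- Coercivity of the Hamiltonian in a neighbourhood of `z` in the closed edge. -/
def CoerciveNear (e : Γ.Edge) (H : EuclideanSpace ℝ (Fin d) → ℝ → ℝ)
    (z : EuclideanSpace ℝ (Fin d)) : Prop :=
  ∃ C : ℝ, 0 < C ∧ ∀ᶠ x in 𝓝[closedEdge e] z, ∀ p : ℝ, C⁻¹ * |p| - C ≤ H x p

variable {Γ} in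
/-- The diffusion coefficient is the square of a Lipschitz function on the closed edge. -/
def DiffusionRegular (e : Γ.Edge) (a : EuclideanSpace ℝ (Fin d) → ℝ) : Prop :=
  ∃ (σ : EuclideanSpace ℝ (Fin d) → ℝ) (C : ℝ), (∀ x ∈ closedEdge e, a x = σ x ^ 2) ∧
    ∀ x ∈ closedEdge e, ∀ y ∈ closedEdge e, |σ x - σ y| ≤ C * ‖x - y‖

/-- The assumptions on the Kirchhoff nonlinearity `F^v : ℝ × ℝ^{N_v} → ℝ`: continuity, (strict)
monotonicity, and `F^v → +∞` as one of the derivatives tends to `-∞`. -/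
structure IsKirchhoff (i : Γ.Vertex) (F : ℝ × (Γ.Inc i → ℝ) → ℝ) : Prop where
  continuous : Continuous F
  mono : ∀ (r s : ℝ) (p q : Γ.Inc i → ℝ), s ≤ r → (∀ e, p e ≤ q e) → F (s, q) ≤ F (r, p)
  strict : ∀ (r s : ℝ) (p q : Γ.Inc i → ℝ), s ≤ r → (∀ e, p e ≤ q e) → (∃ e, p e < q e) →
    F (s, q) < F (r, p)
  tendsto : ∀ (e : Γ.Inc i) (r : ℝ) (p : Γ.Inc i → ℝ),
    Tendsto (fun t : ℝ => F (r, Function.update p e t)) atBot atTop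

/-! ### Viscosity sub- and supersolutions -/

/-- `G_E(r, p, X, x) = λ r - a_E(x) X + H_E(x, p)`. -/
def edgeOp (lam : ℝ) (a : Γ.Edge → EuclideanSpace ℝ (Fin d) → ℝ)
    (H : Γ.Edge → EuclideanSpace ℝ (Fin d) → ℝ → ℝ) (e : Γ.Edge) (r p X : ℝ)
    (x : EuclideanSpace ℝ (Fin d)) : ℝ :=
  lam * r - a e x * X + H e x p

/-- Viscosity subsolutions of the problem `λu - a_E u_xx + H_E(x, u_x) = 0` on the edges,
`F^v(u, ∂u) = 0` at the interior vertices, `u = h_v` at the boundary vertices.  A minimum of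
finitely many quantities is `≤ 0` if and only if one of them is. -/
structure IsViscositySubsolution (lam : ℝ) (a : Γ.Edge → EuclideanSpace ℝ (Fin d) → ℝ)
    (H : Γ.Edge → EuclideanSpace ℝ (Fin d) → ℝ → ℝ)
    (F : ∀ i : Γ.Vertex, ℝ × (Γ.Inc i → ℝ) → ℝ) (h : Γ.Vertex → ℝ)
    (u : EuclideanSpace ℝ (Fin d) → ℝ) : Prop where
  usc : UpperSemicontinuousOn u Γ.carrier
  edge : ∀ φ, Γ.IsC2 φ → ∀ (e : Γ.Edge), ∀ x ∈ openEdge e,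
    IsLocalMaxOn (fun y => u y - φ y) Γ.carrier x →
      Γ.edgeOp lam a H e (u x) (dEdge e φ x) (ddEdge e φ x) x ≤ 0
  interior : ∀ φ, Γ.IsC2 φ → ∀ i, Γ.IsInteriorVertex i →
    IsLocalMaxOn (fun y => u y - φ y) Γ.carrier (Γ.vert i) →
      (∃ e : Γ.Inc i, Γ.edgeOp lam a H e.1 (u (Γ.vert i)) (dEdge e.1 φ (Γ.vert i))
        (ddEdge e.1 φ (Γ.vert i)) (Γ.vert i) ≤ 0) ∨
      F i (u (Γ.vert i), Γ.inwardDeriv i φ) ≤ 0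
  boundary : ∀ φ, Γ.IsC2 φ → ∀ i, Γ.IsBoundaryVertex i →
    IsLocalMaxOn (fun y => u y - φ y) Γ.carrier (Γ.vert i) →
      (∃ e : Γ.Inc i, Γ.edgeOp lam a H e.1 (u (Γ.vert i)) (dEdge e.1 φ (Γ.vert i))
        (ddEdge e.1 φ (Γ.vert i)) (Γ.vert i) ≤ 0) ∨
      u (Γ.vert i) - h i ≤ 0

/-- Viscosity supersolutions of the same problem. -/
structure IsViscositySupersolution (lam : ℝ) (a : Γ.Edge → EuclideanSpace ℝ (Fin d) → ℝ)
    (H : Γ.Edge → EuclideanSpace ℝ (Fin d) → ℝ → ℝ)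
    (F : ∀ i : Γ.Vertex, ℝ × (Γ.Inc i → ℝ) → ℝ) (h : Γ.Vertex → ℝ)
    (v : EuclideanSpace ℝ (Fin d) → ℝ) : Prop where
  lsc : LowerSemicontinuousOn v Γ.carrier
  edge : ∀ φ, Γ.IsC2 φ → ∀ (e : Γ.Edge), ∀ x ∈ openEdge e,
    IsLocalMinOn (fun y => v y - φ y) Γ.carrier x →
      0 ≤ Γ.edgeOp lam a H e (v x) (dEdge e φ x) (ddEdge e φ x) x
  interior : ∀ φ, Γ.IsC2 φ → ∀ i, Γ.IsInteriorVertex i →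
    IsLocalMinOn (fun y => v y - φ y) Γ.carrier (Γ.vert i) →
      (∃ e : Γ.Inc i, 0 ≤ Γ.edgeOp lam a H e.1 (v (Γ.vert i)) (dEdge e.1 φ (Γ.vert i))
        (ddEdge e.1 φ (Γ.vert i)) (Γ.vert i)) ∨
      0 ≤ F i (v (Γ.vert i), Γ.inwardDeriv i φ)
  boundary : ∀ φ, Γ.IsC2 φ → ∀ i, Γ.IsBoundaryVertex i →
    IsLocalMinOn (fun y => v y - φ y) Γ.carrier (Γ.vert i) →
      (∃ e : Γ.Inc i, 0 ≤ Γ.edgeOp lam a H e.1 (v (Γ.vert i)) (dEdge e.1 φ (Γ.vert i))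
        (ddEdge e.1 φ (Γ.vert i)) (Γ.vert i)) ∨
      0 ≤ v (Γ.vert i) - h i

end EmbeddedNetwork

end

/-! ### Convex functions given by subgradients, and semiconvex functions -/

/-! Suppose that `ũ - v` has a positive maximum `M` on the network. Everything is expressed through
`w = -v`, a subsolution of the dual problem, so that one-sided lemmas serve both functions.

Inside an edge the maximum is impossible by `interior_comparison`: doubling of variables shows that
`lam * (u - v) ≤ C * |κ|` at a local maximum of `u - v + κ t`. The second order part works in one
dimension: sup-convolutions are convex, their subgradients are monotone and hence differentiable
almost everywhere, and a one-dimensional Jensen lemma (`exists_isMaxOn_notMem_null`) finds a maximum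
point of a linear perturbation at which both are differentiable. So `M` is attained only at
vertices. Applied with a small `κ > 0`, the same estimate shows that `u - v` decays at least
linearly away from such a vertex (`exists_linear_decay`).

At a vertex a slope is called admissible along an edge (`Admits`) if it belongs to a test function
for which the edge inequality fails. If the slopes on all incident edges are admissible, the vertex
condition itself must hold (`of_admits`). At an interior vertex `exists_admits_pair` separates the
two functions: on every edge there are slopes `r < r'`, admissible for `u` and `v` respectively.
Then `F (u, r) ≤ 0 ≤ F (v, r')`, while `u > v` and strict monotonicity give `F (v, r') < F (u, r)`.
For a nondegenerate edge the separation comes from the linear decay, since any slope above the upper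
slope of `u` is admissible. For a degenerate edge the upper slope `p` of `u` satisfies `lam u + H(0,
p) ≤ 0`, the lower slope `q ≥ p` of `v`, if finite, satisfies `lam v + H(0, q) ≥ 0`, and the
intermediate value theorem together with `lam (u - v) = M lam > 0` supplies `r` and `r'` in between.

At a boundary vertex admissible slopes exist for `u`, whence `u ≤ h`, and for `v`, whence `v ≥ h`;
thus `ũ ≤ u ≤ h ≤ v`. Replacing `u` by `ũ` is essential for the second inequality: it makes the
value at the vertex a limit along the edge. -/

theorem continuous_of_subgradient {f D : ℝ → ℝ} (hf : ∀ y z, f z + D z * (y - z) ≤ f y) :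
    Continuous f := by
  have hconv : ConvexOn ℝ univ f := by
    refine ⟨convex_univ, fun x _ y _ s t hs ht hst => ?_⟩
    have h1 := hf x (s • x + t • y)
    have h2 := hf y (s • x + t • y)
    simp only [smul_eq_mul] at *
    have h3 := add_le_add (mul_le_mul_of_nonneg_left h1 hs) (mul_le_mul_of_nonneg_left h2 ht)
    have : t = 1 - s := by linarith
    subst this
    nlinarith
  exact continuousOn_univ.mp (hconv.continuousOn isOpen_univ)

theorem monotone_of_subgradient {f D : ℝ → ℝ} (hf : ∀ y z, f z + D z * (y - z) ≤ f y) :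
    Monotone D := by
  intro x y hxy
  rcases hxy.eq_or_lt with rfl | h
  · exact le_rfl
  · have h1 := hf x y
    have h2 := hf y x
    by_contra! hc
    nlinarith [mul_pos (sub_pos.2 h) (sub_pos.2 hc)]

theorem eventually_le_of_hasDerivAt {D : ℝ → ℝ} {A A' z : ℝ} (hA : HasDerivAt D A z)
    (h : A < A') : ∃ η > 0, ∀ x, z ≤ x → x < z + η → D x ≤ D z + A' * (x - z) := by
  have h1 := (hasDerivAt_iff_tendsto_slope.1 hA).eventually (gt_mem_nhds h)
  rw [eventually_nhdsWithin_iff, Metric.eventually_nhds_iff] at h1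
  obtain ⟨η, hη, h2⟩ := h1
  refine ⟨η, hη, fun x hx hx' => ?_⟩
  rcases hx.eq_or_lt with rfl | hlt
  · simp
  · have h3 := h2 (y := x) (by rw [Real.dist_eq, abs_of_pos (by linarith)]; linarith) hlt.ne'
    rw [slope_def_field, div_lt_iff₀ (by linarith)] at h3
    linarith

/-- The slope of `f` between `x < y` is at most `D y`, so the linear upper bound on `D` near `z`
bounds the right difference quotients of `f`, and `f` stays below the primitive of that bound. -/
theorem upper_expansion_right {f D : ℝ → ℝ} (hf : ∀ y z, f z + D z * (y - z) ≤ f y)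
    {A A' z : ℝ} (hA : HasDerivAt D A z) (h : A < A') :
    ∃ η > 0, ∀ s, z ≤ s → s < z + η → f s ≤ f z + D z * (s - z) + A' / 2 * (s - z) ^ 2 := by
  obtain ⟨η, hη, hD⟩ := eventually_le_of_hasDerivAt hA h
  refine ⟨η, hη, fun s hs hs' => ?_⟩
  have := image_le_of_liminf_slope_right_le_deriv_boundary (f := f) (a := z) (b := s)
    (B := fun x => f z + D z * (x - z) + A' / 2 * (x - z) ^ 2)
    (B' := fun x => D z + A' * (x - z))
    (continuous_of_subgradient hf).continuousOn (by simp) (by fun_prop)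
    (fun x _ => by
      have : HasDerivAt (fun x => f z + D z * (x - z) + A' / 2 * (x - z) ^ 2)
          (0 + D z * 1 + A' / 2 * (2 * (x - z) ^ (2 - 1) * 1)) x := by
        have h1 : HasDerivAt (fun x : ℝ => x - z) 1 x := (hasDerivAt_id x).sub_const z
        exact ((hasDerivAt_const x (f z)).add (h1.const_mul _)).add ((h1.pow 2).const_mul _)
      refine (this.congr_deriv ?_).hasDerivWithinAt
      ring)
    (fun x hx r hr => by
      apply Eventually.frequently
      have hc : Tendsto (fun y => D z + A' * (y - z)) (𝓝[>] x) (𝓝 (D z + A' * (x - z))) :=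
        (by fun_prop : Continuous fun y => D z + A' * (y - z)).continuousAt.tendsto.mono_left
          nhdsWithin_le_nhds
      filter_upwards [hc.eventually (gt_mem_nhds hr), self_mem_nhdsWithin,
        nhdsWithin_le_nhds (gt_mem_nhds hx.2)] with y hy1 hy2 hy3
      have hxy : x < y := hy2
      rw [slope_def_field, div_lt_iff₀ (by linarith)]
      have h1 := hf x y
      have h2 := hD y (by linarith [hx.1]) (by linarith)
      nlinarith)
  exact this ⟨hs, le_rfl⟩

/-- Same argument, now with the slope between `x < y` bounded below by `D x`. -/
theorem lower_expansion_right {f D : ℝ → ℝ} (hf : ∀ y z, f z + D z * (y - z) ≤ f y)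
    {A A' z : ℝ} (hA : HasDerivAt D A z) (h : A' < A) :
    ∃ η > 0, ∀ s, z ≤ s → s < z + η → f z + D z * (s - z) + A' / 2 * (s - z) ^ 2 ≤ f s := by
  obtain ⟨η, hη, hD⟩ := eventually_le_of_hasDerivAt hA.neg (neg_lt_neg h)
  refine ⟨η, hη, fun s hs hs' => ?_⟩
  have := image_le_of_liminf_slope_right_le_deriv_boundary (f := fun x => -f x) (a := z) (b := s)
    (B := fun x => -(f z + D z * (x - z) + A' / 2 * (x - z) ^ 2))
    (B' := fun x => -(D z + A' * (x - z)))
    (continuous_of_subgradient hf).neg.continuousOn (by simp) (by fun_prop)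
    (fun x _ => by
      have : HasDerivAt (fun x => f z + D z * (x - z) + A' / 2 * (x - z) ^ 2)
          (0 + D z * 1 + A' / 2 * (2 * (x - z) ^ (2 - 1) * 1)) x := by
        have h1 : HasDerivAt (fun x : ℝ => x - z) 1 x := (hasDerivAt_id x).sub_const z
        exact ((hasDerivAt_const x (f z)).add (h1.const_mul _)).add ((h1.pow 2).const_mul _)
      refine (this.neg.congr_deriv ?_).hasDerivWithinAt
      ring)
    (fun x hx r hr => by
      apply Eventually.frequently
      filter_upwards [self_mem_nhdsWithin] with y hy2
      have hxy : x < y := hy2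
      rw [slope_def_field, div_lt_iff₀ (by linarith)]
      have h1 := hf y x
      have h2 := hD x hx.1 (by linarith [hx.2])
      simp only [Pi.neg_apply] at h2
      nlinarith)
  have h3 := this (x := s) ⟨hs, le_rfl⟩
  linarith

theorem subgradient_reflect {f D : ℝ → ℝ} (hf : ∀ y z, f z + D z * (y - z) ≤ f y) :
    ∀ y z, f (-z) + -D (-z) * (y - z) ≤ f (-y) := by
  intro y z
  have := hf (-y) (-z)
  linarith

theorem hasDerivAt_reflect {D : ℝ → ℝ} {A z : ℝ} (hA : HasDerivAt D A z) :
    HasDerivAt (fun x => -D (-x)) A (-z) := by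
  have h1 : HasDerivAt D A (-(-z)) := by simpa using hA
  have : HasDerivAt (fun x => -D (-x)) (-(A * -1)) (-z) := (h1.comp (-z) (hasDerivAt_neg (-z))).neg
  exact this.congr_deriv (by simp)

/-- Second order upper expansion of a convex function at a point where its subgradient is
differentiable. -/
theorem upper_expansion {f D : ℝ → ℝ} (hf : ∀ y z, f z + D z * (y - z) ≤ f y)
    {A A' z : ℝ} (hA : HasDerivAt D A z) (h : A < A') :
    ∀ᶠ s in 𝓝 z, f s ≤ f z + D z * (s - z) + A' / 2 * (s - z) ^ 2 := by
  obtain ⟨η, hη, h1⟩ := upper_expansion_right hf hA h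
  obtain ⟨ζ, hζ, h2⟩ := upper_expansion_right (f := fun x => f (-x)) (subgradient_reflect hf)
    (hasDerivAt_reflect hA) h
  filter_upwards [Ioo_mem_nhds (by linarith : z - ζ < z) (by linarith : z < z + η)] with s hs
  rcases le_total z s with hzs | hzs
  · exact h1 s hzs hs.2
  · have := h2 (-s) (by linarith) (by linarith [hs.1])
    simp only [neg_neg] at this
    linarith

/-- Second order lower expansion of a convex function at a point where its subgradient is
differentiable. -/
theorem lower_expansion {f D : ℝ → ℝ} (hf : ∀ y z, f z + D z * (y - z) ≤ f y)
    {A A' z : ℝ} (hA : HasDerivAt D A z) (h : A' < A) :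
    ∀ᶠ s in 𝓝 z, f z + D z * (s - z) + A' / 2 * (s - z) ^ 2 ≤ f s := by
  obtain ⟨η, hη, h1⟩ := lower_expansion_right hf hA h
  obtain ⟨ζ, hζ, h2⟩ := lower_expansion_right (f := fun x => f (-x)) (subgradient_reflect hf)
    (hasDerivAt_reflect hA) h
  filter_upwards [Ioo_mem_nhds (by linarith : z - ζ < z) (by linarith : z < z + η)] with s hs
  rcases le_total z s with hzs | hzs
  · exact h1 s hzs hs.2
  · have := h2 (-s) (by linarith) (by linarith [hs.1])
    simp only [neg_neg] at this
    linarith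

open MeasureTheory in
/-- One-dimensional Jensen lemma: the points where small linear perturbations of a semiconvex
function attain their maximum are not negligible. -/
theorem exists_isMaxOn_notMem_null {W D : ℝ → ℝ} {c α β δ : ℝ} (hαβ : α < β) (hc : 0 ≤ c)
    (hδ : 0 < δ) (hW : ∀ y z, W z + D z * (y - z) - c * (y - z) ^ 2 ≤ W y)
    (hcont : ContinuousOn W (Icc α β))
    (hint : ∀ p, |p| ≤ δ → ∀ z ∈ Icc α β, IsMaxOn (fun x => W x - p * x) (Icc α β) z →
      z ∈ Ioo α β)
    {N : Set ℝ} (hN : volume N = 0) :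
    ∃ z ∈ Ioo α β, z ∉ N ∧ |D z| ≤ δ ∧ IsMaxOn (fun x => W x - D z * x) (Icc α β) z := by
  set K : Set ℝ := {z | z ∈ Ioo α β ∧ |D z| ≤ δ ∧ IsMaxOn (fun x => W x - D z * x) (Icc α β) z}
    with hK
  by_contra! hcon
  have hKN : K ⊆ N := fun z hz => by
    by_contra hzN
    exact hcon z hz.1 hzN hz.2.1 hz.2.2
  -- Every small `p` is a value of `D` on `K`: at an interior maximum of `W - p x`, if `D z ≠ p`, a
  -- step of length `η` in the favourable direction would gain at least `|D z - p| η - c η² > 0`.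
  have himg : Icc (-δ) δ ⊆ D '' K := by
    intro p hp
    have hp' : |p| ≤ δ := abs_le.2 hp
    obtain ⟨z, hz, hmax⟩ := isCompact_Icc.exists_isMaxOn (f := fun x => W x - p * x)
      (nonempty_Icc.2 hαβ.le)
      (hcont.sub (continuousOn_const.mul continuousOn_id) : ContinuousOn (fun x => W x - p * x) _)
    have hzi := hint p hp' z hz hmax
    have hDz : D z = p := by
      by_contra hne
      have hd : 0 < |D z - p| := abs_pos.2 (sub_ne_zero.2 hne)
      obtain ⟨η, hη, hη1, hη2, hη3⟩ : ∃ η > 0, z + η < β ∧ α < z - η ∧ c * η < |D z - p| := by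
        refine ⟨min (min ((β - z) / 2) ((z - α) / 2)) (|D z - p| / (2 * (c + 1))), ?_, ?_, ?_, ?_⟩
        · have := hzi.1; have := hzi.2
          refine lt_min (lt_min ?_ ?_) (by positivity) <;> linarith
        · have := hzi.2
          have h1 := (min_le_left (min ((β - z) / 2) ((z - α) / 2))
            (|D z - p| / (2 * (c + 1)))).trans (min_le_left _ _)
          linarith
        · have := hzi.1
          have h1 := (min_le_left (min ((β - z) / 2) ((z - α) / 2))
            (|D z - p| / (2 * (c + 1)))).trans (min_le_right _ _)
          linarith
        · have h1 := min_le_right (min ((β - z) / 2) ((z - α) / 2)) (|D z - p| / (2 * (c + 1)))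
          calc c * _ ≤ c * (|D z - p| / (2 * (c + 1))) := mul_le_mul_of_nonneg_left h1 hc
            _ < |D z - p| := by
              rw [mul_div_assoc', div_lt_iff₀ (by positivity)]
              nlinarith
      have hz1 := hzi.1
      have hz2 := hzi.2
      rcases lt_or_gt_of_ne hne with hlt | hgt
      · have h1 := hW (z - η) z
        have h2 := isMaxOn_iff.1 hmax (z - η) ⟨hη2.le, by linarith⟩
        rw [abs_of_neg (by linarith)] at hη3
        nlinarith
      · have h1 := hW (z + η) z
        have h2 := isMaxOn_iff.1 hmax (z + η) ⟨by linarith, hη1.le⟩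
        rw [abs_of_pos (by linarith)] at hη3
        nlinarith
    exact ⟨z, ⟨hzi, hDz ▸ hp', by rw [hDz]; exact hmax⟩, hDz⟩
  -- Maximality makes `D` decreasing on `K`, as for a concave function; semiconvexity limits the
  -- rate of decrease.
  have key : ∀ x ∈ K, ∀ y ∈ K, x < y → |D x - D y| ≤ 2 * c * (y - x) := by
    intro x hx y hy hxy
    have h1 := hW y x
    have h2 := hW x y
    have h3 := isMaxOn_iff.1 hx.2.2 y ⟨hy.1.1.le, hy.1.2.le⟩
    have h4 := isMaxOn_iff.1 hy.2.2 x ⟨hx.1.1.le, hx.1.2.le⟩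
    have hpos : 0 < y - x := by linarith
    rw [abs_le]
    constructor
    · have : D y ≤ D x := by
        by_contra! hcc
        nlinarith
      nlinarith
    · by_contra! hcc
      nlinarith
  have hlip : LipschitzOnWith (Real.toNNReal (2 * c)) D K := by
    refine LipschitzOnWith.of_dist_le_mul fun x hx y hy => ?_
    rw [Real.coe_toNNReal _ (by positivity), Real.dist_eq, Real.dist_eq]
    rcases lt_trichotomy x y with h | h | h
    · rw [abs_sub_comm x y, abs_of_pos (by linarith : 0 < y - x)]
      exact key x hx y hy h
    · simp [h]
    · rw [abs_of_pos (by linarith : 0 < x - y), abs_sub_comm]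
      exact key y hy x hx h
  -- A Lipschitz image of a null set is null, but this one covers an interval.
  have hμ := hlip.hausdorffMeasure_image_le (d := 1) zero_le_one
  rw [hausdorffMeasure_real, measure_mono_null hKN hN, mul_zero] at hμ
  have h5 : volume (Icc (-δ) δ) ≤ 0 := (measure_mono himg).trans hμ
  rw [Real.volume_Icc] at h5
  have : (0 : ENNReal) < ENNReal.ofReal (δ - -δ) := ENNReal.ofReal_pos.2 (by linarith)
  exact absurd h5 (not_le.2 this)

/-! ### Second order equations on an interval -/

/-- Viscosity subsolutions of `lam u - a u'' + H(t, u') = 0` on `(0, L)`, tested with parabolas. -/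
def IsParabolicSub (lam L : ℝ) (a : ℝ → ℝ) (H : ℝ → ℝ → ℝ) (u : ℝ → ℝ) : Prop :=
  ∀ t ∈ Ioo 0 L, ∀ p X : ℝ, (∀ᶠ s in 𝓝 t, u s ≤ u t + p * (s - t) + X / 2 * (s - t) ^ 2) →
    lam * u t - a t * X + H t p ≤ 0

/-- The Hamiltonian of the equation solved by `-v` when `v` solves the one with Hamiltonian `H`. -/
def dualHam (H : ℝ → ℝ → ℝ) (t p : ℝ) : ℝ := -H t (-p)

/-- Regularity of the coefficients on `[0, L]`. -/
structure RegularCoeff (L C : ℝ) (a : ℝ → ℝ) (H : ℝ → ℝ → ℝ) : Prop where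
  nonneg : 0 ≤ C
  lip_left : ∀ x ∈ Icc 0 L, ∀ y ∈ Icc 0 L, ∀ p, |H x p - H y p| ≤ C * (1 + |p|) * |x - y|
  lip_right : ∀ x ∈ Icc 0 L, ∀ p q, |H x p - H x q| ≤ C * |p - q|
  exists_sqrt : ∃ σ : ℝ → ℝ, (∀ x ∈ Icc 0 L, a x = σ x ^ 2) ∧
    ∀ x ∈ Icc 0 L, ∀ y ∈ Icc 0 L, |σ x - σ y| ≤ C * |x - y|

theorem RegularCoeff.dual {L C : ℝ} {a : ℝ → ℝ} {H : ℝ → ℝ → ℝ} (h : RegularCoeff L C a H) :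
    RegularCoeff L C a (dualHam H) where
  nonneg := h.nonneg
  lip_left x hx y hy p := by
    have := h.lip_left x hx y hy (-p)
    rw [abs_neg] at this
    rwa [dualHam, dualHam, neg_sub_neg, abs_sub_comm]
  lip_right x hx p q := by
    have := h.lip_right x hx (-p) (-q)
    rw [neg_sub_neg, abs_sub_comm q p] at this
    rwa [dualHam, dualHam, neg_sub_neg, abs_sub_comm]
  exists_sqrt := h.exists_sqrt

/-! ### Sup-convolutions and doubling of variables -/

/-- Sup-convolution, normalised to be convex; its subgradient is given by the maximizers. -/
theorem exists_supConv {u : ℝ → ℝ} {α β : ℝ} (hαβ : α ≤ β)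
    (hu : UpperSemicontinuousOn u (Icc α β)) (n : ℝ) :
    ∃ xm f : ℝ → ℝ, (∀ z, xm z ∈ Icc α β) ∧
      (∀ z, ∀ x ∈ Icc α β, u x - n * x ^ 2 + 2 * n * x * z ≤ f z) ∧
      ∀ z, f z = u (xm z) - n * xm z ^ 2 + 2 * n * xm z * z := by
  have h : ∀ z : ℝ, ∃ x ∈ Icc α β, ∀ y ∈ Icc α β,
      u y - n * y ^ 2 + 2 * n * y * z ≤ u x - n * x ^ 2 + 2 * n * x * z := by
    intro z
    have h1 : UpperSemicontinuousOn (fun x => u x + (- n * x ^ 2 + 2 * n * x * z)) (Icc α β) :=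
      hu.add (by fun_prop : ContinuousOn (fun x => - n * x ^ 2 + 2 * n * x * z)
        (Icc α β)).upperSemicontinuousOn
    obtain ⟨x, hx, hmax⟩ := h1.exists_isMaxOn (nonempty_Icc.2 hαβ) isCompact_Icc
    refine ⟨x, hx, fun y hy => ?_⟩
    have := isMaxOn_iff.1 hmax y hy
    linarith
  choose xm hxm hmax using h
  exact ⟨xm, fun z => u (xm z) - n * xm z ^ 2 + 2 * n * xm z * z, hxm, hmax, fun z => rfl⟩

/-- A second order expansion of the sup-convolution at `z` is transported to the maximizer. -/
theorem jet_of_supConv {u f D : ℝ → ℝ} {α β n z x A : ℝ}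
    (hf : ∀ y z, f z + D z * (y - z) ≤ f y)
    (hle : ∀ z, ∀ x ∈ Icc α β, u x - n * x ^ 2 + 2 * n * x * z ≤ f z)
    (hz : f z = u x - n * x ^ 2 + 2 * n * x * z) (hD : D z = 2 * n * x) (hx : x ∈ Ioo α β)
    (hA : HasDerivAt D A z) {e : ℝ} (he : 0 < e) (τ : ℝ) :
    ∀ᶠ s in 𝓝 x, u s ≤ u x + 2 * n * (x - z) * (s - x) +
      ((A + e) * τ ^ 2 + 2 * n - 4 * n * τ) / 2 * (s - x) ^ 2 := by
  have h1 := upper_expansion hf hA (by linarith : A < A + e)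
  have hc : Tendsto (fun s => z + τ * (s - x)) (𝓝 x) (𝓝 z) := by
    have : ContinuousAt (fun s => z + τ * (s - x)) x := by fun_prop
    simpa [ContinuousAt] using this
  filter_upwards [hc.eventually h1, Ioo_mem_nhds hx.1 hx.2] with s hs hsI
  -- Any affine path through `z` may be followed while `s` moves away from `x`. Its speed `τ` stays
  -- free, and this freedom later plays the part of the test vectors in the usual matrix inequality.
  have h2 := hle (z + τ * (s - x)) s ⟨hsI.1.le, hsI.2.le⟩
  rw [hD] at hs
  have h3 : u s ≤ f (z + τ * (s - x)) + n * s ^ 2 - 2 * n * s * (z + τ * (s - x)) := by linarith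
  refine (h3.trans (sub_le_sub_right (add_le_add_left hs _) _)).trans (le_of_eq ?_)
  rw [hz]
  ring

/-- Localisation of almost maximizers in the doubling of variables. -/
theorem penalization {u w : ℝ → ℝ} {α β κ θ t₁ B : ℝ} (hθ : 0 < θ)
    (hu : UpperSemicontinuousOn u (Icc α β)) (hw : UpperSemicontinuousOn w (Icc α β))
    (huB : ∀ x ∈ Icc α β, |u x| ≤ B) (hwB : ∀ x ∈ Icc α β, |w x| ≤ B)
    (hmax : ∀ x ∈ Icc α β, u x + w x + κ * x ≤ u t₁ + w t₁ + κ * t₁) {η : ℝ} (hη : 0 < η) :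
    ∃ n₀ δ₀ : ℝ, 0 < δ₀ ∧ ∀ n, n₀ ≤ n → ∀ x ∈ Icc α β, ∀ y ∈ Icc α β, ∀ z ∈ Icc α β,
      u t₁ + w t₁ + κ * t₁ - δ₀ ≤
        u x + w y - n * ((x - z) ^ 2 + (y - z) ^ 2) + κ * z - θ * (z - t₁) ^ 2 →
      |z - t₁| < η ∧ n * ((x - z) ^ 2 + (y - z) ^ 2) < η ^ 2 := by
  -- If this fails along `n → ∞`, `δ₀ → 0`, compactness gives a limit where `x`, `y`, `z` coincide,
  -- because the quadratic penalty stays bounded. Semicontinuity there forces both penalties to be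
  -- small.
  by_contra! hcon
  have hpos : ∀ k : ℕ, (0 : ℝ) < 1 / ((k : ℝ) + 1) := fun k => by positivity
  choose n hn x hx y hy z hz hge hbad using fun k : ℕ => hcon ((k : ℝ) + 1) (1 / ((k : ℝ) + 1)) (hpos k)
  have hcpt : IsCompact (Icc α β ×ˢ (Icc α β ×ˢ Icc α β)) :=
    isCompact_Icc.prod (isCompact_Icc.prod isCompact_Icc)
  obtain ⟨⟨xb, yb, zb⟩, hmem, φ, hφ, hlim⟩ := hcpt.tendsto_subseq
    (x := fun k => (x k, y k, z k)) fun k => ⟨hx k, hy k, hz k⟩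
  have hxl : Tendsto (fun k => x (φ k)) atTop (𝓝 xb) := (continuous_fst.tendsto _).comp hlim
  have hyl : Tendsto (fun k => y (φ k)) atTop (𝓝 yb) :=
    ((continuous_fst.comp continuous_snd).tendsto _).comp hlim
  have hzl : Tendsto (fun k => z (φ k)) atTop (𝓝 zb) :=
    ((continuous_snd.comp continuous_snd).tendsto _).comp hlim
  obtain ⟨hxb, hyb, hzb⟩ := hmem
  simp only at hxb hyb hzb
  have htop : Tendsto (fun k => ((φ k : ℕ) : ℝ) + 1) atTop atTop :=
    tendsto_atTop_add_const_right _ _ (tendsto_natCast_atTop_atTop.comp hφ.tendsto_atTop)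
  have hdel : Tendsto (fun k => 1 / (((φ k : ℕ) : ℝ) + 1)) atTop (𝓝 0) := by
    simpa [one_div, Function.comp_def] using tendsto_inv_atTop_zero.comp htop
  set B' : ℝ := 2 * B + |κ| * (|α| + |β|) - (u t₁ + w t₁ + κ * t₁) + 1 with hB'
  have hpen : ∀ k, n k * ((x k - z k) ^ 2 + (y k - z k) ^ 2) ≤ B' := by
    intro k
    have h1 := hge k
    have h2 := abs_le.1 (huB _ (hx k))
    have h3 := abs_le.1 (hwB _ (hy k))
    have h4 : κ * z k ≤ |κ| * (|α| + |β|) := by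
      refine (le_abs_self _).trans ?_
      rw [abs_mul]
      refine mul_le_mul_of_nonneg_left ?_ (abs_nonneg _)
      rw [abs_le]
      have := (hz k).1; have := (hz k).2
      have := neg_abs_le α; have := le_abs_self β
      have := abs_nonneg α; have := abs_nonneg β
      constructor <;> linarith
    have h5 : 1 / ((k : ℝ) + 1) ≤ 1 := by
      rw [div_le_one (by positivity)]
      linarith [k.cast_nonneg (α := ℝ)]
    have h6 : 0 ≤ θ * (z k - t₁) ^ 2 := by positivity
    linarith
  have hB'0 : 0 ≤ B' := by
    refine le_trans ?_ (hpen 0)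
    have : (0 : ℝ) ≤ n 0 := le_trans (by positivity) (hn 0)
    positivity
  have hq : Tendsto (fun k => (x (φ k) - z (φ k)) ^ 2 + (y (φ k) - z (φ k)) ^ 2) atTop (𝓝 0) := by
    refine squeeze_zero (fun k => by positivity) (fun k => ?_)
      (by simpa using hdel.const_mul B' : Tendsto (fun k => B' * (1 / (((φ k : ℕ) : ℝ) + 1))) atTop (𝓝 0))
    have h1 := hpen (φ k)
    have h2 : (((φ k : ℕ) : ℝ) + 1) * ((x (φ k) - z (φ k)) ^ 2 + (y (φ k) - z (φ k)) ^ 2) ≤ B' :=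
      (mul_le_mul_of_nonneg_right (hn (φ k)) (by positivity)).trans h1
    rw [mul_one_div, le_div_iff₀ (by positivity)]
    linarith
  have hq' := ((hxl.sub hzl).pow 2).add ((hyl.sub hzl).pow 2)
  have h0 := tendsto_nhds_unique hq hq'
  have hxz : xb = zb := by nlinarith [sq_nonneg (xb - zb), sq_nonneg (yb - zb)]
  have hyz : yb = zb := by nlinarith [sq_nonneg (xb - zb), sq_nonneg (yb - zb)]
  subst hxz
  subst hyz
  -- Four errors of size `ε` occur: from `u`, from `w`, from `κ z` and from the defect `1 / (k +
  -- 1)`.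
  obtain ⟨ε, hε, hε1, hε2⟩ : ∃ ε : ℝ, 0 < ε ∧ 4 * ε < η ^ 2 ∧ 4 * ε < θ * η ^ 2 := by
    refine ⟨min (η ^ 2) (θ * η ^ 2) / 8, by positivity, ?_, ?_⟩
    · have := min_le_left (η ^ 2) (θ * η ^ 2)
      have : 0 < η ^ 2 := by positivity
      linarith
    · have := min_le_right (η ^ 2) (θ * η ^ 2)
      have : 0 < θ * η ^ 2 := by positivity
      linarith
  have hxw : Tendsto (fun k => x (φ k)) atTop (𝓝[Icc α β] yb) :=
    tendsto_nhdsWithin_iff.2 ⟨hxl, Eventually.of_forall fun k => hx _⟩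
  have hyw : Tendsto (fun k => y (φ k)) atTop (𝓝[Icc α β] yb) :=
    tendsto_nhdsWithin_iff.2 ⟨hyl, Eventually.of_forall fun k => hy _⟩
  have e1 := hxw.eventually (hu yb hxb (u yb + ε) (by linarith))
  have e2 := hyw.eventually (hw yb hxb (w yb + ε) (by linarith))
  have e3 := (hzl.const_mul κ).eventually (gt_mem_nhds (by linarith : κ * yb < κ * yb + ε))
  have e4 := hdel.eventually (gt_mem_nhds hε)
  obtain ⟨k, h1, h2, h3, h4⟩ := (e1.and (e2.and (e3.and e4))).exists
  have h5 := hge (φ k)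
  have h6 := hmax yb hxb
  have h7 : 0 ≤ n (φ k) := le_trans (by positivity) (hn (φ k))
  have h8 : 0 ≤ n (φ k) * ((x (φ k) - z (φ k)) ^ 2 + (y (φ k) - z (φ k)) ^ 2) := by positivity
  have h9 : θ * (z (φ k) - t₁) ^ 2 < θ * η ^ 2 := by linarith
  have h10 : |z (φ k) - t₁| < η := by
    have := lt_of_mul_lt_mul_left h9 hθ.le
    exact abs_lt_of_sq_lt_sq this hη.le
  have h11 := hbad (φ k) h10
  have h12 : 0 ≤ θ * (z (φ k) - t₁) ^ 2 := by positivity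
  linarith

theorem ae_differentiable_null {D : ℝ → ℝ} (hD : Monotone D) :
    MeasureTheory.volume {z | ¬ DifferentiableAt ℝ D z} = 0 :=
  MeasureTheory.ae_iff.1 hD.ae_differentiableAt

/-- Choice of the scaling factors in the second order part of the doubling argument. -/
theorem exists_scaling (s t : ℝ) : ∃ τ μ : ℝ, s * τ = t * μ ∧ (s * τ) ^ 2 ≤ s ^ 2 ∧
    (s - s * τ) ^ 2 + (t - t * μ) ^ 2 = (s - t) ^ 2 := by
  by_cases ht : t = 0
  · exact ⟨0, 0, by simp, by simpa using sq_nonneg s, by simp [ht]⟩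
  · by_cases hs : s = 0
    · exact ⟨0, 0, by simp, by simp [hs], by simp [hs]⟩
    · refine ⟨1, s / t, ?_, by simp, ?_⟩ <;> field_simp
      ring

/-- The pair of second order jets produced by the doubling of variables. -/
theorem exists_jets {u w : ℝ → ℝ} {α β κ θ t₁ B : ℝ} (hθ : 0 < θ) (ht₁ : t₁ ∈ Ioo α β)
    (hu : UpperSemicontinuousOn u (Icc α β)) (hw : UpperSemicontinuousOn w (Icc α β))
    (huB : ∀ x ∈ Icc α β, |u x| ≤ B) (hwB : ∀ x ∈ Icc α β, |w x| ≤ B)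
    (hmax : ∀ x ∈ Icc α β, u x + w x + κ * x ≤ u t₁ + w t₁ + κ * t₁) {η : ℝ} (hη : 0 < η)
    (hη1 : α < t₁ - 2 * η) (hη2 : t₁ + 2 * η < β) :
    ∃ n x y z P Q, 0 ≤ n ∧ x ∈ Ioo α β ∧ y ∈ Ioo α β ∧ |z - t₁| < η ∧
      n * ((x - z) ^ 2 + (y - z) ^ 2) < η ^ 2 ∧ |x - y| < 2 * η ∧
      |2 * n * (x - z) + 2 * n * (y - z) + κ| ≤ η + 2 * θ * η ∧
      u t₁ + w t₁ + κ * t₁ - η ≤ u x + w y + κ * z ∧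
      P + Q ≤ 4 * n + 2 * θ ∧
      (∀ e > 0, ∀ τ, ∀ᶠ s in 𝓝 x, u s ≤ u x + 2 * n * (x - z) * (s - x) +
        ((P + e) * τ ^ 2 + 2 * n - 4 * n * τ) / 2 * (s - x) ^ 2) ∧
      (∀ e > 0, ∀ τ, ∀ᶠ s in 𝓝 y, w s ≤ w y + 2 * n * (y - z) * (s - y) +
        ((Q + e) * τ ^ 2 + 2 * n - 4 * n * τ) / 2 * (s - y) ^ 2) := by
  have hαβ : α < β := ht₁.1.trans ht₁.2
  have hI₁ : t₁ ∈ Icc α β := ⟨ht₁.1.le, ht₁.2.le⟩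
  obtain ⟨n₀, δ₀, hδ₀, hpen⟩ := penalization (t₁ := t₁) hθ hu hw huB hwB hmax hη
  set n : ℝ := max n₀ 1 with hn
  have hn1 : 1 ≤ n := le_max_right _ _
  have hn0 : n₀ ≤ n := le_max_left _ _
  obtain ⟨xm, f, hxm, hf1, hf2⟩ := exists_supConv hαβ.le hu n
  obtain ⟨ym, g, hym, hg1, hg2⟩ := exists_supConv hαβ.le hw n
  have hfs : ∀ y z, f z + 2 * n * xm z * (y - z) ≤ f y := fun y z => by
    have := hf1 y (xm z) (hxm z)
    rw [hf2 z]
    linarith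
  have hgs : ∀ y z, g z + 2 * n * ym z * (y - z) ≤ g y := fun y z => by
    have := hg1 y (ym z) (hym z)
    rw [hg2 z]
    linarith
  -- `W z` is the maximum over `x` and `y` of the doubled functional. Coupling `x` and `y` through
  -- the middle point `z`, instead of penalizing `x - y` directly, leaves a function of one
  -- variable, to which the one-dimensional Jensen lemma applies.
  set W : ℝ → ℝ := fun z => f z + g z - 2 * n * z ^ 2 + κ * z - θ * (z - t₁) ^ 2 with hWdef
  set D : ℝ → ℝ := fun z => 2 * n * xm z + 2 * n * ym z - 4 * n * z + κ - 2 * θ * (z - t₁)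
    with hDdef
  have hWeq : ∀ z, W z = u (xm z) + w (ym z) - n * ((xm z - z) ^ 2 + (ym z - z) ^ 2) + κ * z -
      θ * (z - t₁) ^ 2 := fun z => by
    simp only [hWdef, hf2, hg2]
    ring
  have hWt : u t₁ + w t₁ + κ * t₁ ≤ W t₁ := by
    have h1 := hf1 t₁ t₁ hI₁
    have h2 := hg1 t₁ t₁ hI₁
    simp only [hWdef]
    nlinarith
  -- A tilt of slope at most `δ` changes values on `[α, β]` by at most `min δ₀ η`, so maximizers of
  -- the tilted function remain within reach of `penalization`.
  obtain ⟨δ, hδ, hδη, hδδ⟩ : ∃ δ > 0, δ ≤ η ∧ δ * (β - α) ≤ min δ₀ η := by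
    have hpos : 0 < β - α := by linarith
    have hm : 0 < min δ₀ η := lt_min hδ₀ hη
    refine ⟨min η (min δ₀ η / (β - α)), lt_min hη (by positivity), min_le_left _ _, ?_⟩
    rw [← le_div_iff₀ hpos]
    exact min_le_right _ _
  have hnear : ∀ p, |p| ≤ δ → ∀ z ∈ Icc α β, IsMaxOn (fun x => W x - p * x) (Icc α β) z →
      u t₁ + w t₁ + κ * t₁ - min δ₀ η ≤ W z := by
    intro p hp z hz hm
    have h1 := isMaxOn_iff.1 hm t₁ hI₁
    have h2 : p * (t₁ - z) ≤ δ * (β - α) := by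
      refine (le_abs_self _).trans ?_
      rw [abs_mul]
      refine mul_le_mul hp ?_ (abs_nonneg _) hδ.le
      rw [abs_le]
      constructor <;> linarith [hz.1, hz.2, hI₁.1, hI₁.2]
    linarith
  have hloc : ∀ z ∈ Icc α β, u t₁ + w t₁ + κ * t₁ - min δ₀ η ≤ W z → |z - t₁| < η ∧
      n * ((xm z - z) ^ 2 + (ym z - z) ^ 2) < η ^ 2 := by
    intro z hz h
    refine hpen n hn0 _ (hxm z) _ (hym z) z hz ?_
    rw [← hWeq]
    linarith [min_le_left δ₀ η]
  have hcont : Continuous W := by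
    have h1 := continuous_of_subgradient hfs
    have h2 := continuous_of_subgradient hgs
    fun_prop
  obtain ⟨z, hzI, hzN, hDz, hzmax⟩ := exists_isMaxOn_notMem_null (W := W) (D := D)
    (c := 2 * n + θ) (δ := δ) hαβ (by positivity) hδ
    (fun y z => by
      have h1 := hfs y z
      have h2 := hgs y z
      simp only [hWdef, hDdef]
      nlinarith)
    hcont.continuousOn
    (fun p hp z hz hm => by
      have h1 := (hloc z hz (hnear p hp z hz hm)).1
      rw [abs_lt] at h1
      constructor <;> linarith)
    (MeasureTheory.measure_union_null (ae_differentiable_null (monotone_of_subgradient hfs))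
      (ae_differentiable_null (monotone_of_subgradient hgs)))
  have hzI' : z ∈ Icc α β := ⟨hzI.1.le, hzI.2.le⟩
  have hWz := hnear _ hDz z hzI' hzmax
  obtain ⟨hz1, hz2⟩ := hloc z hzI' hWz
  have hdf : DifferentiableAt ℝ (fun z => 2 * n * xm z) z := by
    by_contra hc
    exact hzN (Or.inl hc)
  have hdg : DifferentiableAt ℝ (fun z => 2 * n * ym z) z := by
    by_contra hc
    exact hzN (Or.inr hc)
  set P := deriv (fun z => 2 * n * xm z) z
  set Q := deriv (fun z => 2 * n * ym z) z
  have hP : HasDerivAt (fun z => 2 * n * xm z) P z := hdf.hasDerivAt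
  have hQ : HasDerivAt (fun z => 2 * n * ym z) Q z := hdg.hasDerivAt
  have hxz : |xm z - z| < η := by
    refine abs_lt_of_sq_lt_sq ?_ hη.le
    nlinarith [sq_nonneg (xm z - z), sq_nonneg (ym z - z)]
  have hyz : |ym z - z| < η := by
    refine abs_lt_of_sq_lt_sq ?_ hη.le
    nlinarith [sq_nonneg (xm z - z), sq_nonneg (ym z - z)]
  have hxI : xm z ∈ Ioo α β := by
    rw [abs_lt] at hxz hz1
    constructor <;> linarith
  have hyI : ym z ∈ Ioo α β := by
    rw [abs_lt] at hyz hz1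
    constructor <;> linarith
  refine ⟨n, xm z, ym z, z, P, Q, by positivity, hxI, hyI, hz1, hz2, ?_, ?_, ?_, ?_, ?_, ?_⟩
  · rw [abs_lt] at hxz hyz ⊢
    constructor <;> linarith
  · have h1 : 2 * n * (xm z - z) + 2 * n * (ym z - z) + κ = D z + 2 * θ * (z - t₁) := by
      simp only [hDdef]
      ring
    rw [h1]
    refine (abs_add_le _ _).trans (add_le_add (hDz.trans hδη) ?_)
    rw [abs_mul, abs_of_pos (by positivity : 0 < 2 * θ)]
    exact mul_le_mul_of_nonneg_left hz1.le (by positivity)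
  · have h1 := min_le_right δ₀ η
    have h2 : 0 ≤ n * ((xm z - z) ^ 2 + (ym z - z) ^ 2) := by positivity
    have h3 : 0 ≤ θ * (z - t₁) ^ 2 := by positivity
    rw [hWeq] at hWz
    linarith
  -- If `P + Q` were larger, the lower expansions of `f` and `g` would make the tilted `W` exceed
  -- its maximum near `z`: each loses only `ε / 2` of the quadratic coefficient, out of an excess of
  -- `2 ε`.
  · by_contra! hcon
    set ε : ℝ := (P + Q - (4 * n + 2 * θ)) / 4 with hε
    have hεp : 0 < ε := by rw [hε]; linarith
    have e1 := lower_expansion hfs hP (by linarith : P - ε < P)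
    have e2 := lower_expansion hgs hQ (by linarith : Q - ε < Q)
    have e3 : ∀ᶠ s in 𝓝[≠] z, s ∈ Icc α β := nhdsWithin_le_nhds (Icc_mem_nhds hzI.1 hzI.2)
    obtain ⟨s, hs1, hs2, hs3, hs4⟩ := ((e1.filter_mono nhdsWithin_le_nhds).and
      ((e2.filter_mono nhdsWithin_le_nhds).and (e3.and self_mem_nhdsWithin))).exists
    have h1 := isMaxOn_iff.1 hzmax s hs3
    simp only [hWdef, hDdef] at h1
    have h2 : 0 < (s - z) ^ 2 := by
      have : s - z ≠ 0 := sub_ne_zero.2 hs4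
      positivity
    nlinarith
  · exact fun e he τ => jet_of_supConv hfs hf1 (hf2 z) rfl hxI hP he τ
  · exact fun e he τ => jet_of_supConv hgs hg1 (hg2 z) rfl hyI hQ he τ

/-! ### Estimates on the coefficients and interior comparison -/

theorem abs_le_of_regular {L C : ℝ} {H : ℝ → ℝ → ℝ} {a : ℝ → ℝ} (hR : RegularCoeff L C a H)
    {x y : ℝ} (hx : x ∈ Icc 0 L) (hy : y ∈ Icc 0 L) (p q : ℝ) :
    H y q - H x p ≤ C * (1 + |q|) * |x - y| + C * |p - q| := by
  have h1 := (abs_le.1 (hR.lip_left x hx y hy q)).1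
  have h2 := (abs_le.1 (hR.lip_right x hx p q)).1
  linarith

/-- Estimate of the second order terms in the doubling argument. -/
theorem diffusion_estimate {s t τ μ P Q n η θ C S x y z : ℝ} (hn : 0 ≤ n) (hη : 0 < η)
    (hη1 : η ≤ 1) (hτμ : s * τ = t * μ)
    (hk : (s * τ) ^ 2 ≤ s ^ 2) (hsc : (s - s * τ) ^ 2 + (t - t * μ) ^ 2 = (s - t) ^ 2)
    (hS : s ^ 2 ≤ S ^ 2) (hst : |s - t| ≤ C * |x - y|) (hPQ : P + Q ≤ 4 * n + 2 * θ)
    (hpen : n * ((x - z) ^ 2 + (y - z) ^ 2) < η ^ 2) (hθ : 0 < θ) :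
    s ^ 2 * ((P + η) * τ ^ 2 + 2 * n - 4 * n * τ) +
        t ^ 2 * ((Q + η) * μ ^ 2 + 2 * n - 4 * n * μ) ≤
      2 * S ^ 2 * θ + 2 * S ^ 2 * η + 4 * C ^ 2 * η := by
  -- Since `s τ = t μ`, completing squares collects `P` and `Q` with a common factor, so only their
  -- sum matters. The remaining square is `(s - t) ^ 2` by the choice of the scalings; the Lipschitz
  -- bound on `σ` and the penalty control `n (s - t) ^ 2`.
  have e1 : s ^ 2 * ((P + η) * τ ^ 2 + 2 * n - 4 * n * τ) +
      t ^ 2 * ((Q + η) * μ ^ 2 + 2 * n - 4 * n * μ) =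
      (s * τ) ^ 2 * (P + Q - 4 * n + 2 * η) +
        2 * n * ((s - s * τ) ^ 2 + (t - t * μ) ^ 2) := by
    linear_combination (-(Q + η - 2 * n) * (s * τ + t * μ)) * hτμ
  rw [e1, hsc]
  have e2 : (s * τ) ^ 2 * (P + Q - 4 * n + 2 * η) ≤ S ^ 2 * (2 * θ + 2 * η) := by
    calc (s * τ) ^ 2 * (P + Q - 4 * n + 2 * η) ≤ (s * τ) ^ 2 * (2 * θ + 2 * η) :=
          mul_le_mul_of_nonneg_left (by linarith) (sq_nonneg _)
      _ ≤ _ := mul_le_mul_of_nonneg_right (hk.trans hS) (by positivity)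
  have e3 : (s - t) ^ 2 ≤ C ^ 2 * (2 * ((x - z) ^ 2 + (y - z) ^ 2)) := by
    have h5 : (s - t) ^ 2 ≤ (C * |x - y|) ^ 2 := by
      rw [← sq_abs (s - t)]
      exact pow_le_pow_left₀ (abs_nonneg _) hst 2
    rw [mul_pow, sq_abs] at h5
    refine h5.trans (mul_le_mul_of_nonneg_left ?_ (sq_nonneg _))
    nlinarith [sq_nonneg (x - z + (y - z))]
  have e4 : 2 * n * (s - t) ^ 2 ≤ 4 * C ^ 2 * η ^ 2 := by
    calc 2 * n * (s - t) ^ 2 ≤ 2 * n * (C ^ 2 * (2 * ((x - z) ^ 2 + (y - z) ^ 2))) :=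
          mul_le_mul_of_nonneg_left e3 (by positivity)
      _ = 4 * C ^ 2 * (n * ((x - z) ^ 2 + (y - z) ^ 2)) := by ring
      _ ≤ _ := mul_le_mul_of_nonneg_left hpen.le (by positivity)
  have e5 : 4 * C ^ 2 * η ^ 2 ≤ 4 * C ^ 2 * η :=
    mul_le_mul_of_nonneg_left (by nlinarith) (by positivity)
  linarith

/-- Estimate of the first order terms in the doubling argument. -/
theorem drift_estimate {n η C x y z : ℝ} (hn : 0 ≤ n) (hη : 0 < η) (hη1 : η ≤ 1) (hC : 0 ≤ C)
    (hpen : n * ((x - z) ^ 2 + (y - z) ^ 2) < η ^ 2) (hxy : |x - y| < 2 * η) :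
    C * (1 + |-(2 * n * (y - z))|) * |x - y| ≤ C * (5 * η) := by
  rw [mul_assoc]
  refine mul_le_mul_of_nonneg_left ?_ hC
  rw [abs_neg, abs_mul, abs_of_nonneg (by positivity : 0 ≤ 2 * n)]
  have e1 : |x - y| ≤ |x - z| + |y - z| := by
    have := abs_sub_le x z y
    rwa [abs_sub_comm z y] at this
  have e2 : |y - z| * |x - y| ≤ 3 / 2 * ((x - z) ^ 2 + (y - z) ^ 2) := by
    calc |y - z| * |x - y| ≤ |y - z| * (|x - z| + |y - z|) :=
          mul_le_mul_of_nonneg_left e1 (abs_nonneg _)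
      _ ≤ _ := by
        rw [← sq_abs (x - z), ← sq_abs (y - z)]
        nlinarith [sq_nonneg (|x - z| - |y - z|), sq_nonneg (|x - z|)]
  have e3 : 2 * n * (|y - z| * |x - y|) ≤ 3 * η := by
    calc 2 * n * (|y - z| * |x - y|) ≤ 2 * n * (3 / 2 * ((x - z) ^ 2 + (y - z) ^ 2)) :=
          mul_le_mul_of_nonneg_left e2 (by positivity)
      _ = 3 * (n * ((x - z) ^ 2 + (y - z) ^ 2)) := by ring
      _ ≤ 3 * η ^ 2 := by linarith
      _ ≤ _ := by nlinarith
  calc (1 + 2 * n * |y - z|) * |x - y| = |x - y| + 2 * n * (|y - z| * |x - y|) := by ring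
    _ ≤ _ := by linarith

/-- Interior comparison: at an interior local maximum of `u - v + κ t`, where `w = -v`. -/
theorem interior_comparison {lam L C : ℝ} (hlam : 0 < lam) {a : ℝ → ℝ} {H : ℝ → ℝ → ℝ}
    (hR : RegularCoeff L C a H) {u w : ℝ → ℝ} (hsu : IsParabolicSub lam L a H u)
    (hsw : IsParabolicSub lam L a (dualHam H) w) (hu : UpperSemicontinuousOn u (Ioo 0 L))
    (hw : UpperSemicontinuousOn w (Ioo 0 L)) {B : ℝ} (huB : ∀ x ∈ Ioo 0 L, |u x| ≤ B)
    (hwB : ∀ x ∈ Ioo 0 L, |w x| ≤ B) {κ t₁ : ℝ} (ht₁ : t₁ ∈ Ioo 0 L)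
    (hmax : IsLocalMax (fun x => u x + w x + κ * x) t₁) :
    lam * (u t₁ + w t₁) ≤ C * |κ| := by
  obtain ⟨σ, hσ1, hσ2⟩ := hR.exists_sqrt
  have hC := hR.nonneg
  obtain ⟨ρ, hρ, hball⟩ := Metric.mem_nhds_iff.1 (inter_mem hmax (Ioo_mem_nhds ht₁.1 ht₁.2))
  obtain ⟨α, hα⟩ : ∃ α, α = t₁ - ρ / 2 := ⟨_, rfl⟩
  obtain ⟨β, hβ⟩ : ∃ β, β = t₁ + ρ / 2 := ⟨_, rfl⟩
  have hsubI : Icc α β ⊆ Metric.ball t₁ ρ := by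
    intro x hx
    rw [Metric.mem_ball, Real.dist_eq, abs_lt]
    constructor <;> linarith [hx.1, hx.2]
  have hIcc : Icc α β ⊆ Ioo 0 L := fun x hx => (hball (hsubI hx)).2
  have hIcc' : Ioo α β ⊆ Icc 0 L := fun x hx =>
    Ioo_subset_Icc_self (hIcc (Ioo_subset_Icc_self hx))
  have hm : ∀ x ∈ Icc α β, u x + w x + κ * x ≤ u t₁ + w t₁ + κ * t₁ :=
    fun x hx => (hball (hsubI hx)).1
  have hL : 0 ≤ L := (ht₁.1.trans ht₁.2).le
  set S : ℝ := |σ 0| + C * L with hS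
  have hσS : ∀ x ∈ Icc 0 L, σ x ^ 2 ≤ S ^ 2 := by
    intro x hx
    refine sq_le_sq.2 ?_
    rw [abs_of_nonneg (by positivity : 0 ≤ S)]
    have h1 := hσ2 x hx 0 ⟨le_rfl, hL⟩
    have h2 : C * |x - 0| ≤ C * L := by
      rw [sub_zero, abs_of_nonneg hx.1]
      exact mul_le_mul_of_nonneg_left hx.2 hC
    have h3 := abs_sub_abs_le_abs_sub (σ x) (σ 0)
    linarith
  have key : ∀ θ : ℝ, 0 < θ → ∀ η : ℝ, 0 < η → η < min 1 (ρ / 8) →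
      lam * (u t₁ + w t₁) ≤ C * |κ| + 2 * S ^ 2 * θ +
        (lam * (|κ| + 1) + 2 * S ^ 2 + 4 * C ^ 2 + C * (6 + 2 * θ)) * η := by
    intro θ hθ η hη hηm
    have hη1 : η < 1 := hηm.trans_le (min_le_left _ _)
    have hηρ : η < ρ / 8 := hηm.trans_le (min_le_right _ _)
    obtain ⟨n, x, y, z, P, Q, hn, hx, hy, hz, hpen, hxy, hpq, hval, hPQ, hju, hjw⟩ :=
      exists_jets (u := u) (w := w) (B := B) (t₁ := t₁) hθ (α := α) (β := β)
        ⟨by linarith, by linarith⟩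
        (hu.mono hIcc) (hw.mono hIcc) (fun x hx => huB x (hIcc hx)) (fun x hx => hwB x (hIcc hx))
        hm hη (by linarith) (by linarith)
    obtain ⟨τ, μ, hτμ, hk, hsc⟩ := exists_scaling (σ x) (σ y)
    have h1 := hsu x (hIcc (Ioo_subset_Icc_self hx)) _ _ (hju η hη τ)
    have h2 := hsw y (hIcc (Ioo_subset_Icc_self hy)) _ _ (hjw η hη μ)
    rw [dualHam] at h2
    have hx' := hIcc' hx
    have hy' := hIcc' hy
    -- The two momenta `2 n (x - z)` and `-2 n (y - z)` differ by about `-κ`; this produces the term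
    -- `C * |κ|`.
    have h3 := abs_le_of_regular hR hx' hy' (2 * n * (x - z)) (-(2 * n * (y - z)))
    have h4 := diffusion_estimate hn hη hη1.le hτμ hk hsc (hσS x hx') (hσ2 x hx' y hy') hPQ hpen hθ
    rw [← hσ1 x hx', ← hσ1 y hy'] at h4
    have h5 := drift_estimate hn hη hη1.le hC hpen hxy
    have h6 : C * |2 * n * (x - z) - -(2 * n * (y - z))| ≤ C * (|κ| + η + 2 * θ * η) := by
      refine mul_le_mul_of_nonneg_left ?_ hC
      have : 2 * n * (x - z) - -(2 * n * (y - z)) =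
        (2 * n * (x - z) + 2 * n * (y - z) + κ) + -κ := by ring
      rw [this]
      refine (abs_add_le _ _).trans ?_
      rw [abs_neg]
      linarith
    have h7 : u t₁ + w t₁ - (|κ| + 1) * η ≤ u x + w y := by
      have : κ * (z - t₁) ≤ |κ| * η := by
        refine (le_abs_self _).trans ?_
        rw [abs_mul]
        exact mul_le_mul_of_nonneg_left hz.le (abs_nonneg _)
      linarith
    have h8 := mul_le_mul_of_nonneg_left h7 hlam.le
    linarith
  -- First `η → 0` with `θ` fixed, since `n` and the localisation depend on `θ`; only then `θ → 0`.
  have key2 : ∀ θ : ℝ, 0 < θ → lam * (u t₁ + w t₁) ≤ C * |κ| + 2 * S ^ 2 * θ := by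
    intro θ hθ
    set K := lam * (|κ| + 1) + 2 * S ^ 2 + 4 * C ^ 2 + C * (6 + 2 * θ)
    have hlim : Tendsto (fun η : ℝ => C * |κ| + 2 * S ^ 2 * θ + K * η) (𝓝[>] 0)
        (𝓝 (C * |κ| + 2 * S ^ 2 * θ)) := by
      have : ContinuousAt (fun η : ℝ => C * |κ| + 2 * S ^ 2 * θ + K * η) 0 := by fun_prop
      have h := this.tendsto
      simp only [mul_zero, add_zero] at h
      exact h.mono_left nhdsWithin_le_nhds
    refine ge_of_tendsto hlim ?_
    filter_upwards [Ioo_mem_nhdsGT (by positivity : 0 < min 1 (ρ / 8))] with η hη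
    exact key θ hθ η hη.1 hη.2
  have hlim : Tendsto (fun θ : ℝ => C * |κ| + 2 * S ^ 2 * θ) (𝓝[>] 0) (𝓝 (C * |κ|)) := by
    have : ContinuousAt (fun θ : ℝ => C * |κ| + 2 * S ^ 2 * θ) 0 := by fun_prop
    have h := this.tendsto
    simp only [mul_zero, add_zero] at h
    exact h.mono_left nhdsWithin_le_nhds
  refine ge_of_tendsto hlim ?_
  filter_upwards [self_mem_nhdsWithin] with θ hθ
  exact key2 θ hθ

/-! ### One-sided analysis at an end point -/

theorem exists_mem_Ioo_of_frequently {P : ℝ → Prop} (h : ∃ᶠ t in 𝓝[>] (0 : ℝ), P t) {s : ℝ}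
    (hs : 0 < s) : ∃ t ∈ Ioo 0 s, P t := by
  obtain ⟨t, h1, h2⟩ := (h.and_eventually (Ioo_mem_nhdsGT hs)).exists
  exact ⟨t, h2, h1⟩

theorem exists_of_eventually_pos {P : ℝ → Prop} (h : ∀ᶠ t in 𝓝[>] (0 : ℝ), P t) :
    ∃ δ > 0, ∀ t ∈ Ioo 0 δ, P t := by
  obtain ⟨δ, hδ, h1⟩ := mem_nhdsGT_iff_exists_Ioo_subset.1 h
  exact ⟨δ, hδ, fun t ht => h1 ht⟩

section Basic

variable {lam L C B : ℝ} {a : ℝ → ℝ} {H : ℝ → ℝ → ℝ} {u w : ℝ → ℝ} {u₀ w₀ : ℝ}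

/-- A parabola can be slid down until it touches the graph between two points. -/
theorem IsParabolicSub.exists_between (hsu : IsParabolicSub lam L a H u)
    (hu : UpperSemicontinuousOn u (Ioo 0 L)) {x y z : ℝ} (hx : 0 < x) (hxy : x < y) (hyz : y < z)
    (hz : z < L) (r X : ℝ)
    (h1 : u x - (r * x + X / 2 * x ^ 2) < u y - (r * y + X / 2 * y ^ 2))
    (h2 : u z - (r * z + X / 2 * z ^ 2) < u y - (r * y + X / 2 * y ^ 2)) :
    ∃ m ∈ Ioo x z, u y - (r * y + X / 2 * y ^ 2) ≤ u m - (r * m + X / 2 * m ^ 2) ∧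
      lam * u m - a m * X + H m (r + X * m) ≤ 0 := by
  have hsub : Icc x z ⊆ Ioo 0 L := fun s hs => ⟨hx.trans_le hs.1, hs.2.trans_lt hz⟩
  have husc : UpperSemicontinuousOn (fun s => u s + -(r * s + X / 2 * s ^ 2)) (Icc x z) :=
    (hu.mono hsub).add (by fun_prop : ContinuousOn (fun s => -(r * s + X / 2 * s ^ 2))
      (Icc x z)).upperSemicontinuousOn
  obtain ⟨m, hm, hmax⟩ := husc.exists_isMaxOn (nonempty_Icc.2 (hxy.trans hyz).le) isCompact_Icc
  rw [isMaxOn_iff] at hmax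
  have hy := hmax y ⟨hxy.le, hyz.le⟩
  have hmx : x ≠ m := by
    rintro rfl
    linarith
  have hmz : m ≠ z := by
    rintro rfl
    linarith
  have hmI : m ∈ Ioo x z := ⟨lt_of_le_of_ne hm.1 hmx, lt_of_le_of_ne hm.2 hmz⟩
  refine ⟨m, hmI, by linarith, hsu m (hsub hm) _ _ ?_⟩
  filter_upwards [Icc_mem_nhds hmI.1 hmI.2] with s hs
  have := hmax s hs
  nlinarith

/-- The number `r` is an admissible slope at `0` for test functions from above with value `u₀`,
for which the differential inequality at `0` fails. -/
def Admits (lam : ℝ) (a : ℝ → ℝ) (H : ℝ → ℝ → ℝ) (u : ℝ → ℝ) (u₀ r : ℝ) : Prop :=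
  ∃ X : ℝ, 0 < lam * u₀ - a 0 * X + H 0 r ∧ ∀ᶠ t in 𝓝[>] 0, u t ≤ u₀ + r * t + X / 2 * t ^ 2

/-- `p` is the limit superior of the difference quotients of `u` at `0`. -/
def IsUpperSlope (u : ℝ → ℝ) (u₀ p : ℝ) : Prop :=
  (∀ r, p < r → ∀ᶠ t in 𝓝[>] 0, u t ≤ u₀ + r * t) ∧
    ∀ r, r < p → ∃ᶠ t in 𝓝[>] 0, u₀ + r * t < u t

/-- Coercivity of the Hamiltonian near `0`. -/
def CoerciveAtZero (H : ℝ → ℝ → ℝ) : Prop :=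
  ∃ K : ℝ, 0 < K ∧ ∀ᶠ t in 𝓝[≥] 0, ∀ p : ℝ, K⁻¹ * |p| - K ≤ H t p

theorem eventually_slope_mono {r s : ℝ} (hrs : r ≤ s)
    (h : ∀ᶠ t in 𝓝[>] 0, u t ≤ u₀ + r * t) : ∀ᶠ t in 𝓝[>] 0, u t ≤ u₀ + s * t := by
  filter_upwards [h, self_mem_nhdsWithin] with t ht ht0
  have : (0 : ℝ) < t := ht0
  nlinarith

theorem exists_isUpperSlope (h1 : ∃ r, ∀ᶠ t in 𝓝[>] 0, u t ≤ u₀ + r * t)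
    (h2 : ∃ R, ∀ r < R, ¬ ∀ᶠ t in 𝓝[>] 0, u t ≤ u₀ + r * t) : ∃ p, IsUpperSlope u u₀ p := by
  set S : Set ℝ := {r | ∀ᶠ t in 𝓝[>] 0, u t ≤ u₀ + r * t}
  have hne : S.Nonempty := h1
  obtain ⟨R, hR⟩ := h2
  have hbdd : BddBelow S := ⟨R, fun r hr => by
    by_contra! hlt
    exact hR r hlt hr⟩
  refine ⟨sInf S, fun r hr => ?_, fun r hr => ?_⟩
  · obtain ⟨s, hs, hsr⟩ := exists_lt_of_csInf_lt hne hr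
    exact eventually_slope_mono hsr.le hs
  · have : r ∉ S := fun h => absurd (csInf_le hbdd h) (not_le.2 hr)
    have h3 : ¬ ∀ᶠ t in 𝓝[>] 0, u t ≤ u₀ + r * t := this
    simpa [Filter.not_eventually] using h3

theorem admits_of_pos {r : ℝ} (h : 0 < lam * u₀ + H 0 r)
    (hu : ∀ᶠ t in 𝓝[>] 0, u t ≤ u₀ + r * t) : Admits lam a H u u₀ r :=
  ⟨0, by simpa using h, by simpa using hu⟩

/-- When `a 0 > 0`, a very negative second derivative violates the edge inequality whatever the
slope, and the gap `r - ρ` absorbs the resulting quadratic term near `0`. -/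
theorem admits_of_nondegenerate (ha : 0 < a 0) {ρ r : ℝ} (hρ : ρ < r)
    (hu : ∀ᶠ t in 𝓝[>] 0, u t ≤ u₀ + ρ * t) : Admits lam a H u u₀ r := by
  set Y : ℝ := (|lam * u₀ + H 0 r| + 1) / a 0 with hY
  have hYp : 0 < Y := by positivity
  refine ⟨-Y, ?_, ?_⟩
  · have : a 0 * Y = |lam * u₀ + H 0 r| + 1 := by
      rw [hY]
      field_simp
    linarith [neg_abs_le (lam * u₀ + H 0 r)]
  · filter_upwards [hu, Ioo_mem_nhdsGT (by
      have : 0 < r - ρ := by linarith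
      positivity : 0 < (r - ρ) / Y)] with t ht ht2
    have h1 : t * Y < r - ρ := (lt_div_iff₀ hYp).1 ht2.2
    have h2 := ht2.1
    nlinarith [mul_lt_mul_of_pos_left h1 h2]

theorem CoerciveAtZero.exists_pos (hc : CoerciveAtZero H) (c : ℝ) :
    ∃ R, ∀ r, R ≤ |r| → 0 < c + H 0 r := by
  obtain ⟨K, hK, h⟩ := hc
  have h0 := h.self_of_nhdsWithin (mem_Ici.2 le_rfl)
  refine ⟨K * (K + |c| + 1), fun r hr => ?_⟩
  have h1 := h0 r
  have h2 : K + |c| + 1 ≤ K⁻¹ * |r| := by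
    rw [inv_mul_eq_div, le_div_iff₀ hK]
    linarith
  linarith [neg_abs_le c]

/-- A Lipschitz square root that vanishes at `0` is `O(t)`. Hence second derivatives that blow up at
a degenerate end point can still give bounded or vanishing contributions. -/
theorem RegularCoeff.quadratic (hR : RegularCoeff L C a H) (ha : a 0 = 0) {t : ℝ}
    (ht : t ∈ Icc 0 L) : a t ≤ C ^ 2 * t ^ 2 := by
  obtain ⟨σ, h1, h2⟩ := hR.exists_sqrt
  have h0 : (0 : ℝ) ∈ Icc 0 L := ⟨le_rfl, ht.1.trans ht.2⟩
  have hσ0 : σ 0 = 0 := by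
    have := h1 0 h0
    rw [ha] at this
    exact pow_eq_zero_iff (two_ne_zero) |>.1 this.symm
  have h3 := h2 t ht 0 h0
  rw [hσ0, sub_zero, sub_zero, abs_of_nonneg ht.1] at h3
  rw [h1 t ht, ← sq_abs, ← mul_pow]
  exact pow_le_pow_left₀ (abs_nonneg _) h3 2

theorem RegularCoeff.a_nonneg (hR : RegularCoeff L C a H) {t : ℝ}
    (ht : t ∈ Icc 0 L) : 0 ≤ a t := by
  obtain ⟨σ, h1, h2⟩ := hR.exists_sqrt
  rw [h1 t ht]
  positivity

theorem RegularCoeff.exists_half_le (hR : RegularCoeff L C a H) (hL : 0 < L) (ha : 0 < a 0) :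
    ∃ δ > 0, δ < L ∧ ∀ t ∈ Ioo 0 δ, a 0 / 2 ≤ a t := by
  obtain ⟨σ, h1, h2⟩ := hR.exists_sqrt
  have hC := hR.nonneg
  have h0 : (0 : ℝ) ∈ Icc 0 L := ⟨le_rfl, hL.le⟩
  set Q : ℝ := 2 * C * |σ 0| + 1
  have hQ : 0 < Q := by positivity
  refine ⟨min (L / 2) (a 0 / (2 * Q)), by positivity,
    (min_le_left _ _).trans_lt (by linarith), fun t ht => ?_⟩
  have ht1 : t < L / 2 := ht.2.trans_le (min_le_left _ _)
  have ht2 : t < a 0 / (2 * Q) := ht.2.trans_le (min_le_right _ _)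
  have htI : t ∈ Icc 0 L := ⟨ht.1.le, by linarith⟩
  rw [lt_div_iff₀ (by positivity)] at ht2
  have h3 := h2 t htI 0 h0
  rw [sub_zero, abs_of_pos ht.1] at h3
  rw [h1 t htI]
  rw [h1 0 h0] at ht2 ⊢
  have h4 : 2 * σ 0 * (σ t - σ 0) ≥ -(2 * |σ 0| * (C * t)) := by
    have : |2 * σ 0 * (σ t - σ 0)| ≤ 2 * |σ 0| * (C * t) := by
      rw [abs_mul, abs_mul, abs_two]
      exact mul_le_mul_of_nonneg_left h3 (by positivity)
    linarith [neg_abs_le (2 * σ 0 * (σ t - σ 0))]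
  have h5 := ht.1
  have h6 : t * (2 * Q) = 2 * (2 * |σ 0| * (C * t)) + 2 * t := by
    simp only [Q]
    ring
  nlinarith [sq_nonneg (σ t - σ 0)]

theorem RegularCoeff.ham_ge (hR : RegularCoeff L C a H) {t : ℝ} (ht : t ∈ Icc 0 L) (p : ℝ) :
    -|H 0 0| - C * L - C * |p| ≤ H t p := by
  have hL : 0 ≤ L := ht.1.trans ht.2
  have h1 := (abs_le.1 (hR.lip_right t ht p 0)).1
  have h2 := (abs_le.1 (hR.lip_left t ht 0 ⟨le_rfl, hL⟩ 0)).1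
  rw [sub_zero] at h1
  rw [abs_zero, add_zero, mul_one, sub_zero, abs_of_nonneg ht.1] at h2
  have h3 : C * t ≤ C * L := mul_le_mul_of_nonneg_left ht.2 hR.nonneg
  linarith [neg_abs_le (H 0 0)]

theorem RegularCoeff.ham_near (hR : RegularCoeff L C a H) {t : ℝ} (ht : t ∈ Icc 0 L) (p q : ℝ) :
    H 0 p - C * (1 + |p|) * t - C * |p - q| ≤ H t q := by
  have hL : 0 ≤ L := ht.1.trans ht.2
  have h1 := (abs_le.1 (hR.lip_right t ht p q)).2
  have h2 := (abs_le.1 (hR.lip_left t ht 0 ⟨le_rfl, hL⟩ p)).1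
  rw [sub_zero, abs_of_nonneg ht.1] at h2
  linarith

theorem RegularCoeff.continuous_ham (hR : RegularCoeff L C a H) (hL : 0 ≤ L) :
    Continuous (H 0) := by
  have : LipschitzWith (Real.toNNReal C) (H 0) := LipschitzWith.of_dist_le_mul fun p q => by
    rw [Real.coe_toNNReal _ hR.nonneg, Real.dist_eq, Real.dist_eq]
    exact hR.lip_right 0 ⟨le_rfl, hL⟩ p q
  exact this.continuous

/-- The barrier `ψ s = r s - K r s²` is a strict supersolution by `hbar`, for large `r`. If `u t >
u₀ + r t`, then `u - ψ` is larger at `t` than near `0`, by the limsup bound, and than at `δ`, by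
boundedness, so it has an interior maximum that contradicts `hbar`. -/
theorem upper_linear_of_barrier (hsu : IsParabolicSub lam L a H u)
    (hu : UpperSemicontinuousOn u (Ioo 0 L)) (huB : ∀ x ∈ Ioo 0 L, |u x| ≤ B) (hu₀B : -B ≤ u₀)
    (hu₀ : ∀ ε > 0, ∀ᶠ t in 𝓝[>] 0, u t < u₀ + ε) {K δ R : ℝ} (hK : 0 ≤ K) (hδ : 0 < δ)
    (hδL : δ < L) (hKδ : K * δ ≤ 1 / 2)
    (hbar : ∀ r, R ≤ r → 0 ≤ r → ∀ m ∈ Ioo 0 δ, ∀ y, -B ≤ y →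
      0 < lam * y + a m * (2 * K * r) + H m (r * (1 - 2 * K * m))) :
    ∃ R', ∀ r, R' ≤ r → ∀ᶠ t in 𝓝[>] 0, u t ≤ u₀ + r * t := by
  have hB : 0 ≤ B := (abs_nonneg _).trans (huB δ ⟨hδ, hδL⟩)
  refine ⟨max R ((4 * B + 4) / δ), fun r hr => ?_⟩
  have hr1 : R ≤ r := (le_max_left _ _).trans hr
  have hr2 : 4 * B + 4 ≤ r * δ := (div_le_iff₀ hδ).1 ((le_max_right _ _).trans hr)
  have hr0 : 0 ≤ r := by
    by_contra! hneg
    nlinarith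
  filter_upwards [Ioo_mem_nhdsGT hδ] with t ht
  by_contra! hlt
  have hψ : ∀ s, s ∈ Icc 0 δ → r * s / 2 ≤ r * s + -(2 * K * r) / 2 * s ^ 2 := by
    intro s hs
    have h1 : K * s ≤ 1 / 2 := (mul_le_mul_of_nonneg_left hs.2 hK).trans hKδ
    have h2 : 0 ≤ r * s := mul_nonneg hr0 hs.1
    nlinarith
  have hψt : r * t + -(2 * K * r) / 2 * t ^ 2 ≤ r * t := by
    have : 0 ≤ K * r * t ^ 2 := by positivity
    linarith
  obtain ⟨η, hη, hsmall⟩ := exists_of_eventually_pos (hu₀ (u t - u₀ - r * t) (by linarith))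
  have hη' : 0 < min η t := lt_min hη ht.1
  set x := min η t / 2
  have hxη : x < η := by
    have := min_le_left η t
    simp only [x]
    linarith
  have hxt : x < t := by
    have := min_le_right η t
    simp only [x]
    linarith
  have hx0 : 0 < x := by positivity
  have h1 := hsmall x ⟨hx0, hxη⟩
  have h2 := hψ x ⟨hx0.le, (hxt.trans ht.2).le⟩
  have h3 : 0 ≤ r * x := by positivity
  have h4 := hψ δ ⟨hδ.le, le_rfl⟩
  have h5 := (abs_le.1 (huB δ ⟨hδ, hδL⟩)).2
  have h6 : 0 ≤ r * t := mul_nonneg hr0 ht.1.le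
  obtain ⟨m, hm, hm1, hm2⟩ := hsu.exists_between hu hx0 hxt ht.2 hδL r (-(2 * K * r))
    (by linarith) (by linarith)
  have hmδ : m ∈ Ioo 0 δ := ⟨hx0.trans hm.1, hm.2⟩
  have h7 := hbar r hr1 hr0 m hmδ (u m)
    (abs_le.1 (huB m ⟨hmδ.1, hmδ.2.trans hδL⟩)).1
  have h8 : r + -(2 * K * r) * m = r * (1 - 2 * K * m) := by ring
  rw [h8] at hm2
  linarith

theorem upper_linear_of_nondegenerate (hlam : 0 < lam) (hL : 0 < L) (hR : RegularCoeff L C a H)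
    (hsu : IsParabolicSub lam L a H u)
    (hu : UpperSemicontinuousOn u (Ioo 0 L)) (huB : ∀ x ∈ Ioo 0 L, |u x| ≤ B) (hu₀B : -B ≤ u₀)
    (hu₀ : ∀ ε > 0, ∀ᶠ t in 𝓝[>] 0, u t < u₀ + ε) (ha : 0 < a 0) :
    ∃ R', ∀ r, R' ≤ r → ∀ᶠ t in 𝓝[>] 0, u t ≤ u₀ + r * t := by
  have hC := hR.nonneg
  obtain ⟨δ, hδ, hδL, hδa⟩ := hR.exists_half_le hL ha
  obtain ⟨α, hα⟩ : ∃ α, α = a 0 / 2 := ⟨_, rfl⟩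
  have hαp : 0 < α := by rw [hα]; linarith
  rw [← hα] at hδa
  -- With this `K` the diffusion term `2 K r α = 2 C r + 2 r α` dominates the growth `C r` of the
  -- Hamiltonian, leaving a multiple of `r` for the bounded terms.
  obtain ⟨K, hKdef⟩ : ∃ K, K = C / α + 1 := ⟨_, rfl⟩
  have hK : 0 < K := by rw [hKdef]; positivity
  have hKα : K * α = C + α := by
    rw [hKdef]
    field_simp
  refine upper_linear_of_barrier hsu hu huB hu₀B hu₀ (K := K)
    (δ := min δ (1 / (2 * K))) (R := (lam * B + |H 0 0| + C * L + 1) / α) hK.le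
    (by positivity) ((min_le_left _ _).trans_lt hδL) ?_ ?_
  · have := mul_le_mul_of_nonneg_left (min_le_right δ (1 / (2 * K))) hK.le
    refine this.trans (le_of_eq ?_)
    field_simp
  · intro r hr hr0 m hm y hy
    have hmδ : m < δ := hm.2.trans_le (min_le_left _ _)
    have hmK : m < 1 / (2 * K) := hm.2.trans_le (min_le_right _ _)
    rw [lt_div_iff₀ (by positivity)] at hmK
    have hmL : m ∈ Icc 0 L := ⟨hm.1.le, (hmδ.trans hδL).le⟩
    rw [div_le_iff₀ hαp] at hr
    have h1 := hR.ham_ge hmL (r * (1 - 2 * K * m))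
    have h2 : |r * (1 - 2 * K * m)| ≤ r := by
      have h0 : 0 ≤ 2 * K * m := by have := hm.1; positivity
      rw [abs_of_nonneg (mul_nonneg hr0 (by linarith))]
      nlinarith
    have h3 : C * |r * (1 - 2 * K * m)| ≤ C * r := mul_le_mul_of_nonneg_left h2 hC
    have h4 : α * (2 * K * r) ≤ a m * (2 * K * r) :=
      mul_le_mul_of_nonneg_right (hδa m ⟨hm.1, hmδ⟩) (by positivity)
    have h5 : α * (2 * K * r) = 2 * C * r + 2 * (r * α) := by linear_combination 2 * r * hKα
    have h6 : lam * -B ≤ lam * y := mul_le_mul_of_nonneg_left hy hlam.le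
    have h7 : 0 ≤ C * r := by positivity
    have h8 : 0 ≤ r * α := by positivity
    linarith

theorem upper_linear_of_coercive (hlam : 0 < lam) (hL : 0 < L)
    (hsu : IsParabolicSub lam L a H u)
    (hu : UpperSemicontinuousOn u (Ioo 0 L)) (huB : ∀ x ∈ Ioo 0 L, |u x| ≤ B) (hu₀B : -B ≤ u₀)
    (hu₀ : ∀ ε > 0, ∀ᶠ t in 𝓝[>] 0, u t < u₀ + ε) (hc : CoerciveAtZero H) :
    ∃ R', ∀ r, R' ≤ r → ∀ᶠ t in 𝓝[>] 0, u t ≤ u₀ + r * t := by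
  obtain ⟨K, hK, h⟩ := hc
  obtain ⟨δ, hδ, hδc⟩ := exists_of_eventually_pos
    (h.filter_mono (nhdsWithin_mono _ Ioi_subset_Ici_self))
  refine upper_linear_of_barrier hsu hu huB hu₀B hu₀ (K := 0)
    (δ := min δ (L / 2)) (R := K * (lam * B + K + 1)) le_rfl
    (by positivity) ((min_le_right _ _).trans_lt (by linarith)) (by norm_num) ?_
  intro r hr hr0 m hm y hy
  have h1 := hδc m ⟨hm.1, hm.2.trans_le (min_le_left _ _)⟩ r
  rw [abs_of_nonneg hr0] at h1
  have h2 : lam * B + K + 1 ≤ K⁻¹ * r := by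
    rw [inv_mul_eq_div, le_div_iff₀ hK]
    linarith
  have h6 : lam * -B ≤ lam * y := mul_le_mul_of_nonneg_left hy hlam.le
  simp only [mul_zero, zero_mul, sub_zero, mul_one]
  linarith

theorem upper_linear (hlam : 0 < lam) (hL : 0 < L) (hR : RegularCoeff L C a H)
    (hsu : IsParabolicSub lam L a H u)
    (hu : UpperSemicontinuousOn u (Ioo 0 L)) (huB : ∀ x ∈ Ioo 0 L, |u x| ≤ B) (hu₀B : -B ≤ u₀)
    (hu₀ : ∀ ε > 0, ∀ᶠ t in 𝓝[>] 0, u t < u₀ + ε) (hc : CoerciveAtZero H ∨ 0 < a 0) :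
    ∃ R', ∀ r, R' ≤ r → ∀ᶠ t in 𝓝[>] 0, u t ≤ u₀ + r * t :=
  hc.elim (upper_linear_of_coercive hlam hL hsu hu huB hu₀B hu₀)
    (upper_linear_of_nondegenerate hlam hL hR hsu hu huB hu₀B hu₀)

/-- All large slopes are admissible. -/
theorem exists_admits (hlam : 0 < lam) (hL : 0 < L) (hR : RegularCoeff L C a H)
    (hsu : IsParabolicSub lam L a H u)
    (hu : UpperSemicontinuousOn u (Ioo 0 L)) (huB : ∀ x ∈ Ioo 0 L, |u x| ≤ B) (hu₀B : -B ≤ u₀)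
    (hu₀ : ∀ ε > 0, ∀ᶠ t in 𝓝[>] 0, u t < u₀ + ε) (hc : CoerciveAtZero H ∨ 0 < a 0) :
    ∃ r, Admits lam a H u u₀ r := by
  obtain ⟨R', hR'⟩ := upper_linear hlam hL hR hsu hu huB hu₀B hu₀ hc
  rcases hc with hc | ha
  · obtain ⟨R, hR⟩ := hc.exists_pos (lam * u₀)
    exact ⟨max R' R, admits_of_pos (hR _ ((le_max_right _ _).trans (le_abs_self _)))
      (hR' _ (le_max_left _ _))⟩
  · exact ⟨R' + 1, admits_of_nondegenerate ha (by linarith) (hR' R' le_rfl)⟩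

end Basic

/-! ### Upper slopes at an end point and their separation -/

section Slopes

variable {lam L C B : ℝ} {a : ℝ → ℝ} {H : ℝ → ℝ → ℝ} {u w : ℝ → ℝ} {u₀ w₀ : ℝ}

theorem upperSlope_estimate {lam C p δ ε t m A um h0 hm am u₀ : ℝ} (hlam : 0 < lam) (hC : 0 ≤ C)
    (hδ : 0 < δ) (hδ1 : δ ≤ 1) (ht : 0 < t) (hm1 : t / 2 < m) (hm2 : m < 3 * t / 2)
    (hε : ε = δ / 16)
    (hum : u₀ - ε * t + p * m ≤ um) (ham : am ≤ C ^ 2 * m ^ 2)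
    (hham : h0 - C * (1 + |p|) * m - C * |p - (p + 2 * (δ / t) * (m - t))| ≤ hm)
    (hsub : lam * um - am * (2 * (δ / t)) + hm ≤ 0)
    (hA : A = lam * (1 + 2 * |p|) + 5 * C ^ 2 + 2 * C * (1 + |p|)) :
    lam * u₀ + h0 ≤ C * δ + A * t := by
  have e1 : am * (2 * (δ / t)) ≤ 5 * C ^ 2 * t := by
    have h1 : am ≤ C ^ 2 * (9 / 4 * t ^ 2) := by
      refine ham.trans (mul_le_mul_of_nonneg_left ?_ (sq_nonneg _))
      nlinarith
    calc am * (2 * (δ / t)) ≤ C ^ 2 * (9 / 4 * t ^ 2) * (2 * (δ / t)) :=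
          mul_le_mul_of_nonneg_right h1 (by positivity)
      _ = 9 / 2 * C ^ 2 * t * δ := by
          field_simp
          ring
      _ ≤ 9 / 2 * C ^ 2 * t * 1 := mul_le_mul_of_nonneg_left hδ1 (by positivity)
      _ ≤ _ := by nlinarith [mul_nonneg (sq_nonneg C) ht.le]
  have e2 : C * |p - (p + 2 * (δ / t) * (m - t))| ≤ C * δ := by
    refine mul_le_mul_of_nonneg_left ?_ hC
    have : p - (p + 2 * (δ / t) * (m - t)) = δ * (2 * (t - m) / t) := by
      field_simp
      ring
    rw [this, abs_mul, abs_of_pos hδ]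
    refine mul_le_of_le_one_right hδ.le ?_
    rw [abs_le, le_div_iff₀ ht, div_le_iff₀ ht]
    constructor <;> linarith
  have e3 : C * (1 + |p|) * m ≤ 2 * C * (1 + |p|) * t := by
    have : 0 ≤ C * (1 + |p|) := by positivity
    nlinarith
  have e4 : lam * (u₀ - t - 2 * |p| * t) ≤ lam * um := by
    refine mul_le_mul_of_nonneg_left ?_ hlam.le
    have h1 : -(|p| * (2 * t)) ≤ p * m := by
      have h2 := neg_abs_le (p * m)
      rw [abs_mul, abs_of_pos (by linarith : 0 < m)] at h2
      have h3 : |p| * m ≤ |p| * (2 * t) := mul_le_mul_of_nonneg_left (by linarith) (abs_nonneg _)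
      linarith
    have h2 : ε * t ≤ t := by nlinarith
    linarith
  rw [hA]
  linarith

/-- At a degenerate end point the equation holds with the upper slope. -/
theorem IsUpperSlope.edge_inequality {p : ℝ} (hp : IsUpperSlope u u₀ p) (hlam : 0 < lam)
    (hL : 0 < L) (hR : RegularCoeff L C a H) (hsu : IsParabolicSub lam L a H u)
    (hu : UpperSemicontinuousOn u (Ioo 0 L)) (ha : a 0 = 0) : lam * u₀ + H 0 p ≤ 0 := by
  have hC := hR.nonneg
  obtain ⟨A, hA⟩ : ∃ A, A = lam * (1 + 2 * |p|) + 5 * C ^ 2 + 2 * C * (1 + |p|) := ⟨_, rfl⟩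
  have hA0 : 0 ≤ A := by rw [hA]; positivity
  have key : ∀ δ : ℝ, 0 < δ → δ ≤ 1 → lam * u₀ + H 0 p ≤ (C + A) * δ := by
    intro δ hδ hδ1
    obtain ⟨ε, hε⟩ : ∃ ε, ε = δ / 16 := ⟨_, rfl⟩
    have hεp : 0 < ε := by rw [hε]; positivity
    obtain ⟨η, hη, hup⟩ := exists_of_eventually_pos (hp.1 (p + ε) (by linarith))
    obtain ⟨t, ht, htl⟩ := exists_mem_Ioo_of_frequently (hp.2 (p - ε) (by linarith))
      (s := min (min (η / 2) (L / 2)) δ) (by positivity)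
    have ht0 := ht.1
    have ht1 : t < η / 2 := ht.2.trans_le ((min_le_left _ _).trans (min_le_left _ _))
    have ht2 : t < L / 2 := ht.2.trans_le ((min_le_left _ _).trans (min_le_right _ _))
    have ht3 : t < δ := ht.2.trans_le (min_le_right _ _)
    -- Up to a constant the test function is `p s + (δ / t) (s - t)²`. At `t / 2` and `3 t / 2` it
    -- rises by `δ t / 4`, more than the `5 ε t / 2 = 5 δ t / 32` that `u - p s` can gain from `t`
    -- to these points. At the contact point the slope is within `δ` of `p`, and the curvature `2 δ
    -- / t` is multiplied by `a = O(t²)`.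
    have hq : ∀ s, (p - 2 * δ) * s + 2 * (δ / t) / 2 * s ^ 2 =
        p * s + δ / t * (s - t) ^ 2 - δ * t := by
      intro s
      field_simp
      ring
    have hq1 : δ / t * (t / 2 - t) ^ 2 = δ * t / 4 := by
      field_simp
      ring
    have hq2 : δ / t * (3 * t / 2 - t) ^ 2 = δ * t / 4 := by
      field_simp
      ring
    have h1 := hup (t / 2) ⟨by linarith, by linarith⟩
    have h2 := hup (3 * t / 2) ⟨by linarith, by linarith⟩
    have hδt : 0 < δ * t := by positivity
    obtain ⟨m, hm, hm1, hm2⟩ := hsu.exists_between hu (x := t / 2) (y := t) (z := 3 * t / 2)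
      (by linarith) (by linarith) (by linarith) (by linarith) (p - 2 * δ) (2 * (δ / t))
      (by rw [hq, hq, hq1]; rw [hε] at h1 htl; nlinarith)
      (by rw [hq, hq, hq2]; rw [hε] at h2 htl; nlinarith)
    rw [hq, hq] at hm1
    have hmI : m ∈ Icc 0 L := ⟨by linarith [hm.1], by linarith [hm.2]⟩
    have hpm : p - 2 * δ + 2 * (δ / t) * m = p + 2 * (δ / t) * (m - t) := by
      field_simp
      ring
    rw [hpm] at hm2
    have hpos : 0 ≤ δ / t * (m - t) ^ 2 := by positivity
    have := upperSlope_estimate (u₀ := u₀) hlam hC hδ hδ1 ht0 hm.1 hm.2 hε (by nlinarith)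
      (hR.quadratic ha hmI) (hR.ham_near hmI p (p + 2 * (δ / t) * (m - t))) hm2 hA
    have h3 : A * t ≤ A * δ := mul_le_mul_of_nonneg_left ht3.le hA0
    linarith
  by_contra! hpos
  obtain ⟨G, hG⟩ : ∃ G, G = lam * u₀ + H 0 p := ⟨_, rfl⟩
  rw [← hG] at hpos key
  have h1 := key (min 1 (G / (2 * (C + A + 1)))) (by positivity) (min_le_left _ _)
  have h2 : (C + A) * min 1 (G / (2 * (C + A + 1))) ≤ (C + A) * (G / (2 * (C + A + 1))) :=
    mul_le_mul_of_nonneg_left (min_le_right _ _) (by positivity)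
  have h3 : (C + A) * (G / (2 * (C + A + 1))) < G := by
    rw [mul_div_assoc', div_lt_iff₀ (by positivity)]
    nlinarith
  linarith

/-- At a degenerate end point with a coercive Hamiltonian, a subsolution which is continuous along
some sequence has difference quotients bounded below. -/
theorem slope_bounded_below (hlam : 0 < lam) (hL : 0 < L) (hR : RegularCoeff L C a H)
    (hsu : IsParabolicSub lam L a H u)
    (hu : UpperSemicontinuousOn u (Ioo 0 L)) (huB : ∀ x ∈ Ioo 0 L, |u x| ≤ B)
    (hlim : ∀ ε > 0, ∃ᶠ t in 𝓝[>] 0, u₀ - ε < u t) (ha : a 0 = 0) (hc : CoerciveAtZero H) :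
    ∃ R, ∀ r < R, ¬ ∀ᶠ t in 𝓝[>] 0, u t ≤ u₀ + r * t := by
  obtain ⟨K, hK, hcK⟩ := hc
  have hB : 0 ≤ B := (abs_nonneg _).trans (huB (L / 2) ⟨by linarith, by linarith⟩)
  obtain ⟨r, hr⟩ : ∃ r, r = K * (K + lam * B + 4 * C ^ 2 * (2 * B + 2) + 1) := ⟨_, rfl⟩
  have hr0 : 0 < r := by rw [hr]; positivity
  refine ⟨-(2 * r), fun r' hr' hev => ?_⟩
  have hev2 := eventually_slope_mono hr'.le hev
  obtain ⟨δ, hδ, hδe⟩ := exists_of_eventually_pos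
    (hev2.and (hcK.filter_mono (nhdsWithin_mono _ Ioi_subset_Ici_self)))
  obtain ⟨τ, hτ, hτδ, hτL, hτr⟩ : ∃ τ > 0, τ < δ ∧ τ < L ∧ r * τ ≤ 1 := by
    refine ⟨min (min (δ / 2) (L / 2)) (1 / r), by positivity, ?_, ?_, ?_⟩
    · exact ((min_le_left _ _).trans (min_le_left _ _)).trans_lt (by linarith)
    · exact ((min_le_left _ _).trans (min_le_right _ _)).trans_lt (by linarith)
    · rw [← le_div_iff₀' hr0]
      exact min_le_right _ _
  have hrτ : 0 < r * τ := by positivity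
  obtain ⟨y, hy, hyu⟩ := exists_mem_Ioo_of_frequently (hlim (r * τ / 4) (by positivity)) hτ
  have hy0 := hy.1
  have hyτ := hy.2
  obtain ⟨ε, hε, hεy⟩ : ∃ ε > 0, ε / y ≤ r * τ / 4 := by
    refine ⟨r * τ / 4 * y, by positivity, ?_⟩
    rw [mul_div_cancel_right₀ _ hy0.ne']
  have huy := abs_le.1 (huB y ⟨hy0, hyτ.trans hτL⟩)
  obtain ⟨x, hx0, hxy, hxε⟩ : ∃ x > 0, x < y ∧ 2 * B + 2 < ε / x := by
    refine ⟨min (y / 2) (ε / (2 * B + 3)), by positivity,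
      (min_le_left _ _).trans_lt (by linarith), ?_⟩
    rw [lt_div_iff₀ (by positivity)]
    have h1 : (2 * B + 2) * min (y / 2) (ε / (2 * B + 3)) ≤ (2 * B + 2) * (ε / (2 * B + 3)) :=
      mul_le_mul_of_nonneg_left (min_le_right _ _) (by positivity)
    refine h1.trans_lt ?_
    rw [mul_div_assoc', div_lt_iff₀ (by positivity)]
    nlinarith
  have hsub : Icc x τ ⊆ Ioo 0 L := fun s hs => ⟨hx0.trans_le hs.1, hs.2.trans_lt hτL⟩
  -- The test function is `-r s + ε / s`. Its singular part keeps the maximum away from `0`, and the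
  -- assumed bound `u ≤ u₀ - 2 r s` keeps it away from `τ`. At the maximum the slope is below `-r`,
  -- while `a` times the curvature is of order `ε / m`, which is bounded by `2 B + 2`; coercivity is
  -- then violated.
  have hcont : ContinuousOn (fun s => r * s - ε / s) (Icc x τ) := by
    refine ContinuousOn.sub (by fun_prop) (ContinuousOn.div (by fun_prop) continuousOn_id ?_)
    exact fun s hs => (hx0.trans_le hs.1).ne'
  have husc : UpperSemicontinuousOn (fun s => u s + (r * s - ε / s)) (Icc x τ) :=
    (hu.mono hsub).add hcont.upperSemicontinuousOn
  obtain ⟨m, hm, hmax⟩ := husc.exists_isMaxOn (nonempty_Icc.2 (hxy.trans hyτ).le) isCompact_Icc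
  rw [isMaxOn_iff] at hmax
  have hmy := hmax y ⟨hxy.le, hyτ.le⟩
  have hry : 0 < r * y := by positivity
  have hmx : x ≠ m := by
    rintro rfl
    have h1 := (abs_le.1 (huB x (hsub hm))).2
    have h2 : r * x ≤ r * y := mul_le_mul_of_nonneg_left hxy.le hr0.le
    linarith
  have hmτ : m ≠ τ := by
    rintro rfl
    have h1 := (hδe m ⟨hτ, hτδ⟩).1
    have h2 : 0 < ε / m := by positivity
    linarith
  have hm0 : 0 < m := hx0.trans_le hm.1
  have hmI : m ∈ Ioo x τ := ⟨lt_of_le_of_ne hm.1 hmx, lt_of_le_of_ne hm.2 hmτ⟩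
  have hεm : ε / m ≤ 2 * B + 2 := by
    have h1 := (abs_le.1 (huB m (hsub hm))).2
    have h2 : r * m ≤ r * τ := mul_le_mul_of_nonneg_left hm.2 hr0.le
    linarith
  have hjet := hsu m (hsub hm) (-r - ε / m ^ 2) (4 * ε / m ^ 3) (by
    filter_upwards [Icc_mem_nhds hmI.1 hmI.2, lt_mem_nhds (by linarith : m / 2 < m)] with s hs hs2
    have h1 := hmax s hs
    have hs0 : 0 < s := hx0.trans_le hs.1
    have h2 : ε / s - ε / m ≤ -(ε / m ^ 2) * (s - m) + 4 * ε / m ^ 3 / 2 * (s - m) ^ 2 := by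
      have e1 : ε / s - ε / m = -(ε / m ^ 2) * (s - m) + ε / (s * m ^ 2) * (s - m) ^ 2 := by
        field_simp
        ring
      rw [e1]
      refine add_le_add_right (mul_le_mul_of_nonneg_right ?_ (sq_nonneg _)) _
      -- The curvature `4 ε / m³`, twice the exact one, is enough because `s > m / 2`.
      rw [div_div, div_le_div_iff₀ (by positivity) (by positivity)]
      have : 0 < ε * m ^ 2 := by positivity
      nlinarith
    linarith)
  have h1 := hδe m ⟨hm0, hm.2.trans_lt hτδ⟩ |>.2 (-r - ε / m ^ 2)
  have h2 : r ≤ |-r - ε / m ^ 2| := by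
    have : 0 < ε / m ^ 2 := by positivity
    rw [abs_of_neg (by linarith)]
    linarith
  have h3 : K + lam * B + 4 * C ^ 2 * (2 * B + 2) + 1 ≤ K⁻¹ * |-r - ε / m ^ 2| := by
    rw [inv_mul_eq_div, le_div_iff₀ hK]
    linarith
  have h4 : a m * (4 * ε / m ^ 3) ≤ 4 * C ^ 2 * (2 * B + 2) := by
    calc a m * (4 * ε / m ^ 3) ≤ C ^ 2 * m ^ 2 * (4 * ε / m ^ 3) :=
          mul_le_mul_of_nonneg_right (hR.quadratic ha ⟨hm0.le, hm.2.trans hτL.le⟩) (by positivity)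
      _ = 4 * C ^ 2 * (ε / m) := by
          field_simp
      _ ≤ _ := mul_le_mul_of_nonneg_left hεm (by positivity)
  have h5 : lam * -B ≤ lam * u m :=
    mul_le_mul_of_nonneg_left (abs_le.1 (huB m (hsub hm))).1 hlam.le
  linarith

/-- If `u - v` attains its positive maximum at `0`, with `w = -v`, then the lower slope of `v` at
`0` is at least the upper slope of `u`. -/
theorem IsUpperSlope.dual_le {p : ℝ} (hp : IsUpperSlope u u₀ p) (hlam : 0 < lam)
    (hL : 0 < L) (hR : RegularCoeff L C a H) (hsu : IsParabolicSub lam L a H u)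
    (hsw : IsParabolicSub lam L a (dualHam H) w) (hu : UpperSemicontinuousOn u (Ioo 0 L))
    (hw : UpperSemicontinuousOn w (Ioo 0 L)) (hM : 0 < u₀ + w₀)
    (hle : ∀ t ∈ Ioo 0 L, u t + w t ≤ u₀ + w₀) {r : ℝ} (hr : r < p) :
    ∀ᶠ t in 𝓝[>] 0, w t ≤ w₀ + -r * t := by
  have hC := hR.nonneg
  -- Otherwise `u > u₀ + r t` and `w > w₀ - r t` both occur arbitrarily close to `0`, and never
  -- together, as `u + w ≤ u₀ + w₀`. The two kinds of points alternate, so straight lines touch both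
  -- graphs at interior points tending to `0`. In the limit this gives `lam u₀ + H 0 r ≤ 0` and `lam
  -- w₀ - H 0 r ≤ 0`, which cannot both hold since `u₀ + w₀ > 0`. Lines have no curvature, so `a`
  -- plays no role.
  by_contra hcon
  have hfw : ∃ᶠ t in 𝓝[>] 0, w₀ + -r * t < w t := by
    simpa [Filter.not_eventually] using hcon
  have hfu := hp.2 r hr
  obtain ⟨A, hA⟩ : ∃ A, A = lam * |r| + C * (1 + |r|) := ⟨_, rfl⟩
  have hA0 : 0 ≤ A := by rw [hA]; positivity
  have hrm : ∀ m, 0 < m → |lam * (r * m)| = lam * |r| * m := fun m hm => by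
    rw [abs_mul, abs_mul, abs_of_pos hlam, abs_of_pos hm, mul_assoc]
  rcases lt_or_ge 0 (lam * w₀ - H 0 r) with hpos | hneg
  · obtain ⟨G, hG⟩ : ∃ G, G = lam * w₀ - H 0 r := ⟨_, rfl⟩
    rw [← hG] at hpos
    obtain ⟨z, hz, hzu⟩ := exists_mem_Ioo_of_frequently hfu
      (s := min L (G / (A + 1))) (by positivity)
    obtain ⟨y, hy, hyw⟩ := exists_mem_Ioo_of_frequently hfw hz.1
    obtain ⟨x, hx, hxu⟩ := exists_mem_Ioo_of_frequently hfu hy.1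
    have hzL : z < L := hz.2.trans_le (min_le_left _ _)
    have hzG : z < G / (A + 1) := hz.2.trans_le (min_le_right _ _)
    rw [lt_div_iff₀ (by positivity)] at hzG
    have h1 := hle z ⟨hz.1, hzL⟩
    have h2 := hle x ⟨hx.1, by linarith [hx.2, hy.2]⟩
    obtain ⟨m, hm, hm1, hm2⟩ := hsw.exists_between hw hx.1 hx.2 hy.2 hzL (-r) 0
      (by linarith) (by linarith)
    have hm0 : 0 < m := hx.1.trans hm.1
    have hmI : m ∈ Icc 0 L := ⟨hm0.le, (hm.2.trans hzL).le⟩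
    rw [zero_mul, add_zero, mul_zero, sub_zero, dualHam, neg_neg] at hm2
    have h3 := (abs_le.1 (hR.lip_left m hmI 0 ⟨le_rfl, hL.le⟩ r)).2
    rw [sub_zero, abs_of_pos hm0] at h3
    have h4 := (abs_le.1 (hrm m hm0).le).2
    have h5 : lam * (w₀ - r * m) ≤ lam * w m := mul_le_mul_of_nonneg_left (by linarith) hlam.le
    have h6 : A * m ≤ A * z := mul_le_mul_of_nonneg_left hm.2.le hA0
    rw [hA] at h6 hzG
    linarith [hz.1]
  · have hpos : 0 < lam * u₀ + H 0 r := by nlinarith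
    obtain ⟨G, hG⟩ : ∃ G, G = lam * u₀ + H 0 r := ⟨_, rfl⟩
    rw [← hG] at hpos
    obtain ⟨z, hz, hzw⟩ := exists_mem_Ioo_of_frequently hfw
      (s := min L (G / (A + 1))) (by positivity)
    obtain ⟨y, hy, hyu⟩ := exists_mem_Ioo_of_frequently hfu hz.1
    obtain ⟨x, hx, hxw⟩ := exists_mem_Ioo_of_frequently hfw hy.1
    have hzL : z < L := hz.2.trans_le (min_le_left _ _)
    have hzG : z < G / (A + 1) := hz.2.trans_le (min_le_right _ _)
    rw [lt_div_iff₀ (by positivity)] at hzG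
    have h1 := hle z ⟨hz.1, hzL⟩
    have h2 := hle x ⟨hx.1, by linarith [hx.2, hy.2]⟩
    obtain ⟨m, hm, hm1, hm2⟩ := hsu.exists_between hu hx.1 hx.2 hy.2 hzL r 0
      (by linarith) (by linarith)
    have hm0 : 0 < m := hx.1.trans hm.1
    have hmI : m ∈ Icc 0 L := ⟨hm0.le, (hm.2.trans hzL).le⟩
    rw [zero_mul, add_zero, mul_zero, sub_zero] at hm2
    have h3 := (abs_le.1 (hR.lip_left m hmI 0 ⟨le_rfl, hL.le⟩ r)).1
    rw [sub_zero, abs_of_pos hm0] at h3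
    have h4 := (abs_le.1 (hrm m hm0).le).1
    have h5 : lam * (u₀ + r * m) ≤ lam * u m := mul_le_mul_of_nonneg_left (by linarith) hlam.le
    have h6 : A * m ≤ A * z := mul_le_mul_of_nonneg_left hm.2.le hA0
    rw [hA] at h6 hzG
    linarith [hz.1]

/-- At a nondegenerate end point the upper slope is a limit. -/
theorem IsUpperSlope.lower_of_nondegenerate {p : ℝ} (hp : IsUpperSlope u u₀ p) (hlam : 0 < lam)
    (hL : 0 < L) (hR : RegularCoeff L C a H) (hsu : IsParabolicSub lam L a H u)
    (hu : UpperSemicontinuousOn u (Ioo 0 L)) (huB : ∀ x ∈ Ioo 0 L, |u x| ≤ B) (ha : 0 < a 0)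
    {ρ : ℝ} (hρ : ρ < p) : ∀ᶠ t in 𝓝[>] 0, u₀ + ρ * t ≤ u t := by
  have hC := hR.nonneg
  have hB : 0 ≤ B := (abs_nonneg _).trans (huB (L / 2) ⟨by linarith, by linarith⟩)
  obtain ⟨δ, hδ, hδL, hδa⟩ := hR.exists_half_le hL ha
  obtain ⟨α, hα⟩ : ∃ α, α = a 0 / 2 := ⟨_, rfl⟩
  have hαp : 0 < α := by rw [hα]; linarith
  rw [← hα] at hδa
  obtain ⟨ρ₁, hρ₁⟩ : ∃ ρ₁, ρ₁ = (ρ + p) / 2 := ⟨_, rfl⟩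
  obtain ⟨Y, hY⟩ : ∃ Y, Y = 2 * (lam * B + |H 0 0| + C * L + C * |ρ₁| + 1) / α := ⟨_, rfl⟩
  have hYp : 0 < Y := by rw [hY]; positivity
  have hYα : α * Y = 2 * (lam * B + |H 0 0| + C * L + C * |ρ₁| + 1) := by
    rw [hY]
    field_simp
  obtain ⟨η, hη⟩ : ∃ η, η = min δ (α / (2 * C + 1)) := ⟨_, rfl⟩
  have hη0 : 0 < η := by rw [hη]; positivity
  have hηδ : η ≤ δ := by rw [hη]; exact min_le_left _ _
  have hηC : η * (2 * C + 1) ≤ α := by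
    rw [← le_div_iff₀ (by positivity), hη]
    exact min_le_right _ _
  -- Points violating this bound would alternate with points where `u > u₀ + ρ₁ t`, so a concave
  -- parabola would touch `u` from above between two of them. There `a Y ≥ α Y`; the slope change `Y
  -- m` costs at most `α Y / 2` by the choice of `η`, and the other half exceeds all bounded terms
  -- by the choice of `Y`.
  have hev : ∀ᶠ t in 𝓝[>] 0, u₀ ≤ u t - (ρ₁ * t + -Y / 2 * t ^ 2) := by
    by_contra hcon
    have hf1 : ∃ᶠ t in 𝓝[>] 0, u t - (ρ₁ * t + -Y / 2 * t ^ 2) < u₀ := by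
      simpa [Filter.not_eventually] using hcon
    have hf2 := hp.2 ρ₁ (by linarith)
    obtain ⟨z, hz, hz1⟩ := exists_mem_Ioo_of_frequently hf1 hη0
    obtain ⟨y, hy, hy1⟩ := exists_mem_Ioo_of_frequently hf2 hz.1
    obtain ⟨x, hx, hx1⟩ := exists_mem_Ioo_of_frequently hf1 hy.1
    have hy2 : 0 ≤ Y / 2 * y ^ 2 := by positivity
    obtain ⟨m, hm, -, hm2⟩ := hsu.exists_between hu hx.1 hx.2 hy.2
      (hz.2.trans_le (hηδ.trans hδL.le)) ρ₁ (-Y) (by linarith) (by linarith)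
    have hm0 : 0 < m := hx.1.trans hm.1
    have hmη : m < η := hm.2.trans hz.2
    have hmI : m ∈ Icc 0 L := ⟨hm0.le, by linarith⟩
    have h1 := hR.ham_ge hmI (ρ₁ + -Y * m)
    have h2 : C * |ρ₁ + -Y * m| ≤ C * |ρ₁| + α * Y / 2 := by
      have e1 : |ρ₁ + -Y * m| ≤ |ρ₁| + Y * m := by
        refine (abs_add_le _ _).trans (le_of_eq ?_)
        rw [neg_mul, abs_neg, abs_of_pos (by positivity : 0 < Y * m)]
      have e2 := mul_le_mul_of_nonneg_left e1 hC
      have e3 : C * m ≤ α / 2 := by nlinarith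
      have e4 := mul_le_mul_of_nonneg_right e3 hYp.le
      linarith
    have h3 : α * Y ≤ a m * Y :=
      mul_le_mul_of_nonneg_right (hδa m ⟨hm0, by linarith⟩) hYp.le
    have h4 : lam * -B ≤ lam * u m :=
      mul_le_mul_of_nonneg_left (abs_le.1 (huB m ⟨hm0, by linarith⟩)).1 hlam.le
    linarith
  have hd : 0 < ρ₁ - ρ := by rw [hρ₁]; linarith
  filter_upwards [hev, Ioo_mem_nhdsGT (by positivity : 0 < (ρ₁ - ρ) / Y)] with t ht htη
  have h1 : t * Y < ρ₁ - ρ := (lt_div_iff₀ hYp).1 htη.2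
  have h2 := htη.1
  nlinarith [mul_lt_mul_of_pos_left h1 h2]

/-- Separation of the slopes at an end point where `u - v`, `v = -w`, has a positive maximum. -/
theorem exists_admits_pair (hlam : 0 < lam)
    (hL : 0 < L) (hR : RegularCoeff L C a H) (hsu : IsParabolicSub lam L a H u)
    (hsw : IsParabolicSub lam L a (dualHam H) w) (hu : UpperSemicontinuousOn u (Ioo 0 L))
    (hw : UpperSemicontinuousOn w (Ioo 0 L)) (huB : ∀ x ∈ Ioo 0 L, |u x| ≤ B)
    (hu₀B : -B ≤ u₀) (hu₀ : ∀ ε > 0, ∀ᶠ t in 𝓝[>] 0, u t < u₀ + ε)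
    (hc : CoerciveAtZero H ∨ 0 < a 0) (hM : 0 < u₀ + w₀)
    (hle : ∀ t ∈ Ioo 0 L, u t + w t ≤ u₀ + w₀) {κ : ℝ} (hκ : 0 < κ)
    (hleκ : ∀ᶠ t in 𝓝[>] 0, u t + w t ≤ u₀ + w₀ - κ * t)
    (hbelow : ∃ R, ∀ r < R, ¬ Admits lam a H u u₀ r) :
    ∃ r r', r < r' ∧ Admits lam a H u u₀ r ∧ Admits lam a (dualHam H) w w₀ (-r') := by
  obtain ⟨R₁, hR₁⟩ := upper_linear hlam hL hR hsu hu huB hu₀B hu₀ hc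
  obtain ⟨R₂, hR₂⟩ := hbelow
  by_cases ha : 0 < a 0
  · obtain ⟨p, hp⟩ := exists_isUpperSlope (u := u) (u₀ := u₀) ⟨R₁, hR₁ R₁ le_rfl⟩
      ⟨R₂ - 1, fun r hr hev => hR₂ (r + 1) (by linarith)
        (admits_of_nondegenerate ha (by linarith) hev)⟩
    -- Since `p` is a true limit here, the linear decay pushes the slopes of `v` to at least `p + 5
    -- κ / 6`, and the interval up to there has room for both slopes.
    refine ⟨p + κ / 3, p + 2 * κ / 3, by linarith,
      admits_of_nondegenerate ha (ρ := p + κ / 6) (by linarith) (hp.1 _ (by linarith)),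
      admits_of_nondegenerate ha (ρ := -(p + 5 * κ / 6)) (by linarith) ?_⟩
    filter_upwards [hleκ, hp.lower_of_nondegenerate hlam hL hR hsu hu huB ha
      (by linarith : p - κ / 6 < p)] with t h1 h2
    linarith
  · have hc' : CoerciveAtZero H := hc.resolve_right ha
    have ha0 : a 0 = 0 := le_antisymm (not_lt.1 ha) (hR.a_nonneg ⟨le_rfl, hL.le⟩)
    obtain ⟨R₃, hR₃⟩ := hc'.exists_pos (lam * u₀)
    obtain ⟨p, hp⟩ := exists_isUpperSlope (u := u) (u₀ := u₀) ⟨R₁, hR₁ R₁ le_rfl⟩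
      ⟨min R₂ (-|R₃|), fun r hr hev => hR₂ r (hr.trans_le (min_le_left _ _))
        (admits_of_pos (hR₃ r (by
          have h1 := hr.trans_le (min_le_right _ _)
          have h2 := neg_le_abs r
          linarith [le_abs_self R₃])) hev)⟩
    have hGp := hp.edge_inequality hlam hL hR hsu hu ha0
    obtain ⟨M, hMdef⟩ : ∃ M, M = lam * (u₀ + w₀) := ⟨_, rfl⟩
    have hMp : 0 < M := by rw [hMdef]; positivity
    have hcontH := hR.continuous_ham hL.le
    -- `b` is the lower slope of `v` if that is finite; the edge inequality for `v` then gives `lam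
    -- u₀ + H 0 b ≥ M`. If it is infinite, every slope lies below it, and coercivity provides a
    -- suitable `b`.
    obtain ⟨b, hpb, hGb, hb⟩ : ∃ b, p ≤ b ∧ M / 2 < lam * u₀ + H 0 b ∧
        ∀ r < b, ∀ᶠ t in 𝓝[>] 0, w t ≤ w₀ + -r * t := by
      by_cases hbd : ∃ R, ∀ r < R, ¬ ∀ᶠ t in 𝓝[>] 0, w t ≤ w₀ + r * t
      · obtain ⟨q, hq⟩ := exists_isUpperSlope (u := w) (u₀ := w₀)
          ⟨-(p - 1), hp.dual_le hlam hL hR hsu hsw hu hw hM hle (by linarith)⟩ hbd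
        have hGq := hq.edge_inequality hlam hL hR.dual hsw hw ha0
        rw [dualHam] at hGq
        refine ⟨-q, ?_, by linarith, fun r hr => hq.1 _ (by linarith)⟩
        by_contra! hlt
        have h1 := hp.dual_le hlam hL hR hsu hsw hu hw hM hle
          (by linarith : (p + -q) / 2 < p)
        have h2 := hq.2 (-((p + -q) / 2)) (by linarith)
        exact h2 (h1.mono fun t ht => not_lt.2 ht)
      · push Not at hbd
        obtain ⟨R₄, hR₄⟩ := hc'.exists_pos (lam * u₀ - M / 2)
        refine ⟨max p R₄, le_max_left _ _, ?_, fun r _ => ?_⟩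
        · have := hR₄ (max p R₄) ((le_max_right _ _).trans (le_abs_self _))
          linarith
        · obtain ⟨s, hs, hev⟩ := hbd (-r)
          exact eventually_slope_mono hs.le hev
    have hcf : Continuous fun r => lam * u₀ + H 0 r := continuous_const.add hcontH
    -- `lam u₀ + H 0 ·` is nonpositive at `p` and above `M / 2` at `b`. At the level `M / 2` the
    -- inequality fails for `u`; slightly to the right the level is still below `M`, so that it
    -- fails for `v` as well.
    obtain ⟨r, hrI, hr⟩ := intermediate_value_Icc hpb hcf.continuousOn
      (⟨by linarith, hGb.le⟩ : M / 2 ∈ Icc (lam * u₀ + H 0 p) (lam * u₀ + H 0 b))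
    simp only at hr
    have hrp : p < r := lt_of_le_of_ne hrI.1 (by rintro rfl; linarith)
    have hrb : r < b := lt_of_le_of_ne hrI.2 (by rintro rfl; linarith)
    have hev : ∀ᶠ s in 𝓝[>] r, lam * u₀ + H 0 s < M :=
      (hcf.continuousAt.eventually (gt_mem_nhds (by linarith : lam * u₀ + H 0 r < M))).filter_mono
        nhdsWithin_le_nhds
    obtain ⟨s, hs1, hs2⟩ := (hev.and (Ioo_mem_nhdsGT hrb)).exists
    refine ⟨r, s, hs2.1, admits_of_pos (by linarith) (hp.1 r hrp),
      admits_of_pos ?_ (hb s hs2.2)⟩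
    rw [dualHam, neg_neg]
    linarith

/-- At an end point where `u - v`, `v = -w`, has a positive maximum and `u` is continuous along
some sequence, some slope is admissible for `w`. -/
theorem exists_admits_dual (hlam : 0 < lam)
    (hL : 0 < L) (hR : RegularCoeff L C a H) (hsu : IsParabolicSub lam L a H u)
    (hsw : IsParabolicSub lam L a (dualHam H) w) (hu : UpperSemicontinuousOn u (Ioo 0 L))
    (hw : UpperSemicontinuousOn w (Ioo 0 L)) (huB : ∀ x ∈ Ioo 0 L, |u x| ≤ B)
    (hwB : ∀ x ∈ Ioo 0 L, |w x| ≤ B) (hw₀B : -B ≤ w₀)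
    (hu₀B : -B ≤ u₀) (hu₀ : ∀ ε > 0, ∀ᶠ t in 𝓝[>] 0, u t < u₀ + ε)
    (hw₀ : ∀ ε > 0, ∀ᶠ t in 𝓝[>] 0, w t < w₀ + ε)
    (hlim : ∀ ε > 0, ∃ᶠ t in 𝓝[>] 0, u₀ - ε < u t)
    (hc : CoerciveAtZero H ∨ 0 < a 0) (hM : 0 < u₀ + w₀)
    (hle : ∀ t ∈ Ioo 0 L, u t + w t ≤ u₀ + w₀) :
    ∃ r, Admits lam a (dualHam H) w w₀ r := by
  by_cases ha : 0 < a 0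
  · exact exists_admits hlam hL hR.dual hsw hw hwB hw₀B hw₀ (Or.inr ha)
  · have hc' : CoerciveAtZero H := hc.resolve_right ha
    have ha0 : a 0 = 0 := le_antisymm (not_lt.1 ha) (hR.a_nonneg ⟨le_rfl, hL.le⟩)
    obtain ⟨R₁, hR₁⟩ := upper_linear hlam hL hR hsu hu huB hu₀B hu₀ hc
    obtain ⟨p, hp⟩ := exists_isUpperSlope (u := u) (u₀ := u₀) ⟨R₁, hR₁ R₁ le_rfl⟩
      (slope_bounded_below hlam hL hR hsu hu huB hlim ha0 hc')
    have hGp := hp.edge_inequality hlam hL hR hsu hu ha0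
    have hcf : Continuous fun r => lam * w₀ - H 0 r :=
      continuous_const.sub (hR.continuous_ham hL.le)
    -- Coercivity of `H` has the wrong sign for the dual Hamiltonian, so the slope has to come from
    -- `u`: the edge inequality at `p` and `u₀ + w₀ > 0` make the dual inequality fail near `p`, and
    -- `dual_le` allows slopes just below `p`.
    have hpos : 0 < lam * w₀ - H 0 p := by nlinarith
    obtain ⟨s, hs1, hs2⟩ := (((hcf.continuousAt.eventually (lt_mem_nhds hpos)).filter_mono
      nhdsWithin_le_nhds).and (self_mem_nhdsWithin : Iio p ∈ 𝓝[<] p)).exists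
    refine ⟨-s, admits_of_pos ?_ (hp.dual_le hlam hL hR hsu hsw hu hw hM hle hs2)⟩
    rw [dualHam, neg_neg]
    linarith

end Slopes

namespace EmbeddedNetwork

variable {d : ℕ} {Γ : EmbeddedNetwork d}

/-! ### Geometry of the network -/

theorem source_ne_target (e : Γ.Edge) : source e ≠ target e := fun h =>
  (Γ.edges_lt e.1 e.2).ne (Γ.vert_injective h)

theorem length_pos (e : Γ.Edge) : 0 < length e := dist_pos.2 (source_ne_target e)

theorem dist_param (e : Γ.Edge) (s t : ℝ) : dist (param e s) (param e t) = |s - t| := by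
  have hℓ := length_pos e
  have hlen : dist (target e) (source e) = length e := dist_comm _ _
  rw [param, param, dist_add_left, dist_eq_norm, ← sub_smul, norm_smul,
    ← dist_eq_norm (target e), hlen, ← sub_div, Real.norm_eq_abs, abs_div, abs_of_pos hℓ]
  field_simp

@[simp] theorem param_zero (e : Γ.Edge) : param e 0 = source e := by simp [param]

@[simp] theorem param_length (e : Γ.Edge) : param e (length e) = target e := by
  simp [param, div_self (length_pos e).ne']

theorem continuous_param (e : Γ.Edge) : Continuous (param e) := by
  unfold param
  fun_prop

theorem coord_param (e : Γ.Edge) {t : ℝ} (ht : 0 ≤ t) : coord e (param e t) = t := by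
  rw [coord, ← param_zero e, dist_param, zero_sub, abs_neg, abs_of_nonneg ht]

theorem continuous_coord (e : Γ.Edge) : Continuous (coord e) := by
  unfold coord
  fun_prop

theorem closedEdge_eq_image (e : Γ.Edge) : closedEdge e = param e '' Icc 0 (length e) := by
  have hℓ := length_pos e
  rw [closedEdge, segment_eq_image']
  ext x
  constructor
  · rintro ⟨θ, hθ, rfl⟩
    refine ⟨θ * length e, ⟨mul_nonneg hθ.1 hℓ.le, mul_le_of_le_one_left hℓ.le hθ.2⟩, ?_⟩
    rw [param, mul_div_cancel_right₀ _ hℓ.ne']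
  · rintro ⟨t, ht, rfl⟩
    exact ⟨t / length e, ⟨div_nonneg ht.1 hℓ.le, div_le_one_of_le₀ ht.2 hℓ.le⟩, rfl⟩

theorem openEdge_eq_image (e : Γ.Edge) : openEdge e = param e '' Ioo 0 (length e) := by
  have hℓ := length_pos e
  rw [openEdge, openSegment_eq_image']
  ext x
  constructor
  · rintro ⟨θ, hθ, rfl⟩
    refine ⟨θ * length e, ⟨mul_pos hθ.1 hℓ, mul_lt_of_lt_one_left hℓ hθ.2⟩, ?_⟩
    rw [param, mul_div_cancel_right₀ _ hℓ.ne']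
  · rintro ⟨t, ht, rfl⟩
    exact ⟨t / length e, ⟨div_pos ht.1 hℓ, (div_lt_one hℓ).2 ht.2⟩, rfl⟩

theorem param_mem_closedEdge (e : Γ.Edge) {t : ℝ} (ht : t ∈ Icc 0 (length e)) :
    param e t ∈ closedEdge e := closedEdge_eq_image e ▸ mem_image_of_mem _ ht

theorem param_mem_openEdge (e : Γ.Edge) {t : ℝ} (ht : t ∈ Ioo 0 (length e)) :
    param e t ∈ openEdge e := openEdge_eq_image e ▸ mem_image_of_mem _ ht

theorem openEdge_subset (e : Γ.Edge) : openEdge e ⊆ closedEdge e := openSegment_subset_segment _ _ _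

theorem closedEdge_subset (e : Γ.Edge) : closedEdge e ⊆ Γ.carrier := subset_iUnion _ e

theorem coord_mem (e : Γ.Edge) {x : EuclideanSpace ℝ (Fin d)} (hx : x ∈ closedEdge e) :
    coord e x ∈ Icc 0 (length e) := by
  rw [closedEdge_eq_image] at hx
  obtain ⟨t, ht, rfl⟩ := hx
  rwa [coord_param e ht.1]

theorem param_coord (e : Γ.Edge) {x : EuclideanSpace ℝ (Fin d)} (hx : x ∈ closedEdge e) :
    param e (coord e x) = x := by
  rw [closedEdge_eq_image] at hx
  obtain ⟨t, ht, rfl⟩ := hx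
  rw [coord_param e ht.1]

theorem isCompact_closedEdge (e : Γ.Edge) : IsCompact (closedEdge e) := by
  rw [closedEdge_eq_image]
  exact isCompact_Icc.image (continuous_param e)

theorem isCompact_carrier : IsCompact Γ.carrier := isCompact_iUnion isCompact_closedEdge

theorem carrier_nonempty : Γ.carrier.Nonempty := by
  obtain ⟨x, hx⟩ := Γ.connected.nonempty
  simp only [mem_iUnion] at hx
  obtain ⟨e, he, hx⟩ := hx
  exact ⟨x, closedEdge_subset ⟨e, he⟩ hx⟩

theorem vert_mem_closedEdge_iff (e : Γ.Edge) (i : Γ.Vertex) :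
    Γ.vert i ∈ closedEdge e ↔ e.1.1 = i ∨ e.1.2 = i := by
  constructor
  · intro h
    have : Γ.vert i ∈ ({Γ.vert e.1.1, Γ.vert e.1.2} : Set _) := by
      rw [← Γ.segment_inter_vert e.1 e.2]
      exact ⟨h, mem_range_self i⟩
    rcases this with h | h
    · exact Or.inl (Γ.vert_injective h).symm
    · exact Or.inr (Γ.vert_injective h).symm
  · rintro (rfl | rfl)
    · exact left_mem_segment _ _ _
    · exact right_mem_segment _ _ _

theorem coord_source (e : Γ.Edge) : coord e (Γ.vert e.1.1) = 0 := dist_self _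

theorem coord_target (e : Γ.Edge) : coord e (Γ.vert e.1.2) = length e := rfl

theorem coord_vert (e : Γ.Edge) {i : Γ.Vertex} (h : Γ.vert i ∈ closedEdge e) :
    coord e (Γ.vert i) = 0 ∨ coord e (Γ.vert i) = length e := by
  rcases (vert_mem_closedEdge_iff e i).1 h with rfl | rfl
  · exact Or.inl (coord_source e)
  · exact Or.inr (coord_target e)

theorem mem_openEdge_or_vert (e : Γ.Edge) {x : EuclideanSpace ℝ (Fin d)} (hx : x ∈ closedEdge e) :
    x ∈ openEdge e ∨ ∃ i, Γ.vert i = x := by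
  have h := coord_mem e hx
  rw [← param_coord e hx]
  rcases h.1.eq_or_lt with h0 | h0
  · right
    rw [← h0]
    exact ⟨e.1.1, (param_zero e).symm⟩
  · rcases h.2.eq_or_lt with h1 | h1
    · right
      rw [h1]
      exact ⟨e.1.2, (param_length e).symm⟩
    · exact Or.inl (param_mem_openEdge e ⟨h0, h1⟩)

theorem vert_notMem_openEdge (e : Γ.Edge) (i : Γ.Vertex) : Γ.vert i ∉ openEdge e := by
  intro h
  have h1 := coord_vert e (openEdge_subset e h)
  rw [openEdge_eq_image] at h
  obtain ⟨t, ht, h2⟩ := h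
  rw [← h2, coord_param e ht.1.le] at h1
  rcases h1 with h1 | h1
  · exact ht.1.ne' h1
  · exact ht.2.ne h1

theorem edge_unique {e f : Γ.Edge} {x : EuclideanSpace ℝ (Fin d)} (hx : x ∈ openEdge e)
    (hf : x ∈ closedEdge f) : f = e := by
  by_contra hne
  rcases mem_openEdge_or_vert f hf with h | ⟨i, rfl⟩
  · have := Γ.disjoint_edges f.1 f.2 e.1 e.2 (fun h => hne (Subtype.ext h))
    exact this.ne_of_mem h hx rfl
  · exact vert_notMem_openEdge e i hx

theorem vert_of_mem_two {e f : Γ.Edge} (hne : e ≠ f) {x : EuclideanSpace ℝ (Fin d)}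
    (he : x ∈ closedEdge e) (hf : x ∈ closedEdge f) : ∃ i, Γ.vert i = x := by
  rcases mem_openEdge_or_vert e he with h | h
  · exact absurd (edge_unique h hf) hne.symm
  · exact h

theorem eventually_carrier {x : EuclideanSpace ℝ (Fin d)} {P : EuclideanSpace ℝ (Fin d) → Prop}
    (h : ∀ e : Γ.Edge, x ∈ closedEdge e → ∀ᶠ y in 𝓝[closedEdge e] x, P y) :
    ∀ᶠ y in 𝓝[Γ.carrier] x, P y := by
  rw [carrier, nhdsWithin_iUnion, eventually_iSup]
  intro e
  by_cases hx : x ∈ closedEdge e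
  · exact h e hx
  · have : (closedEdge e)ᶜ ∈ 𝓝 x := (isCompact_closedEdge e).isClosed.isOpen_compl.mem_nhds hx
    filter_upwards [self_mem_nhdsWithin, nhdsWithin_le_nhds this] with y h1 h2
    exact absurd h1 h2

theorem isLocalMaxOn_carrier {g : EuclideanSpace ℝ (Fin d) → ℝ} {x : EuclideanSpace ℝ (Fin d)}
    (h : ∀ e : Γ.Edge, x ∈ closedEdge e →
      ∀ᶠ s in 𝓝[Icc 0 (length e)] (coord e x), g (param e s) ≤ g x) :
    IsLocalMaxOn g Γ.carrier x := by
  refine eventually_carrier fun e he => ?_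
  have ht : Tendsto (coord e) (𝓝[closedEdge e] x) (𝓝[Icc 0 (length e)] (coord e x)) :=
    tendsto_nhdsWithin_iff.2 ⟨(continuous_coord e).continuousWithinAt,
      eventually_nhdsWithin_of_forall fun y hy => coord_mem e hy⟩
  filter_upwards [ht.eventually (h e he), self_mem_nhdsWithin] with y hy hye
  rwa [param_coord e hye] at hy

/-! ### Test functions -/

/-- Functions on the edges vanishing at the vertices glue to a function on the network. -/
theorem exists_glue (f : Γ.Edge → ℝ → ℝ) (hf : ∀ e, ContDiff ℝ 2 (f e))
    (h0 : ∀ e, f e 0 = 0) (h1 : ∀ e, f e (length e) = 0) :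
    ∃ φ : EuclideanSpace ℝ (Fin d) → ℝ, Γ.IsC2 φ ∧
      ∀ e, ∀ t ∈ Icc 0 (length e), φ (param e t) = f e t := by
  classical
  let φ : EuclideanSpace ℝ (Fin d) → ℝ := fun x =>
    if h : ∃ e : Γ.Edge, x ∈ closedEdge e then f h.choose (coord h.choose x) else 0
  have hφ : ∀ e, ∀ x ∈ closedEdge e, φ x = f e (coord e x) := by
    intro e x hx
    have h : ∃ e : Γ.Edge, x ∈ closedEdge e := ⟨e, hx⟩
    have hφx : φ x = f h.choose (coord h.choose x) := dif_pos h
    rw [hφx]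
    by_cases hne : h.choose = e
    · rw [hne]
    · obtain ⟨i, rfl⟩ := vert_of_mem_two hne h.choose_spec hx
      have hv : ∀ g : Γ.Edge, Γ.vert i ∈ closedEdge g → f g (coord g (Γ.vert i)) = 0 := by
        intro g hg
        rcases coord_vert g hg with hc | hc <;> rw [hc]
        · exact h0 g
        · exact h1 g
      rw [hv _ hx, hv _ h.choose_spec]
  have hφ' : ∀ e, ∀ t ∈ Icc 0 (length e), φ (param e t) = f e t := fun e t ht => by
    rw [hφ e _ (param_mem_closedEdge e ht), coord_param e ht.1]
  refine ⟨φ, ⟨?_, fun e => ?_⟩, hφ'⟩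
  · refine (locallyFinite_of_finite _).continuousOn_iUnion
      (fun e => (isCompact_closedEdge e).isClosed) fun e => ?_
    exact ((hf e).continuous.comp (continuous_coord e)).continuousOn.congr (hφ e)
  · exact (hf e).contDiffOn.congr (hφ' e)

/-- A cut-off makes the parabola vanish at the end points other than `t`; at `t` it vanishes by
itself. Hence such functions glue continuously at the vertices, with independent derivatives on the
different edges. -/
theorem exists_bump_parabola {ℓ t : ℝ} (hℓ : 0 < ℓ) (ht : t ∈ Icc 0 ℓ) (p X : ℝ) :
    ∃ f : ℝ → ℝ, ContDiff ℝ 2 f ∧ f 0 = 0 ∧ f ℓ = 0 ∧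
      ∀ᶠ s in 𝓝 t, f s = p * (s - t) + X / 2 * (s - t) ^ 2 := by
  obtain ⟨ρ, hρ, hρ0, hρℓ⟩ : ∃ ρ > 0, (t = 0 ∨ ρ ≤ t) ∧ (t = ℓ ∨ ρ ≤ ℓ - t) := by
    rcases ht.1.eq_or_lt with h | h
    · exact ⟨ℓ, hℓ, Or.inl h.symm, Or.inr (by linarith)⟩
    · rcases ht.2.eq_or_lt with h' | h'
      · exact ⟨ℓ, hℓ, Or.inr h'.ge, Or.inl h'⟩
      · exact ⟨min t (ℓ - t), lt_min h (by linarith), Or.inr (min_le_left _ _),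
          Or.inr (min_le_right _ _)⟩
  let b : ContDiffBump t := ⟨ρ / 2, ρ, by positivity, by linarith⟩
  refine ⟨fun s => b s * (p * (s - t) + X / 2 * (s - t) ^ 2), ?_, ?_, ?_, ?_⟩
  · exact b.contDiff.mul (by fun_prop)
  · rcases hρ0 with h | h
    · simp [h]
    · have : b 0 = 0 := b.zero_of_le_dist (by
        rw [Real.dist_eq, zero_sub, abs_neg, abs_of_nonneg ht.1]
        exact h)
      simp [this]
  · rcases hρℓ with h | h
    · simp [h]
    · have : b ℓ = 0 := b.zero_of_le_dist (by
        rw [Real.dist_eq, abs_of_nonneg (by linarith [ht.2])]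
        exact h)
      simp [this]
  · filter_upwards [b.eventuallyEq_one] with s hs
    rw [hs, Pi.one_apply, one_mul]

theorem deriv_of_eventually_parabola {f : ℝ → ℝ} {t p X : ℝ}
    (h : ∀ᶠ s in 𝓝 t, f s = p * (s - t) + X / 2 * (s - t) ^ 2) :
    deriv f t = p ∧ deriv (deriv f) t = X := by
  have hd : ∀ s, HasDerivAt (fun s => p * (s - t) + X / 2 * (s - t) ^ 2) (p + X * (s - t)) s := by
    intro s
    have h1 : HasDerivAt (fun x : ℝ => x - t) 1 s := (hasDerivAt_id s).sub_const t
    refine ((h1.const_mul p).add ((h1.pow 2).const_mul (X / 2))).congr_deriv ?_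
    push_cast
    ring
  have h1 : deriv f =ᶠ[𝓝 t] fun s => p + X * (s - t) := by
    have h2 : f =ᶠ[𝓝 t] fun s => p * (s - t) + X / 2 * (s - t) ^ 2 := h
    exact h2.deriv.trans (Eventually.of_forall fun s => (hd s).deriv)
  refine ⟨by simpa using h1.self_of_nhds, ?_⟩
  rw [h1.deriv_eq]
  simp

/-- Test functions with prescribed derivatives at a point, on all the edges through it. -/
theorem exists_testFunction (x : EuclideanSpace ℝ (Fin d)) (p X : Γ.Edge → ℝ) :
    ∃ φ, Γ.IsC2 φ ∧ ∀ e : Γ.Edge, x ∈ closedEdge e → φ x = 0 ∧ dEdge e φ x = p e ∧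
      ddEdge e φ x = X e ∧ ∀ᶠ s in 𝓝[Icc 0 (length e)] (coord e x),
        φ (param e s) = p e * (s - coord e x) + X e / 2 * (s - coord e x) ^ 2 := by
  classical
  have hex : ∀ e : Γ.Edge, ∃ f : ℝ → ℝ, ContDiff ℝ 2 f ∧ f 0 = 0 ∧ f (length e) = 0 ∧
      (x ∈ closedEdge e → ∀ᶠ s in 𝓝 (coord e x),
        f s = p e * (s - coord e x) + X e / 2 * (s - coord e x) ^ 2) := by
    intro e
    by_cases hx : x ∈ closedEdge e
    · obtain ⟨f, h1, h2, h3, h4⟩ := exists_bump_parabola (length_pos e) (coord_mem e hx) (p e) (X e)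
      exact ⟨f, h1, h2, h3, fun _ => h4⟩
    · exact ⟨fun _ => 0, contDiff_const, rfl, rfl, fun h => absurd h hx⟩
  choose f hf h0 h1 hpar using hex
  obtain ⟨φ, hφ, hφf⟩ := exists_glue f hf h0 h1
  refine ⟨φ, hφ, fun e hx => ?_⟩
  have ht := coord_mem e hx
  have hpar' := hpar e hx
  have hU : UniqueDiffOn ℝ (Icc 0 (length e)) := uniqueDiffOn_Icc (length_pos e)
  have hEq : EqOn (onEdge e φ) (f e) (Icc 0 (length e)) := fun s hs => hφf e s hs
  have hdf : Differentiable ℝ (f e) := (hf e).differentiable two_ne_zero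
  have hddf : Differentiable ℝ (deriv (f e)) := by
    have : ContDiff ℝ 1 (deriv (f e)) := ((contDiff_succ_iff_deriv (n := 1)).1 (hf e)).2.2
    exact this.differentiable one_ne_zero
  have hd1 : EqOn (derivWithin (onEdge e φ) (Icc 0 (length e))) (deriv (f e))
      (Icc 0 (length e)) := fun s hs => by
    rw [derivWithin_congr hEq (hEq hs), (hdf s).derivWithin (hU s hs)]
  obtain ⟨hD, hDD⟩ := deriv_of_eventually_parabola hpar'
  refine ⟨?_, ?_, ?_, ?_⟩
  · have h2 := hφf e _ ht
    rw [param_coord e hx] at h2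
    rw [h2, hpar'.self_of_nhds]
    simp
  · rw [dEdge, hd1 ht, hD]
  · rw [ddEdge, derivWithin_congr hd1 (hd1 ht), (hddf _).derivWithin (hU _ ht), hDD]
  · filter_upwards [nhdsWithin_le_nhds hpar', self_mem_nhdsWithin] with s hs hsI
    rw [hφf e s hsI, hs]

end EmbeddedNetwork

/-- At an end point where `u + w` has a positive maximum which is not attained in the interior,
`u + w` decays linearly. -/
theorem exists_linear_decay {lam L C B : ℝ} {a : ℝ → ℝ} {H : ℝ → ℝ → ℝ} {u w : ℝ → ℝ} {M : ℝ}
    (hlam : 0 < lam) (hL : 0 < L) (hR : RegularCoeff L C a H) (hsu : IsParabolicSub lam L a H u)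
    (hsw : IsParabolicSub lam L a (dualHam H) w) (hu : UpperSemicontinuousOn u (Ioo 0 L))
    (hw : UpperSemicontinuousOn w (Ioo 0 L)) (huB : ∀ x ∈ Ioo 0 L, |u x| ≤ B)
    (hwB : ∀ x ∈ Ioo 0 L, |w x| ≤ B) (hM : 0 < M) (hlt : ∀ t ∈ Ioo 0 L, u t + w t < M)
    (hlim : ∀ ε > 0, ∀ᶠ t in 𝓝[>] 0, u t + w t < M + ε) :
    ∃ κ > 0, ∀ᶠ t in 𝓝[>] 0, u t + w t ≤ M - κ * t := by
  have hC := hR.nonneg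
  have hz := hlt (L / 2) ⟨by linarith, by linarith⟩
  obtain ⟨g, hg⟩ : ∃ g, g = min (M - (u (L / 2) + w (L / 2))) M := ⟨_, rfl⟩
  have hg0 : 0 < g := by rw [hg]; exact lt_min (by linarith) hM
  have hg1 : g ≤ M - (u (L / 2) + w (L / 2)) := by rw [hg]; exact min_le_left _ _
  have hg2 : g ≤ M := by rw [hg]; exact min_le_right _ _
  -- The first condition keeps `u + w + κ t` below `M` at `L / 2` and leaves `u + w ≥ M / 2` at its
  -- interior maximum; the second contradicts `interior_comparison` there.
  obtain ⟨κ, hκ, hκ1, hκ2⟩ : ∃ κ > 0, κ * L ≤ g ∧ C * κ < lam * (M / 2) := by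
    refine ⟨min (g / L) (lam * M / (2 * (C + 1))), by positivity, ?_, ?_⟩
    · rw [← le_div_iff₀ hL]
      exact min_le_left _ _
    · have h1 : C * min (g / L) (lam * M / (2 * (C + 1))) ≤ C * (lam * M / (2 * (C + 1))) :=
        mul_le_mul_of_nonneg_left (min_le_right _ _) hC
      refine h1.trans_lt ?_
      have : 0 < lam * M := by positivity
      rw [mul_div_assoc', div_lt_iff₀ (by positivity)]
      linarith
  refine ⟨κ, hκ, ?_⟩
  filter_upwards [Ioo_mem_nhdsGT (by linarith : 0 < L / 2)] with y hy
  by_contra! hlty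
  obtain ⟨ε, hε⟩ : ∃ ε, ε = (u y + w y + κ * y - M) / 2 := ⟨_, rfl⟩
  have hε0 : 0 < ε := by rw [hε]; linarith
  obtain ⟨δ, hδ, hδl⟩ := exists_of_eventually_pos (hlim ε hε0)
  obtain ⟨x, hx0, hxδ, hxy, hxε⟩ : ∃ x > 0, x < δ ∧ x < y ∧ κ * x ≤ ε := by
    have := hy.1
    refine ⟨min (min (δ / 2) (y / 2)) (ε / κ), by positivity, ?_, ?_, ?_⟩
    · exact ((min_le_left _ _).trans (min_le_left _ _)).trans_lt (by linarith)
    · exact ((min_le_left _ _).trans (min_le_right _ _)).trans_lt (by linarith)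
    · rw [← le_div_iff₀' hκ]
      exact min_le_right _ _
  have h1 := hδl x ⟨hx0, hxδ⟩
  have hsub : Icc x (L / 2) ⊆ Ioo 0 L := fun s hs => ⟨hx0.trans_le hs.1, by linarith [hs.2]⟩
  have husc : UpperSemicontinuousOn (fun s => u s + w s + κ * s) (Icc x (L / 2)) :=
    ((hu.mono hsub).add (hw.mono hsub)).add
      (by fun_prop : ContinuousOn (fun s => κ * s) (Icc x (L / 2))).upperSemicontinuousOn
  obtain ⟨m, hm, hmax⟩ := husc.exists_isMaxOn (nonempty_Icc.2 (hxy.trans hy.2).le) isCompact_Icc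
  rw [isMaxOn_iff] at hmax
  have hmy := hmax y ⟨hxy.le, hy.2.le⟩
  have hmx : x ≠ m := by
    rintro rfl
    linarith
  have hmz : m ≠ L / 2 := by
    rintro rfl
    linarith
  have hloc : IsLocalMax (fun s => u s + w s + κ * s) m := by
    filter_upwards [Icc_mem_nhds (lt_of_le_of_ne hm.1 hmx) (lt_of_le_of_ne hm.2 hmz)] with s hs
    exact hmax s hs
  have h2 := interior_comparison hlam hR hsu hsw hu hw huB hwB (hsub hm) hloc
  rw [abs_of_pos hκ] at h2
  have h3 : κ * m ≤ κ * (L / 2) := mul_le_mul_of_nonneg_left hm.2 hκ.le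
  have h4 : M / 2 ≤ u m + w m := by linarith
  have h5 := mul_le_mul_of_nonneg_left h4 hlam.le
  linarith

namespace EmbeddedNetwork

variable {d : ℕ} {Γ : EmbeddedNetwork d}

/-! ### Half edges -/

/-- The orientation of an edge seen from one of its end points. -/
def orient (i : Γ.Vertex) (e : Γ.Inc i) : ℝ := if e.1.1.1 = i then 1 else -1

/-- The edge `e` parametrized by arc length from its end point `i`. -/
noncomputable def ray (i : Γ.Vertex) (e : Γ.Inc i) (t : ℝ) : EuclideanSpace ℝ (Fin d) :=
  param e.1 (coord e.1 (Γ.vert i) + orient i e * t)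

/-- The Hamiltonian in the coordinate of `ray`. -/
noncomputable def rayHam (i : Γ.Vertex) (e : Γ.Inc i) (H : Γ.Edge → EuclideanSpace ℝ (Fin d) → ℝ → ℝ)
    (t p : ℝ) : ℝ := H e.1 (ray i e t) (orient i e * p)

theorem orient_cases (i : Γ.Vertex) (e : Γ.Inc i) :
    (coord e.1 (Γ.vert i) = 0 ∧ orient i e = 1) ∨
      (coord e.1 (Γ.vert i) = length e.1 ∧ orient i e = -1) := by
  by_cases h : e.1.1.1 = i
  · left
    refine ⟨?_, if_pos h⟩
    have h3 := coord_source e.1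
    rwa [h] at h3
  · right
    refine ⟨?_, if_neg h⟩
    have h2 : e.1.1.2 = i := ((vert_mem_closedEdge_iff e.1 i).1 e.2).resolve_left h
    have h3 := coord_target e.1
    rwa [h2] at h3

theorem orient_mul_self (i : Γ.Vertex) (e : Γ.Inc i) : orient i e * orient i e = 1 := by
  rcases orient_cases i e with h | h <;> rw [h.2] <;> norm_num

theorem abs_orient (i : Γ.Vertex) (e : Γ.Inc i) : |orient i e| = 1 := by
  rcases orient_cases i e with h | h <;> rw [h.2] <;> norm_num

theorem ray_coord_mem_Icc (i : Γ.Vertex) (e : Γ.Inc i) {t : ℝ} (ht : t ∈ Icc 0 (length e.1)) :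
    coord e.1 (Γ.vert i) + orient i e * t ∈ Icc 0 (length e.1) := by
  rcases orient_cases i e with h | h <;> rw [h.1, h.2] <;> constructor <;> linarith [ht.1, ht.2]

theorem ray_coord_mem_Ioo (i : Γ.Vertex) (e : Γ.Inc i) {t : ℝ} (ht : t ∈ Ioo 0 (length e.1)) :
    coord e.1 (Γ.vert i) + orient i e * t ∈ Ioo 0 (length e.1) := by
  rcases orient_cases i e with h | h <;> rw [h.1, h.2] <;> constructor <;> linarith [ht.1, ht.2]

theorem ray_mem_closedEdge (i : Γ.Vertex) (e : Γ.Inc i) {t : ℝ} (ht : t ∈ Icc 0 (length e.1)) :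
    ray i e t ∈ closedEdge e.1 := param_mem_closedEdge _ (ray_coord_mem_Icc i e ht)

theorem ray_mem_openEdge (i : Γ.Vertex) (e : Γ.Inc i) {t : ℝ} (ht : t ∈ Ioo 0 (length e.1)) :
    ray i e t ∈ openEdge e.1 := param_mem_openEdge _ (ray_coord_mem_Ioo i e ht)

theorem ray_mem_carrier (i : Γ.Vertex) (e : Γ.Inc i) {t : ℝ} (ht : t ∈ Ioo 0 (length e.1)) :
    ray i e t ∈ Γ.carrier := closedEdge_subset _ (openEdge_subset _ (ray_mem_openEdge i e ht))

@[simp] theorem ray_zero (i : Γ.Vertex) (e : Γ.Inc i) : ray i e 0 = Γ.vert i := by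
  rw [ray, mul_zero, add_zero, param_coord _ e.2]

theorem dist_ray (i : Γ.Vertex) (e : Γ.Inc i) (s t : ℝ) :
    dist (ray i e s) (ray i e t) = |s - t| := by
  rw [ray, ray, dist_param, add_sub_add_left_eq_sub, ← mul_sub, abs_mul, abs_orient, one_mul]

theorem continuous_ray (i : Γ.Vertex) (e : Γ.Inc i) : Continuous (ray i e) := by
  unfold ray
  exact (continuous_param _).comp (by fun_prop)

theorem exists_ray_eq (i : Γ.Vertex) (e : Γ.Inc i) {x : EuclideanSpace ℝ (Fin d)}
    (hx : x ∈ closedEdge e.1) :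
    dist x (Γ.vert i) ∈ Icc 0 (length e.1) ∧ ray i e (dist x (Γ.vert i)) = x := by
  have hs := coord_mem e.1 hx
  obtain ⟨t, ht, hts⟩ : ∃ t ∈ Icc 0 (length e.1),
      coord e.1 (Γ.vert i) + orient i e * t = coord e.1 x := by
    rcases orient_cases i e with h | h <;> rw [h.1, h.2]
    · exact ⟨coord e.1 x, hs, by ring⟩
    · exact ⟨length e.1 - coord e.1 x, ⟨by linarith [hs.2], by linarith [hs.1]⟩, by ring⟩
  have hray : ray i e t = x := by rw [ray, hts, param_coord _ hx]
  have hd : dist x (Γ.vert i) = t := by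
    rw [← hray, ← ray_zero i e, dist_ray, sub_zero, abs_of_nonneg ht.1]
  rw [hd]
  exact ⟨ht, hray⟩

theorem tendsto_ray (i : Γ.Vertex) (e : Γ.Inc i) :
    Tendsto (ray i e) (𝓝[>] 0) (𝓝[openEdge e.1] (Γ.vert i)) := by
  refine tendsto_nhdsWithin_iff.2 ⟨?_, ?_⟩
  · have := (continuous_ray i e).tendsto 0
    rw [ray_zero] at this
    exact this.mono_left nhdsWithin_le_nhds
  · filter_upwards [Ioo_mem_nhdsGT (length_pos e.1)] with t ht
    exact ray_mem_openEdge i e ht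

theorem tendsto_ray_closed (i : Γ.Vertex) (e : Γ.Inc i) :
    Tendsto (ray i e) (𝓝[≥] 0) (𝓝[closedEdge e.1] (Γ.vert i)) := by
  refine tendsto_nhdsWithin_iff.2 ⟨?_, ?_⟩
  · have := (continuous_ray i e).tendsto 0
    rw [ray_zero] at this
    exact this.mono_left nhdsWithin_le_nhds
  · filter_upwards [Icc_mem_nhdsGE (length_pos e.1)] with t ht
    exact ray_mem_closedEdge i e ht

theorem regularCoeff_ray {a : Γ.Edge → EuclideanSpace ℝ (Fin d) → ℝ}
    {H : Γ.Edge → EuclideanSpace ℝ (Fin d) → ℝ → ℝ} (i : Γ.Vertex) (e : Γ.Inc i)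
    (hH : HamiltonianRegular e.1 (H e.1)) (ha : DiffusionRegular e.1 (a e.1)) :
    ∃ C, RegularCoeff (length e.1) C (fun t => a e.1 (ray i e t)) (rayHam i e H) := by
  obtain ⟨C₁, h1, h2⟩ := hH
  obtain ⟨σ, C₂, h3, h4⟩ := ha
  have hC₁ : C₁ ≤ max (max C₁ C₂) 0 := (le_max_left _ _).trans (le_max_left _ _)
  have hC₂ : C₂ ≤ max (max C₁ C₂) 0 := (le_max_right _ _).trans (le_max_left _ _)
  have hm : ∀ {t}, t ∈ Icc 0 (length e.1) → ray i e t ∈ closedEdge e.1 :=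
    fun ht => ray_mem_closedEdge i e ht
  refine ⟨max (max C₁ C₂) 0, le_max_right _ _, fun x hx y hy p => ?_, fun x hx p q => ?_,
    fun t => σ (ray i e t), fun x hx => h3 _ (hm hx), fun x hx y hy => ?_⟩
  · refine (h1 _ (hm hx) _ (hm hy) _).trans ?_
    rw [← dist_eq_norm, dist_ray, abs_mul, abs_orient, one_mul]
    exact mul_le_mul_of_nonneg_right (mul_le_mul_of_nonneg_right hC₁ (by positivity))
      (abs_nonneg _)
  · refine (h2 _ (hm hx) _ _).trans ?_
    rw [← mul_sub, abs_mul, abs_orient, one_mul]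
    exact mul_le_mul_of_nonneg_right hC₁ (abs_nonneg _)
  · refine (h4 _ (hm hx) _ (hm hy)).trans ?_
    rw [← dist_eq_norm, dist_ray]
    exact mul_le_mul_of_nonneg_right hC₂ (abs_nonneg _)

theorem coerciveAtZero_ray {H : Γ.Edge → EuclideanSpace ℝ (Fin d) → ℝ → ℝ} (i : Γ.Vertex)
    (e : Γ.Inc i) (h : CoerciveNear e.1 (H e.1) (Γ.vert i)) : CoerciveAtZero (rayHam i e H) := by
  obtain ⟨K, hK, hev⟩ := h
  refine ⟨K, hK, ?_⟩
  filter_upwards [(tendsto_ray_closed i e).eventually hev] with t ht p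
  have := ht (orient i e * p)
  rwa [abs_mul, abs_orient, one_mul] at this

/-! ### Duality and viscosity inequalities along half edges -/

section Viscosity

variable {lam : ℝ} {a : Γ.Edge → EuclideanSpace ℝ (Fin d) → ℝ}
  {H : Γ.Edge → EuclideanSpace ℝ (Fin d) → ℝ → ℝ}
  {F : ∀ i : Γ.Vertex, ℝ × (Γ.Inc i → ℝ) → ℝ} {h : Γ.Vertex → ℝ}
  {u v : EuclideanSpace ℝ (Fin d) → ℝ}

theorem dEdge_neg (e : Γ.Edge) (φ : EuclideanSpace ℝ (Fin d) → ℝ) (x : EuclideanSpace ℝ (Fin d)) :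
    dEdge e (fun y => -φ y) x = -dEdge e φ x := by
  have : onEdge e (fun y => -φ y) = -onEdge e φ := rfl
  rw [dEdge, dEdge, this, derivWithin.neg]

theorem ddEdge_neg (e : Γ.Edge) (φ : EuclideanSpace ℝ (Fin d) → ℝ)
    (x : EuclideanSpace ℝ (Fin d)) : ddEdge e (fun y => -φ y) x = -ddEdge e φ x := by
  have h1 : onEdge e (fun y => -φ y) = -onEdge e φ := rfl
  have h2 : derivWithin (-onEdge e φ) (Icc 0 (length e)) =
      -derivWithin (onEdge e φ) (Icc 0 (length e)) := by
    ext s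
    rw [derivWithin.neg, Pi.neg_apply]
  rw [ddEdge, ddEdge, h1, h2, derivWithin.neg]

theorem inwardDeriv_neg (i : Γ.Vertex) (φ : EuclideanSpace ℝ (Fin d) → ℝ) :
    Γ.inwardDeriv i (fun y => -φ y) = -Γ.inwardDeriv i φ := by
  ext e
  simp only [inwardDeriv, dEdge_neg, Pi.neg_apply]
  split_ifs <;> rfl

theorem IsC2.neg {φ : EuclideanSpace ℝ (Fin d) → ℝ} (hφ : Γ.IsC2 φ) :
    Γ.IsC2 (fun y => -φ y) := ⟨hφ.1.neg, fun e => (hφ.2 e).neg⟩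

/-- The opposite of a supersolution is a subsolution of the dual problem. -/
theorem IsViscositySupersolution.neg (hv : Γ.IsViscositySupersolution lam a H F h v) :
    Γ.IsViscositySubsolution lam a (fun e x p => -H e x (-p))
      (fun i q => -F i (-q.1, -q.2)) (fun i => -h i) (fun x => -v x) where
  usc := by
    intro x hx y hy
    have hlt : -y < v x := by linarith
    filter_upwards [hv.lsc x hx _ hlt] with z hz
    linarith
  edge φ hφ e x hx hmax := by
    have hmin : IsLocalMinOn (fun y => v y - -φ y) Γ.carrier x := by
      filter_upwards [hmax] with y hy
      linarith
    have := hv.edge _ hφ.neg e x hx hmin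
    rw [dEdge_neg, ddEdge_neg] at this
    simp only [edgeOp] at *
    linarith
  interior φ hφ i hi hmax := by
    have hmin : IsLocalMinOn (fun y => v y - -φ y) Γ.carrier (Γ.vert i) := by
      filter_upwards [hmax] with y hy
      linarith
    rcases hv.interior _ hφ.neg i hi hmin with ⟨e, he⟩ | h
    · left
      refine ⟨e, ?_⟩
      rw [dEdge_neg, ddEdge_neg] at he
      simp only [edgeOp] at *
      linarith
    · right
      rw [inwardDeriv_neg] at h
      simp only [neg_neg]
      linarith
  boundary φ hφ i hi hmax := by
    have hmin : IsLocalMinOn (fun y => v y - -φ y) Γ.carrier (Γ.vert i) := by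
      filter_upwards [hmax] with y hy
      linarith
    rcases hv.boundary _ hφ.neg i hi hmin with ⟨e, he⟩ | h
    · left
      refine ⟨e, ?_⟩
      rw [dEdge_neg, ddEdge_neg] at he
      simp only [edgeOp] at *
      linarith
    · right
      linarith

theorem rayHam_dual (i : Γ.Vertex) (e : Γ.Inc i) :
    rayHam i e (fun e x p => -H e x (-p)) = dualHam (rayHam i e H) := by
  ext t p
  simp only [rayHam, dualHam, mul_neg]

theorem IsViscositySubsolution.isParabolicSub (hu : Γ.IsViscositySubsolution lam a H F h u)
    (i : Γ.Vertex) (e : Γ.Inc i) :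
    IsParabolicSub lam (length e.1) (fun t => a e.1 (ray i e t)) (rayHam i e H)
      (fun t => u (ray i e t)) := by
  intro t ht p X hjet
  obtain ⟨φ, hφ, hφe⟩ := exists_testFunction (Γ := Γ) (ray i e t) (fun _ => orient i e * p)
    (fun _ => X)
  have hopen := ray_mem_openEdge i e ht
  have hIoo := ray_coord_mem_Ioo i e ht
  have hcoord : coord e.1 (ray i e t) = coord e.1 (Γ.vert i) + orient i e * t :=
    coord_param _ hIoo.1.le
  obtain ⟨h0, h1, h2, h3⟩ := hφe e.1 (openEdge_subset _ hopen)
  have hmax : IsLocalMaxOn (fun y => u y - φ y) Γ.carrier (ray i e t) := by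
    refine isLocalMaxOn_carrier fun f hf => ?_
    obtain rfl := edge_unique hopen hf
    have hoo := orient_mul_self i e
    have hlim : Tendsto (fun s => orient i e * (s - coord e.1 (Γ.vert i)))
        (𝓝[Icc 0 (length e.1)] (coord e.1 (ray i e t))) (𝓝 t) := by
      have hc : Continuous fun s => orient i e * (s - coord e.1 (Γ.vert i)) := by fun_prop
      have := hc.tendsto (coord e.1 (ray i e t))
      rw [hcoord, add_sub_cancel_left, ← mul_assoc, hoo, one_mul] at this
      rw [hcoord]
      exact this.mono_left nhdsWithin_le_nhds
    filter_upwards [h3, hlim.eventually hjet] with s hs1 hs2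
    have hray : ray i e (orient i e * (s - coord e.1 (Γ.vert i))) = param e.1 s := by
      rw [ray, ← mul_assoc, hoo, one_mul, add_sub_cancel]
    rw [hray] at hs2
    rw [hs1, h0]
    have e1 : orient i e * (s - coord e.1 (Γ.vert i)) - t =
        orient i e * (s - coord e.1 (ray i e t)) := by
      rw [hcoord]
      linear_combination t * hoo
    rw [e1] at hs2
    have e2 : (orient i e * (s - coord e.1 (ray i e t))) ^ 2 =
        (s - coord e.1 (ray i e t)) ^ 2 := by
      rw [mul_pow, sq (orient i e), hoo, one_mul]
    rw [e2] at hs2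
    linarith
  have := hu.edge φ hφ e.1 _ hopen hmax
  rw [h1, h2] at this
  exact this

/-- The admissible slopes and their second derivatives glue to one test function at the vertex. By
definition of `Admits` every edge alternative fails for it, so only the vertex alternative remains.
-/
theorem IsViscositySubsolution.of_admits (hu : Γ.IsViscositySubsolution lam a H F h u)
    (i : Γ.Vertex) (r : Γ.Inc i → ℝ)
    (hr : ∀ e : Γ.Inc i, Admits lam (fun t => a e.1 (ray i e t)) (rayHam i e H)
      (fun t => u (ray i e t)) (u (Γ.vert i)) (r e)) :
    (Γ.IsInteriorVertex i → F i (u (Γ.vert i), r) ≤ 0) ∧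
      (Γ.IsBoundaryVertex i → u (Γ.vert i) - h i ≤ 0) := by
  classical
  choose X hX hX' using hr
  obtain ⟨φ, hφ, hφe⟩ := exists_testFunction (Γ := Γ) (Γ.vert i)
    (fun f => if hf : Γ.vert i ∈ closedEdge f then orient i ⟨f, hf⟩ * r ⟨f, hf⟩ else 0)
    (fun f => if hf : Γ.vert i ∈ closedEdge f then X ⟨f, hf⟩ else 0)
  have key : ∀ e : Γ.Inc i, φ (Γ.vert i) = 0 ∧ dEdge e.1 φ (Γ.vert i) = orient i e * r e ∧
      ddEdge e.1 φ (Γ.vert i) = X e ∧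
      ∀ᶠ s in 𝓝[Icc 0 (length e.1)] (coord e.1 (Γ.vert i)),
        φ (param e.1 s) = orient i e * r e * (s - coord e.1 (Γ.vert i)) +
          X e / 2 * (s - coord e.1 (Γ.vert i)) ^ 2 := fun e => by
    have := hφe e.1 e.2
    rwa [dif_pos e.2, dif_pos e.2] at this
  have hmax : IsLocalMaxOn (fun y => u y - φ y) Γ.carrier (Γ.vert i) := by
    refine isLocalMaxOn_carrier fun f hf => ?_
    obtain ⟨e, rfl⟩ : ∃ e : Γ.Inc i, e.1 = f := ⟨⟨f, hf⟩, rfl⟩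
    obtain ⟨h0, -, -, h3⟩ := key e
    have hoo := orient_mul_self i e
    have hlim : Tendsto (fun s => orient i e * (s - coord e.1 (Γ.vert i)))
        (𝓝[Icc 0 (length e.1)] (coord e.1 (Γ.vert i))) (𝓝[≥] 0) := by
      refine tendsto_nhdsWithin_iff.2 ⟨?_, eventually_nhdsWithin_of_forall fun s hs => ?_⟩
      · have hc : Continuous fun s => orient i e * (s - coord e.1 (Γ.vert i)) := by fun_prop
        have := hc.tendsto (coord e.1 (Γ.vert i))
        rw [sub_self, mul_zero] at this
        exact this.mono_left nhdsWithin_le_nhds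
      · rw [mem_Ici]
        rcases orient_cases i e with h | h <;> rw [h.1, h.2] <;> linarith [hs.1, hs.2]
    have hjet : ∀ᶠ t in 𝓝[≥] 0,
        u (ray i e t) ≤ u (Γ.vert i) + r e * t + X e / 2 * t ^ 2 := by
      rw [← Ioi_insert, nhdsWithin_insert, eventually_sup]
      exact ⟨by simp, hX' e⟩
    filter_upwards [h3, hlim.eventually hjet] with s hs1 hs2
    have hray : ray i e (orient i e * (s - coord e.1 (Γ.vert i))) = param e.1 s := by
      rw [ray, ← mul_assoc, hoo, one_mul, add_sub_cancel]
    rw [hray] at hs2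
    rw [hs1, h0]
    have e2 : (orient i e * (s - coord e.1 (Γ.vert i))) ^ 2 = (s - coord e.1 (Γ.vert i)) ^ 2 := by
      rw [mul_pow, sq (orient i e), hoo, one_mul]
    rw [e2] at hs2
    linarith
  have hno : ¬ ∃ e : Γ.Inc i, Γ.edgeOp lam a H e.1 (u (Γ.vert i)) (dEdge e.1 φ (Γ.vert i))
      (ddEdge e.1 φ (Γ.vert i)) (Γ.vert i) ≤ 0 := by
    rintro ⟨e, he⟩
    obtain ⟨-, h1, h2, -⟩ := key e
    have := hX e
    simp only [rayHam, ray_zero] at this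
    rw [h1, h2, edgeOp] at he
    linarith
  have hinw : Γ.inwardDeriv i φ = r := by
    ext e
    obtain ⟨-, h1, -, -⟩ := key e
    rw [inwardDeriv, h1, orient]
    split_ifs <;> ring
  refine ⟨fun hi => ?_, fun hi => ?_⟩
  · have := (hu.interior φ hφ i hi hmax).resolve_left hno
    rwa [hinw] at this
  · exact (hu.boundary φ hφ i hi hmax).resolve_left hno

theorem IsViscositySubsolution.usc_ray (hu : Γ.IsViscositySubsolution lam a H F h u)
    (i : Γ.Vertex) (e : Γ.Inc i) :
    UpperSemicontinuousOn (fun t => u (ray i e t)) (Ioo 0 (length e.1)) :=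
  hu.usc.comp (continuous_ray i e).continuousOn fun _ ht => ray_mem_carrier i e ht

theorem vert_mem_carrier (i : Γ.Vertex) (e : Γ.Inc i) : Γ.vert i ∈ Γ.carrier :=
  closedEdge_subset _ e.2

theorem IsViscositySubsolution.limsup_ray (hu : Γ.IsViscositySubsolution lam a H F h u)
    (i : Γ.Vertex) (e : Γ.Inc i) :
    ∀ ε > 0, ∀ᶠ t in 𝓝[>] 0, u (ray i e t) < u (Γ.vert i) + ε := fun ε hε =>
  ((tendsto_ray i e).mono_right
    (nhdsWithin_mono _ ((openEdge_subset _).trans (closedEdge_subset _)))).eventually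
    (hu.usc _ (vert_mem_carrier i e) _ (by linarith))

end Viscosity

end EmbeddedNetwork

namespace EmbeddedNetwork

variable {d : ℕ} {Γ : EmbeddedNetwork d}

/-! ### The upper semicontinuous extension at the boundary vertices -/

theorem uscExtension_of_notMem {u : EuclideanSpace ℝ (Fin d) → ℝ} {x : EuclideanSpace ℝ (Fin d)}
    (hx : x ∉ Γ.boundaryVertices) : Γ.uscExtension u x = u x := if_neg hx

theorem uscExtension_openEdge {u : EuclideanSpace ℝ (Fin d) → ℝ} (e : Γ.Edge)
    {x : EuclideanSpace ℝ (Fin d)} (hx : x ∈ openEdge e) : Γ.uscExtension u x = u x := by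
  refine uscExtension_of_notMem ?_
  rintro ⟨i, -, rfl⟩
  exact vert_notMem_openEdge e i hx

theorem vert_mem_boundaryVertices_iff (i : Γ.Vertex) :
    Γ.vert i ∈ Γ.boundaryVertices ↔ Γ.IsBoundaryVertex i :=
  Γ.vert_injective.mem_set_image

theorem nonempty_inc (i : Γ.Vertex) : Nonempty (Γ.Inc i) := by
  obtain ⟨e, he, h⟩ := Γ.exists_incident i
  exact ⟨⟨⟨e, he⟩, h⟩⟩

theorem interior_or_boundary (i : Γ.Vertex) : Γ.IsInteriorVertex i ∨ Γ.IsBoundaryVertex i := by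
  have := nonempty_inc i
  have h : 0 < Nat.card (Γ.Inc i) := Nat.card_pos
  exact (Nat.succ_le_of_lt h).lt_or_eq.imp id Eq.symm

/-- The punctured neighbourhoods of a point in the edges through it. -/
def edgeFilter (Γ : EmbeddedNetwork d) (x : EuclideanSpace ℝ (Fin d)) :
    Filter (EuclideanSpace ℝ (Fin d)) :=
  𝓝[⋃ e : {e : Γ.Edge // x ∈ closedEdge e}, openEdge e.1] x

theorem tendsto_ray_edgeFilter (i : Γ.Vertex) (e : Γ.Inc i) :
    Tendsto (ray i e) (𝓝[>] 0) (Γ.edgeFilter (Γ.vert i)) :=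
  (tendsto_ray i e).mono_right (nhdsWithin_mono _
    (subset_iUnion (fun e : {e : Γ.Edge // Γ.vert i ∈ closedEdge e} => openEdge e.1) e))

theorem edgeFilter_neBot (i : Γ.Vertex) : (Γ.edgeFilter (Γ.vert i)).NeBot := by
  obtain ⟨e⟩ := nonempty_inc i
  exact (tendsto_ray_edgeFilter i e).neBot

theorem edgeFilter_le (x : EuclideanSpace ℝ (Fin d)) : Γ.edgeFilter x ≤ 𝓝[Γ.carrier] x :=
  nhdsWithin_mono _ (iUnion_subset fun _ => (openEdge_subset _).trans (closedEdge_subset _))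

section Extension

variable {u : EuclideanSpace ℝ (Fin d) → ℝ} {B : ℝ}

theorem isBoundedUnder_edgeFilter (hB : ∀ x ∈ Γ.carrier, |u x| ≤ B)
    (x : EuclideanSpace ℝ (Fin d)) :
    (Γ.edgeFilter x).IsBoundedUnder (· ≤ ·) u ∧ (Γ.edgeFilter x).IsBoundedUnder (· ≥ ·) u := by
  have h : ∀ᶠ y in Γ.edgeFilter x, y ∈ Γ.carrier := edgeFilter_le x self_mem_nhdsWithin
  exact ⟨⟨B, eventually_map.2 (h.mono fun y hy => (abs_le.1 (hB y hy)).2)⟩,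
    ⟨-B, eventually_map.2 (h.mono fun y hy => (abs_le.1 (hB y hy)).1)⟩⟩

theorem uscExtension_vert {i : Γ.Vertex} (hi : Γ.IsBoundaryVertex i) :
    Γ.uscExtension u (Γ.vert i) = limsup u (Γ.edgeFilter (Γ.vert i)) :=
  if_pos ((vert_mem_boundaryVertices_iff i).2 hi)

theorem uscExtension_le_self (hu : UpperSemicontinuousOn u Γ.carrier)
    (hB : ∀ x ∈ Γ.carrier, |u x| ≤ B) {x : EuclideanSpace ℝ (Fin d)} (hx : x ∈ Γ.carrier) :
    Γ.uscExtension u x ≤ u x := by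
  by_cases hb : x ∈ Γ.boundaryVertices
  · obtain ⟨i, hi, rfl⟩ := hb
    have := edgeFilter_neBot i
    rw [uscExtension_vert hi]
    refine le_of_forall_gt_imp_ge_of_dense fun c hc => ?_
    exact limsup_le_of_le (isBoundedUnder_edgeFilter hB _).2.isCoboundedUnder_le
      (((hu _ hx c hc).filter_mono (edgeFilter_le _)).mono fun y hy => le_of_lt hy)
  · rw [uscExtension_of_notMem hb]

theorem eventually_lt_of_uscExtension_lt (hB : ∀ x ∈ Γ.carrier, |u x| ≤ B) {i : Γ.Vertex}
    (hi : Γ.IsBoundaryVertex i) {c : ℝ} (hc : Γ.uscExtension u (Γ.vert i) < c) :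
    ∀ᶠ y in Γ.edgeFilter (Γ.vert i), u y < c := by
  rw [uscExtension_vert hi] at hc
  exact eventually_lt_of_limsup_lt hc (isBoundedUnder_edgeFilter hB _).1

/-- A boundary vertex has only one incident edge, so the limit superior defining the extension is
attained along that single half edge. -/
theorem frequently_ray_of_lt_uscExtension (hB : ∀ x ∈ Γ.carrier, |u x| ≤ B) {i : Γ.Vertex}
    (hi : Γ.IsBoundaryVertex i) (e : Γ.Inc i) {c : ℝ} (hc : c < Γ.uscExtension u (Γ.vert i)) :
    ∃ᶠ t in 𝓝[>] 0, c < u (ray i e t) := by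
  have := edgeFilter_neBot i
  rw [uscExtension_vert hi] at hc
  have hf := frequently_lt_of_lt_limsup (isBoundedUnder_edgeFilter hB _).2.isCoboundedUnder_le hc
  have hsub : Subsingleton (Γ.Inc i) := (Nat.card_eq_one_iff_unique.1 hi).1
  have hopen : ∀ᶠ y in Γ.edgeFilter (Γ.vert i), y ∈ openEdge e.1 := by
    have : ∀ᶠ y in Γ.edgeFilter (Γ.vert i),
        y ∈ ⋃ f : {f : Γ.Edge // Γ.vert i ∈ closedEdge f}, openEdge f.1 := self_mem_nhdsWithin
    filter_upwards [this] with y hy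
    obtain ⟨f, hf⟩ := mem_iUnion.1 hy
    rwa [Subsingleton.elim e f]
  have hlim : Tendsto (fun y => dist y (Γ.vert i)) (Γ.edgeFilter (Γ.vert i)) (𝓝[>] 0) := by
    refine tendsto_nhdsWithin_iff.2 ⟨?_, ?_⟩
    · have h1 : Continuous fun y => dist y (Γ.vert i) := by fun_prop
      have := h1.tendsto (Γ.vert i)
      rw [dist_self] at this
      exact this.mono_left nhdsWithin_le_nhds
    · filter_upwards [hopen] with y hy
      refine dist_pos.2 ?_
      rintro rfl
      exact vert_notMem_openEdge _ i hy
  refine hlim.frequently ((hf.and_eventually hopen).mono fun y hy => ?_)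
  rw [(exists_ray_eq i e (openEdge_subset _ hy.2)).2]
  exact hy.1

theorem upperSemicontinuousOn_uscExtension (hu : UpperSemicontinuousOn u Γ.carrier)
    (hB : ∀ x ∈ Γ.carrier, |u x| ≤ B) : UpperSemicontinuousOn (Γ.uscExtension u) Γ.carrier := by
  intro x hx c hc
  by_cases hb : x ∈ Γ.boundaryVertices
  · obtain ⟨i, hi, rfl⟩ := hb
    refine eventually_carrier fun e he => ?_
    have h1 : ∀ᶠ y in 𝓝[openEdge e] (Γ.vert i), u y < c :=
      (eventually_lt_of_uscExtension_lt hB hi hc).filter_mono (nhdsWithin_mono _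
        (subset_iUnion (fun e : {e : Γ.Edge // Γ.vert i ∈ closedEdge e} => openEdge e.1) ⟨e, he⟩))
    -- The other vertices are finitely many, so nearby points lie in open edges, where the extension
    -- is `u`, or coincide with the vertex.
    have h2 : (range Γ.vert \ {Γ.vert i})ᶜ ∈ 𝓝 (Γ.vert i) :=
      ((finite_range Γ.vert).subset sdiff_subset).isClosed.isOpen_compl.mem_nhds
        fun h => h.2 rfl
    filter_upwards [eventually_nhdsWithin_iff.1 h1 |>.filter_mono nhdsWithin_le_nhds,
      nhdsWithin_le_nhds h2, self_mem_nhdsWithin] with y hy1 hy2 hy3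
    rcases mem_openEdge_or_vert e hy3 with hy | hy
    · rw [uscExtension_openEdge e hy]
      exact hy1 hy
    · have : y = Γ.vert i := by
        by_contra hne
        exact hy2 ⟨hy, hne⟩
      rwa [this]
  · rw [uscExtension_of_notMem hb] at hc
    filter_upwards [hu x hx c hc, self_mem_nhdsWithin] with y hy hyc
    exact (uscExtension_le_self hu hB hyc).trans_lt hy

theorem uscExtension_limsup_ray (hu : UpperSemicontinuousOn u Γ.carrier)
    (hB : ∀ x ∈ Γ.carrier, |u x| ≤ B) (i : Γ.Vertex) (e : Γ.Inc i) :
    ∀ ε > 0, ∀ᶠ t in 𝓝[>] 0, u (ray i e t) < Γ.uscExtension u (Γ.vert i) + ε := by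
  intro ε hε
  rcases em (Γ.IsBoundaryVertex i) with hi | hi
  · exact (tendsto_ray_edgeFilter i e).eventually
      (eventually_lt_of_uscExtension_lt hB hi (by linarith))
  · rw [uscExtension_of_notMem (fun h => hi ((vert_mem_boundaryVertices_iff i).1 h))]
    exact ((tendsto_ray_edgeFilter i e).mono_right (edgeFilter_le _)).eventually
      (hu _ (vert_mem_carrier i e) _ (by linarith))

theorem neg_le_uscExtension_vert (hu : UpperSemicontinuousOn u Γ.carrier)
    (hB : ∀ x ∈ Γ.carrier, |u x| ≤ B) (i : Γ.Vertex) : -B ≤ Γ.uscExtension u (Γ.vert i) := by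
  obtain ⟨e⟩ := nonempty_inc i
  refine le_of_forall_pos_le_add fun ε hε => ?_
  obtain ⟨t, ht1, ht2⟩ := ((uscExtension_limsup_ray hu hB i e ε hε).and
    (Ioo_mem_nhdsGT (length_pos e.1))).exists
  exact (abs_le.1 (hB _ (ray_mem_carrier i e ht2))).1.trans ht1.le

end Extension

/-! ### Comparison -/

section Comparison

variable {lam : ℝ} {a : Γ.Edge → EuclideanSpace ℝ (Fin d) → ℝ}
  {H : Γ.Edge → EuclideanSpace ℝ (Fin d) → ℝ → ℝ}
  {F : ∀ i : Γ.Vertex, ℝ × (Γ.Inc i → ℝ) → ℝ} {h : Γ.Vertex → ℝ}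
  {u v : EuclideanSpace ℝ (Fin d) → ℝ} {B : ℝ}

/-- At an interior vertex the admissible slopes of a subsolution along an edge are bounded below. -/
theorem exists_not_admits (hF : ∀ i : Γ.Vertex, Γ.IsInteriorVertex i → Γ.IsKirchhoff i (F i))
    (hu : Γ.IsViscositySubsolution lam a H F h u) {i : Γ.Vertex} (hi : Γ.IsInteriorVertex i)
    (hex : ∀ e : Γ.Inc i, ∃ r, Admits lam (fun t => a e.1 (ray i e t)) (rayHam i e H)
      (fun t => u (ray i e t)) (u (Γ.vert i)) r) (e : Γ.Inc i) :
    ∃ R, ∀ r < R, ¬ Admits lam (fun t => a e.1 (ray i e t)) (rayHam i e H)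
      (fun t => u (ray i e t)) (u (Γ.vert i)) r := by
  choose p hp using hex
  obtain ⟨R, hR⟩ := eventually_atBot.1
    (((hF i hi).tendsto e (u (Γ.vert i)) p).eventually (eventually_gt_atTop 0))
  refine ⟨R, fun r hr had => ?_⟩
  have h1 := hR r hr.le
  -- With admissible slopes fixed on the other edges, a very negative admissible slope on `e` would
  -- make `F` positive, against `of_admits`.
  have h2 := (hu.of_admits i (Function.update p e r) fun f => by
    by_cases hf : f = e
    · subst hf
      rwa [Function.update_self]
    · rw [Function.update_of_ne hf]
      exact hp f).1 hi
  linarith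

/-- The extension is upper semicontinuous on the compact network, so a violation produces a positive
maximum. It is excluded in turn in the open edges, at interior vertices and at boundary vertices. -/
theorem uscExtension_le_supersolution (hlam : 0 < lam)
    (hH : ∀ e : Γ.Edge, HamiltonianRegular e (H e)) (ha : ∀ e : Γ.Edge, DiffusionRegular e (a e))
    (hF : ∀ i : Γ.Vertex, Γ.IsInteriorVertex i → Γ.IsKirchhoff i (F i))
    (hcoer : ∀ (i : Γ.Vertex) (e : Γ.Inc i),
      CoerciveNear e.1 (H e.1) (Γ.vert i) ∨ 0 < a e.1 (Γ.vert i))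
    (hu : Γ.IsViscositySubsolution lam a H F h u) (huB : ∀ x ∈ Γ.carrier, |u x| ≤ B)
    (hv : Γ.IsViscositySupersolution lam a H F h v) (hvB : ∀ x ∈ Γ.carrier, |v x| ≤ B) :
    ∀ x ∈ Γ.carrier, Γ.uscExtension u x ≤ v x := by
  by_contra! hcon
  obtain ⟨x₁, hx₁, hlt₁⟩ := hcon
  have hw := hv.neg
  have hwB : ∀ x ∈ Γ.carrier, |(-v x)| ≤ B := fun x hx => by rw [abs_neg]; exact hvB x hx
  have husc : UpperSemicontinuousOn (fun x => Γ.uscExtension u x + -v x) Γ.carrier :=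
    (upperSemicontinuousOn_uscExtension hu.usc huB).add hw.usc
  obtain ⟨x₀, hx₀, hmax⟩ := husc.exists_isMaxOn carrier_nonempty isCompact_carrier
  rw [isMaxOn_iff] at hmax
  obtain ⟨M, hM⟩ : ∃ M, M = Γ.uscExtension u x₀ + -v x₀ := ⟨_, rfl⟩
  rw [← hM] at hmax
  have hMp : 0 < M := by
    have := hmax x₁ hx₁
    linarith
  have hsw : ∀ (i : Γ.Vertex) (e : Γ.Inc i), IsParabolicSub lam (length e.1)
      (fun t => a e.1 (ray i e t)) (dualHam (rayHam i e H)) (fun t => -v (ray i e t)) :=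
    fun i e => by
      have := hw.isParabolicSub i e
      rwa [rayHam_dual] at this
  have hle : ∀ (i : Γ.Vertex) (e : Γ.Inc i), ∀ t ∈ Ioo 0 (length e.1),
      u (ray i e t) + -v (ray i e t) ≤ M := fun i e t ht => by
    have := hmax _ (ray_mem_carrier i e ht)
    rwa [uscExtension_openEdge e.1 (ray_mem_openEdge i e ht)] at this
  have hlt : ∀ (i : Γ.Vertex) (e : Γ.Inc i), ∀ t ∈ Ioo 0 (length e.1),
      u (ray i e t) + -v (ray i e t) < M := by
    intro i e t ht
    refine lt_of_le_of_ne (hle i e t ht) fun heq => ?_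
    obtain ⟨C, hR⟩ := regularCoeff_ray i e (hH e.1) (ha e.1)
    have h1 := interior_comparison hlam hR (hu.isParabolicSub i e) (hsw i e) (hu.usc_ray i e)
      (hw.usc_ray i e) (B := B) (fun s hs => huB _ (ray_mem_carrier i e hs))
      (fun s hs => hwB _ (ray_mem_carrier i e hs)) (κ := 0) ht (by
        filter_upwards [Ioo_mem_nhds ht.1 ht.2] with s hs
        have := hle i e s hs
        linarith)
    rw [heq, abs_zero, mul_zero] at h1
    have : 0 < lam * M := by positivity
    linarith
  obtain ⟨i, rfl⟩ : ∃ i, Γ.vert i = x₀ := by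
    obtain ⟨e, he⟩ := mem_iUnion.1 hx₀
    refine (mem_openEdge_or_vert e he).resolve_left fun hopen => ?_
    let f : Γ.Inc e.1.1 := ⟨e, left_mem_segment _ _ _⟩
    obtain ⟨h1, h2⟩ := exists_ray_eq e.1.1 f he
    have h3 : dist x₀ (Γ.vert e.1.1) ∈ Ioo 0 (length e) := by
      refine ⟨dist_pos.2 ?_, lt_of_le_of_ne h1.2 fun heq => ?_⟩
      · rintro rfl
        exact vert_notMem_openEdge e _ hopen
      · have h4 := param_coord e he
        rw [coord, dist_comm, source, heq, param_length] at h4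
        rw [← h4] at hopen
        exact vert_notMem_openEdge e e.1.2 hopen
    have h4 := hlt _ f _ h3
    rw [h2, ← uscExtension_openEdge (u := u) e hopen] at h4
    linarith
  have hcoer' : ∀ e : Γ.Inc i, CoerciveAtZero (rayHam i e H) ∨ 0 < a e.1 (ray i e 0) :=
    fun e => by
      rw [ray_zero]
      exact (hcoer i e).imp_left (coerciveAtZero_ray i e)
  have hu₀ := uscExtension_limsup_ray hu.usc huB i
  have hw₀ := hw.limsup_ray i
  have hinc := nonempty_inc i
  rcases interior_or_boundary i with hi | hi
  · have hext : Γ.uscExtension u (Γ.vert i) = u (Γ.vert i) :=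
      uscExtension_of_notMem fun hb =>
        (ne_of_gt hi : Nat.card (Γ.Inc i) ≠ 1) ((vert_mem_boundaryVertices_iff i).1 hb)
    rw [hext] at hM hu₀
    have hu₀B := (abs_le.1 (huB _ hx₀)).1
    have hadm := exists_not_admits hF hu hi fun e => by
      obtain ⟨C, hR⟩ := regularCoeff_ray i e (hH e.1) (ha e.1)
      exact exists_admits hlam (length_pos e.1) hR (hu.isParabolicSub i e) (hu.usc_ray i e)
        (fun s hs => huB _ (ray_mem_carrier i e hs)) hu₀B (hu₀ e) (hcoer' e)
    have hpair : ∀ e : Γ.Inc i, ∃ r r', r < r' ∧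
        Admits lam (fun t => a e.1 (ray i e t)) (rayHam i e H) (fun t => u (ray i e t))
          (u (Γ.vert i)) r ∧
        Admits lam (fun t => a e.1 (ray i e t)) (dualHam (rayHam i e H))
          (fun t => -v (ray i e t)) (-v (Γ.vert i)) (-r') := by
      intro e
      obtain ⟨C, hR⟩ := regularCoeff_ray i e (hH e.1) (ha e.1)
      obtain ⟨κ, hκ, hdecay⟩ := exists_linear_decay hlam (length_pos e.1) hR
        (hu.isParabolicSub i e) (hsw i e) (hu.usc_ray i e) (hw.usc_ray i e)
        (fun s hs => huB _ (ray_mem_carrier i e hs))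
        (fun s hs => hwB _ (ray_mem_carrier i e hs)) hMp (hlt i e) (fun ε hε => by
          filter_upwards [hu₀ e (ε / 2) (by linarith), hw₀ e (ε / 2) (by linarith)] with t h1 h2
          linarith)
      exact exists_admits_pair hlam (length_pos e.1) hR (hu.isParabolicSub i e) (hsw i e)
        (hu.usc_ray i e) (hw.usc_ray i e) (fun s hs => huB _ (ray_mem_carrier i e hs)) hu₀B
        (hu₀ e) (hcoer' e) (hM ▸ hMp) (fun t ht => hM ▸ hle i e t ht) hκ (hM ▸ hdecay) (hadm e)
    choose r r' hrr' hr hr' using hpair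
    have h1 := (hu.of_admits i r hr).1 hi
    have h2 := (hw.of_admits i (fun e => -r' e) fun e => by
      rw [rayHam_dual]
      exact hr' e).1 hi
    have h3 : (-fun e => -r' e) = r' := by
      ext e
      simp
    simp only [neg_neg, h3] at h2
    obtain ⟨e⟩ := hinc
    -- Strictness needs one edge with `r e < r' e`; every incident edge has this property, and there
    -- is at least one.
    have h4 := (hF i hi).strict (u (Γ.vert i)) (v (Γ.vert i)) r r' (by linarith)
      (fun e => (hrr' e).le) ⟨e, hrr' e⟩
    linarith
  · have hle_self := uscExtension_le_self hu.usc huB hx₀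
    -- The boundary condition is tested at the actual value of `u`, which may exceed the extension;
    -- large slopes are admissible for it all the same.
    have h1 : u (Γ.vert i) - h i ≤ 0 := by
      have hex : ∀ e : Γ.Inc i, ∃ r, Admits lam (fun t => a e.1 (ray i e t)) (rayHam i e H)
          (fun t => u (ray i e t)) (u (Γ.vert i)) r := fun e => by
        obtain ⟨C, hR⟩ := regularCoeff_ray i e (hH e.1) (ha e.1)
        exact exists_admits hlam (length_pos e.1) hR (hu.isParabolicSub i e) (hu.usc_ray i e)
          (fun s hs => huB _ (ray_mem_carrier i e hs)) (abs_le.1 (huB _ hx₀)).1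
          (hu.limsup_ray i e) (hcoer' e)
      choose r hr using hex
      exact (hu.of_admits i r hr).2 hi
    -- Here the value of `u` at the vertex is taken to be the extension, so that it is approached
    -- along the edge.
    have h2 : -v (Γ.vert i) - -h i ≤ 0 := by
      have hex : ∀ e : Γ.Inc i, ∃ r, Admits lam (fun t => a e.1 (ray i e t))
          (dualHam (rayHam i e H)) (fun t => -v (ray i e t)) (-v (Γ.vert i)) r := fun e => by
        obtain ⟨C, hR⟩ := regularCoeff_ray i e (hH e.1) (ha e.1)
        exact exists_admits_dual hlam (length_pos e.1) hR (hu.isParabolicSub i e) (hsw i e)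
          (hu.usc_ray i e) (hw.usc_ray i e) (fun s hs => huB _ (ray_mem_carrier i e hs))
          (fun s hs => hwB _ (ray_mem_carrier i e hs)) (abs_le.1 (hwB _ hx₀)).1
          (neg_le_uscExtension_vert hu.usc huB i) (hu₀ e) (hw₀ e)
          (fun ε hε => frequently_ray_of_lt_uscExtension huB hi e (by linarith))
          (hcoer' e) (hM ▸ hMp) (fun t ht => hM ▸ hle i e t ht)
      choose r hr using hex
      exact (hw.of_admits i r fun e => by
        rw [rayHam_dual]
        exact hr e).2 hi
    linarith

end Comparison

end EmbeddedNetwork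

theorem theorem5p4 {d : ℕ} (Γ : EmbeddedNetwork d) (lam : ℝ) (hlam : 0 < lam)
    (a : Γ.Edge → EuclideanSpace ℝ (Fin d) → ℝ)
    (H : Γ.Edge → EuclideanSpace ℝ (Fin d) → ℝ → ℝ)
    (F : ∀ i : Γ.Vertex, ℝ × (Γ.Inc i → ℝ) → ℝ) (h : Γ.Vertex → ℝ)
    (hH : ∀ e : Γ.Edge, EmbeddedNetwork.HamiltonianRegular e (H e))
    (ha : ∀ e : Γ.Edge, EmbeddedNetwork.DiffusionRegular e (a e))
    (hF : ∀ i : Γ.Vertex, Γ.IsInteriorVertex i → Γ.IsKirchhoff i (F i))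
    (hcoer : ∀ (i : Γ.Vertex) (e : Γ.Inc i),
      EmbeddedNetwork.CoerciveNear e.1 (H e.1) (Γ.vert i) ∨ 0 < a e.1 (Γ.vert i))
    (u v : EuclideanSpace ℝ (Fin d) → ℝ)
    (hu : Γ.IsViscositySubsolution lam a H F h u) (hub : ∃ M : ℝ, ∀ x ∈ Γ.carrier, |u x| ≤ M)
    (hv : Γ.IsViscositySupersolution lam a H F h v) (hvb : ∃ M : ℝ, ∀ x ∈ Γ.carrier, |v x| ≤ M) :
    (∀ x ∈ Γ.carrier \ Γ.boundaryVertices, u x ≤ v x) ∧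
      ∀ x ∈ Γ.carrier, Γ.uscExtension u x ≤ v x := by
  obtain ⟨M₁, hM₁⟩ := hub
  obtain ⟨M₂, hM₂⟩ := hvb
  have key := EmbeddedNetwork.uscExtension_le_supersolution hlam hH ha hF hcoer hu
    (fun x hx => (hM₁ x hx).trans (le_max_left M₁ M₂)) hv
    (fun x hx => (hM₂ x hx).trans (le_max_right M₁ M₂))
  refine ⟨fun x hx => ?_, key⟩
  have := key x hx.1
  rwa [EmbeddedNetwork.uscExtension_of_notMem hx.2] at this
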